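/- Let $k$ be a perfect field of characteristic $p>0$, $W=W(k)$ its ring of Witt vectors with Frobenius automorphism $\sigma$, and $K$ the field of fractions of $W$. Let $R$ be the Raynaud ring: the graded $W$-algebra generated by $F,V$ in degree $0$ and $d$ in degree $1$ with the relations $FV=p=VF$, $Fa=\sigma(a)F$, $aV=V\sigma(a)$, $d^2=0$, $FdV=d$, $ad=da$ $(a\in W)$. For a graded $R$-module $M$ let $M\{n\}$ be its degree shift, $M\{n\}^i=M^{n+i}$ with $d$ multiplied by $(-1)^n$. A graded $R$-module is *elementary* if either (I) it is concentrated in degree $0$, finitely generated over $W$, and $V$ is topologically nilpotent on it; or (II) it is isomorphic, for some $l\in\mathbb{Z}$, to $U_l\colon \prod_{n\ge 0}kV^n\xrightarrow{\,d\,}\prod_{n\ge l}k\,dV^n$ (degrees $0$ and $1$), where $F$ is zero in degree $0$, $V$ is zero in degree $1$, and $dV^{n}$ means $F^{-n}d$ for $n<0$. A graded $R$-module is *coherent* if it has a finite filtration whose quotients are degree shifts of elementary modules. Let $\mathsf{D}^b_c(R)$ be the full subcategory of the derived category of graded $R$-modules whose objects are the bounded complexes with coherent cohomology modules $H^j(M)$.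 For a coherent graded $R$-module $N$ let $V^{-\infty}Z^i(N)=\{x\in N^i\mid dV^nx=0 \text{ for all } n\ge 0\}$, and let $$T^i(N)=\dim_k\bigl(N^i/(V^{-\infty}Z^i(N)+VN^i)\bigr),$$ the dimension of the domino attached to $d\colon N^i\to N^{i+1}$. For $M$ in $\mathsf{D}^b_c(R)$ put $T^{i,j}(M)=T^i(H^j(M))$, $$m^{i,j}(M)=\dim_k\frac{H^j(M)^i}{H^j(M)^i_{\mathrm{tors}}+V(H^j(M)^i)}+\dim_k\frac{H^{j+1}(M)^{i-1}}{H^{j+1}(M)^{i-1}_{\mathrm{tors}}+F(H^{j+1}(M)^{i-1})},$$ $$h_W^{i,j}(M)=m^{i,j}(M)+T^{i,j}(M)-2T^{i-1,j+1}(M)+T^{i-2,j+2}(M),$$ and let $(\lambda_{i,j,l})_l$ be the family of slopes, with multiplicities, of the $F$-isocrystal $H^j(M)^i_K=K\otimes_W H^j(M)^i$. **Theorem.** For every $M$ in $\mathsf{D}^b_c(R)$, all these dimensions are finite, only finitely many of the numbers $h_W^{i,j}(M)$ and $T^{i,j}(M)$ are nonzero, there are only finitely many slopes $\lambda_{i,j,l}$,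 and for every $r\in\mathbb{Z}$ $$\sum_{i,j\ (i\le r)}(-1)^{i+j}(r-i)\,h_W^{i,j}(M)=e_r(M),$$ where $$e_r(M)=\sum_{j}(-1)^{j-1}T^{r-1,j-r}(M)+\sum_{i,j,l\ (\lambda_{i,j,l}\le r-i)}(-1)^{i+j}(r-i-\lambda_{i,j,l}).$$ -/

import Mathlib

open CategoryTheory CategoryTheory.Limits
open scoped TensorProduct Isocrystal

universe w u

noncomputable section

/-! ## Graded modules over the Raynaud ring

The Raynaud ring of a perfect field `k` of characteristic `p` is the graded `W(k)`-algebra with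
generators `F`, `V` (degree `0`) and `d` (degree `1`) and relations `FV = p = VF`, `F a = σ(a) F`,
`a V = V σ(a)`, `d² = 0`, `F d V = d`, `a d = d a` for `a ∈ W(k)`. -/

/-- A graded left module over the Raynaud ring of `k`: a family `(M i)`, `i ∈ ℤ`, of
`W(k)`-modules with operators `F`, `V : M i → M i` and `d : M i → M (i + 1)` that satisfy the
relations of the ring. -/
structure RaynaudModule (p : ℕ) [Fact p.Prime] (k : Type u) [Field k] [CharP k p] :
    Type (u + 1) where
  X : ℤ → Type u
  [addCommGroup : ∀ i, AddCommGroup (X i)]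
  [module : ∀ i, Module (WittVector p k) (X i)]
  F : ∀ i, X i →+ X i
  V : ∀ i, X i →+ X i
  d : ∀ i j, i + 1 = j → (X i →+ X j)
  F_V : ∀ i (x : X i), F i (V i x) = (p : WittVector p k) • x
  V_F : ∀ i (x : X i), V i (F i x) = (p : WittVector p k) • x
  F_smul : ∀ i (a : WittVector p k) (x : X i),
    F i (a • x) = WittVector.frobenius a • F i x
  smul_V : ∀ i (a : WittVector p k) (x : X i),
    a • V i x = V i (WittVector.frobenius a • x)
  d_d : ∀ i j l (h : i + 1 = j) (h' : j + 1 = l) (x : X i), d j l h' (d i j h x) = 0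
  F_d_V : ∀ i j (h : i + 1 = j) (x : X i), F j (d i j h (V i x)) = d i j h x
  d_smul : ∀ i j (h : i + 1 = j) (a : WittVector p k) (x : X i),
    d i j h (a • x) = a • d i j h x

namespace RaynaudModule

attribute [instance] RaynaudModule.addCommGroup RaynaudModule.module

variable {p : ℕ} [Fact p.Prime] {k : Type u} [Field k] [CharP k p]

/-- Homomorphisms of degree `0` of graded modules over the Raynaud ring. -/
@[ext]
structure Hom (M N : RaynaudModule p k) : Type u where
  f : ∀ i, M.X i →ₗ[WittVector p k] N.X i
  comm_F : ∀ i (x : M.X i), f i (M.F i x) = N.F i (f i x)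
  comm_V : ∀ i (x : M.X i), f i (M.V i x) = N.V i (f i x)
  comm_d : ∀ i j (h : i + 1 = j) (x : M.X i), f j (M.d i j h x) = N.d i j h (f i x)

instance : Category (RaynaudModule p k) where
  Hom := Hom
  id M := ⟨fun _ => LinearMap.id, fun _ _ => rfl, fun _ _ => rfl, fun _ _ _ _ => rfl⟩
  comp φ ψ := ⟨fun i => (ψ.f i).comp (φ.f i),
    fun i x => by simp [φ.comm_F, ψ.comm_F],
    fun i x => by simp [φ.comm_V, ψ.comm_V],
    fun i j h x => by simp [φ.comm_d, ψ.comm_d]⟩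

@[ext]
theorem hom_ext {M N : RaynaudModule p k} {φ ψ : M ⟶ N}
    (h : ∀ i (x : M.X i), φ.f i x = ψ.f i x) : φ = ψ :=
  Hom.ext (funext fun i => LinearMap.ext (h i))

@[simp] theorem id_f (M : RaynaudModule p k) (i : ℤ) (x : M.X i) : Hom.f (𝟙 M) i x = x := rfl

@[simp] theorem comp_f {M N P : RaynaudModule p k} (φ : M ⟶ N) (ψ : N ⟶ P) (i : ℤ) (x : M.X i) :
    Hom.f (φ ≫ ψ) i x = ψ.f i (φ.f i x) := rfl

section Additive

variable {M N : RaynaudModule p k}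

instance : Zero (M ⟶ N) := ⟨⟨fun _ => 0, by simp, by simp, by simp⟩⟩

instance : Add (M ⟶ N) := ⟨fun φ ψ => ⟨fun i => φ.f i + ψ.f i,
  by simp [φ.comm_F, ψ.comm_F], by simp [φ.comm_V, ψ.comm_V], by simp [φ.comm_d, ψ.comm_d]⟩⟩

instance : Neg (M ⟶ N) := ⟨fun φ => ⟨fun i => -φ.f i,
  by simp [φ.comm_F], by simp [φ.comm_V], by simp [φ.comm_d]⟩⟩

@[simp] theorem zero_f (i : ℤ) (x : M.X i) : Hom.f (0 : M ⟶ N) i x = 0 := rfl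

@[simp] theorem add_f (φ ψ : M ⟶ N) (i : ℤ) (x : M.X i) :
    Hom.f (φ + ψ) i x = φ.f i x + ψ.f i x := rfl

@[simp] theorem neg_f (φ : M ⟶ N) (i : ℤ) (x : M.X i) : Hom.f (-φ) i x = -φ.f i x := rfl

instance : AddCommGroup (M ⟶ N) where
  add_assoc a b c := by ext i x; simp [add_assoc]
  zero_add a := by ext i x; simp
  add_zero a := by ext i x; simp
  neg_add_cancel a := by ext i x; simp
  add_comm a b := by ext i x; simp [add_comm]
  nsmul := nsmulRec
  zsmul := zsmulRec

end Additive

instance : Preadditive (RaynaudModule p k) where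
  homGroup M N := inferInstance
  add_comp M N P a b c := by ext i x; simp
  comp_add M N P a b c := by ext i x; simp

/-- The zero module. -/
def zeroModule (p : ℕ) [Fact p.Prime] (k : Type u) [Field k] [CharP k p] : RaynaudModule p k where
  X _ := PUnit.{u + 1}
  F _ := 0
  V _ := 0
  d _ _ _ := 0
  F_V _ _ := rfl
  V_F _ _ := rfl
  F_smul _ _ _ := rfl
  smul_V _ _ _ := rfl
  d_d _ _ _ _ _ _ := rfl
  F_d_V _ _ _ _ := rfl
  d_smul _ _ _ _ _ := rfl

instance : HasZeroObject (RaynaudModule p k) :=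
  ⟨zeroModule p k, by
    rw [IsZero.iff_id_eq_zero]; ext i x; rfl⟩

/-- The direct sum of two graded modules. -/
def prod (M N : RaynaudModule p k) : RaynaudModule p k where
  X i := M.X i × N.X i
  F i := (M.F i).prodMap (N.F i)
  V i := (M.V i).prodMap (N.V i)
  d i j h := (M.d i j h).prodMap (N.d i j h)
  F_V i _ := Prod.ext (M.F_V i _) (N.F_V i _)
  V_F i _ := Prod.ext (M.V_F i _) (N.V_F i _)
  F_smul i a _ := Prod.ext (M.F_smul i a _) (N.F_smul i a _)
  smul_V i a _ := Prod.ext (M.smul_V i a _) (N.smul_V i a _)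
  d_d i j l h h' _ := Prod.ext (M.d_d i j l h h' _) (N.d_d i j l h h' _)
  F_d_V i j h _ := Prod.ext (M.F_d_V i j h _) (N.F_d_V i j h _)
  d_smul i j h a _ := Prod.ext (M.d_smul i j h a _) (N.d_smul i j h a _)

instance : HasBinaryBiproducts (RaynaudModule p k) where
  has_binary_biproduct M N := HasBinaryBiproduct.mk
    { bicone :=
        { pt := prod M N
          fst := ⟨fun i => LinearMap.fst _ _ _, fun _ _ => rfl, fun _ _ => rfl, fun _ _ _ _ => rfl⟩
          snd := ⟨fun i => LinearMap.snd _ _ _, fun _ _ => rfl, fun _ _ => rfl, fun _ _ _ _ => rfl⟩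
          inl := ⟨fun i => LinearMap.inl _ _ _, fun i x => Prod.ext rfl (map_zero (N.F i)).symm,
            fun i x => Prod.ext rfl (map_zero (N.V i)).symm,
            fun i j h x => Prod.ext rfl (map_zero (N.d i j h)).symm⟩
          inr := ⟨fun i => LinearMap.inr _ _ _, fun i x => Prod.ext (map_zero (M.F i)).symm rfl,
            fun i x => Prod.ext (map_zero (M.V i)).symm rfl,
            fun i j h x => Prod.ext (map_zero (M.d i j h)).symm rfl⟩
          inl_fst := by ext; rfl
          inl_snd := by ext; rfl
          inr_fst := by ext; rfl
          inr_snd := by ext; rfl }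
      isBilimit := isBinaryBilimitOfTotal _ (by
        ext i x
        exact Prod.ext (add_zero _) (zero_add _)) }

instance : HasFiniteProducts (RaynaudModule p k) :=
  hasFiniteProducts_of_has_binary_and_terminal

/-- A family of submodules that is stable under `F`, `V` and `d`. -/
structure Stable (M : RaynaudModule p k) where
  S : ∀ i, Submodule (WittVector p k) (M.X i)
  F_mem : ∀ i x, x ∈ S i → M.F i x ∈ S i
  V_mem : ∀ i x, x ∈ S i → M.V i x ∈ S i
  d_mem : ∀ i j h x, x ∈ S i → M.d i j h x ∈ S j

/-- The graded submodule given by a stable family of submodules. -/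
def Stable.sub {M : RaynaudModule p k} (T : M.Stable) : RaynaudModule p k where
  X i := T.S i
  F i := ((M.F i).comp (T.S i).subtype.toAddMonoidHom).codRestrict (T.S i)
    fun x => T.F_mem i _ x.2
  V i := ((M.V i).comp (T.S i).subtype.toAddMonoidHom).codRestrict (T.S i)
    fun x => T.V_mem i _ x.2
  d i j h := ((M.d i j h).comp (T.S i).subtype.toAddMonoidHom).codRestrict (T.S j)
    fun x => T.d_mem i j h _ x.2
  F_V i _ := Subtype.ext (M.F_V i _)
  V_F i _ := Subtype.ext (M.V_F i _)
  F_smul i a _ := Subtype.ext (M.F_smul i a _)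
  smul_V i a _ := Subtype.ext (M.smul_V i a _)
  d_d i j l h h' _ := Subtype.ext (M.d_d i j l h h' _)
  F_d_V i j h _ := Subtype.ext (M.F_d_V i j h _)
  d_smul i j h a _ := Subtype.ext (M.d_smul i j h a _)

/-- The graded quotient module by a stable family of submodules. -/
def Stable.quot {M : RaynaudModule p k} (T : M.Stable) : RaynaudModule p k where
  X i := M.X i ⧸ T.S i
  F i := QuotientAddGroup.map (T.S i).toAddSubgroup (T.S i).toAddSubgroup (M.F i) (T.F_mem i)
  V i := QuotientAddGroup.map (T.S i).toAddSubgroup (T.S i).toAddSubgroup (M.V i) (T.V_mem i)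
  d i j h := QuotientAddGroup.map (T.S i).toAddSubgroup (T.S j).toAddSubgroup (M.d i j h)
    (T.d_mem i j h)
  F_V i x := by
    obtain ⟨x, rfl⟩ := (T.S i).mkQ_surjective x
    exact congrArg (T.S i).mkQ (M.F_V i x)
  V_F i x := by
    obtain ⟨x, rfl⟩ := (T.S i).mkQ_surjective x
    exact congrArg (T.S i).mkQ (M.V_F i x)
  F_smul i a x := by
    obtain ⟨x, rfl⟩ := (T.S i).mkQ_surjective x
    exact congrArg (T.S i).mkQ (M.F_smul i a x)
  smul_V i a x := by
    obtain ⟨x, rfl⟩ := (T.S i).mkQ_surjective x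
    exact congrArg (T.S i).mkQ (M.smul_V i a x)
  d_d i j l h h' x := by
    obtain ⟨x, rfl⟩ := (T.S i).mkQ_surjective x
    exact congrArg (T.S l).mkQ (M.d_d i j l h h' x)
  F_d_V i j h x := by
    obtain ⟨x, rfl⟩ := (T.S i).mkQ_surjective x
    exact congrArg (T.S j).mkQ (M.F_d_V i j h x)
  d_smul i j h a x := by
    obtain ⟨x, rfl⟩ := (T.S i).mkQ_surjective x
    exact congrArg (T.S j).mkQ (M.d_smul i j h a x)

/-- The inclusion of a graded submodule. -/
def Stable.ι {M : RaynaudModule p k} (T : M.Stable) : T.sub ⟶ M :=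
  ⟨fun i => (T.S i).subtype, fun _ _ => rfl, fun _ _ => rfl, fun _ _ _ _ => rfl⟩

/-- The projection to a graded quotient module. -/
def Stable.π {M : RaynaudModule p k} (T : M.Stable) : M ⟶ T.quot :=
  ⟨fun i => (T.S i).mkQ, fun _ _ => rfl, fun _ _ => rfl, fun _ _ _ _ => rfl⟩

/-- Homomorphisms into `M` with values in a graded submodule factor through it. -/
def Stable.lift {M N : RaynaudModule p k} (T : M.Stable) (φ : N ⟶ M)
    (hφ : ∀ i x, φ.f i x ∈ T.S i) : N ⟶ T.sub :=
  ⟨fun i => (φ.f i).codRestrict (T.S i) (hφ i), fun i x => Subtype.ext (φ.comm_F i x),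
    fun i x => Subtype.ext (φ.comm_V i x), fun i j h x => Subtype.ext (φ.comm_d i j h x)⟩

/-- Homomorphisms that vanish on a graded submodule factor through the quotient by it. -/
def Stable.desc {M N : RaynaudModule p k} (T : M.Stable) (φ : M ⟶ N)
    (hφ : ∀ i x, x ∈ T.S i → φ.f i x = 0) : T.quot ⟶ N :=
  ⟨fun i => (T.S i).liftQ (φ.f i) (hφ i),
    fun i x => by
      obtain ⟨x, rfl⟩ := (T.S i).mkQ_surjective x
      exact φ.comm_F i x,
    fun i x => by
      obtain ⟨x, rfl⟩ := (T.S i).mkQ_surjective x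
      exact φ.comm_V i x,
    fun i j h x => by
      obtain ⟨x, rfl⟩ := (T.S i).mkQ_surjective x
      exact φ.comm_d i j h x⟩

/-- The kernel of a homomorphism, as a graded submodule. -/
def kerStable {M N : RaynaudModule p k} (φ : M ⟶ N) : M.Stable where
  S i := LinearMap.ker (φ.f i)
  F_mem i x hx := by
    rw [LinearMap.mem_ker] at hx ⊢; rw [φ.comm_F, hx, map_zero]
  V_mem i x hx := by
    rw [LinearMap.mem_ker] at hx ⊢; rw [φ.comm_V, hx, map_zero]
  d_mem i j h x hx := by
    rw [LinearMap.mem_ker] at hx ⊢; rw [φ.comm_d, hx, map_zero]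

/-- The image of a homomorphism, as a graded submodule. -/
def rangeStable {M N : RaynaudModule p k} (φ : M ⟶ N) : N.Stable where
  S i := LinearMap.range (φ.f i)
  F_mem i x hx := by
    obtain ⟨y, rfl⟩ := hx; exact ⟨M.F i y, φ.comm_F i y⟩
  V_mem i x hx := by
    obtain ⟨y, rfl⟩ := hx; exact ⟨M.V i y, φ.comm_V i y⟩
  d_mem i j h x hx := by
    obtain ⟨y, rfl⟩ := hx; exact ⟨M.d i j h y, φ.comm_d i j h y⟩

theorem ι_comp {M N : RaynaudModule p k} (φ : M ⟶ N) : (kerStable φ).ι ≫ φ = 0 := by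
  ext i x; exact x.2

theorem comp_π {M N : RaynaudModule p k} (φ : M ⟶ N) : φ ≫ (rangeStable φ).π = 0 := by
  ext i x
  exact (Submodule.Quotient.mk_eq_zero _).2 ⟨x, rfl⟩

/-- Degreewise kernels are kernels. -/
def kerIsLimit {M N : RaynaudModule p k} (φ : M ⟶ N) :
    IsLimit (KernelFork.ofι (kerStable φ).ι (ι_comp φ)) :=
  KernelFork.IsLimit.ofι _ _
    (fun g hg => (kerStable φ).lift g fun i x => congrArg (fun ψ => Hom.f ψ i x) hg)
    (fun g hg => by ext i x; rfl)
    (fun g hg m hm => by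
      ext i x
      exact Subtype.ext (congrArg (fun ψ => Hom.f ψ i x) hm))

/-- Degreewise cokernels are cokernels. -/
def cokerIsColimit {M N : RaynaudModule p k} (φ : M ⟶ N) :
    IsColimit (CokernelCofork.ofπ (rangeStable φ).π (comp_π φ)) :=
  CokernelCofork.IsColimit.ofπ _ _
    (fun g hg => (rangeStable φ).desc g (by
      rintro i _ ⟨x, rfl⟩
      exact congrArg (fun ψ => Hom.f ψ i x) hg))
    (fun g hg => by ext i x; rfl)
    (fun g hg m hm => by
      ext i x
      obtain ⟨x, rfl⟩ := (LinearMap.range (φ.f i)).mkQ_surjective x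
      exact congrArg (fun ψ => Hom.f ψ i x) hm)

instance : HasKernels (RaynaudModule p k) := ⟨fun φ => ⟨⟨_, kerIsLimit φ⟩⟩⟩

instance : HasCokernels (RaynaudModule p k) := ⟨fun φ => ⟨⟨_, cokerIsColimit φ⟩⟩⟩

theorem injective_of_mono {M N : RaynaudModule p k} (φ : M ⟶ N) [Mono φ] (i : ℤ) :
    Function.Injective (φ.f i) := by
  rw [injective_iff_map_eq_zero]
  intro x hx
  have h : (kerStable φ).ι = 0 := by
    rw [← cancel_mono φ, ι_comp, zero_comp]
  exact congrArg (fun ψ => Hom.f ψ i (⟨x, hx⟩ : LinearMap.ker (φ.f i))) h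

theorem surjective_of_epi {M N : RaynaudModule p k} (φ : M ⟶ N) [Epi φ] (i : ℤ) :
    Function.Surjective (φ.f i) := by
  intro y
  have h : (rangeStable φ).π = 0 := by
    rw [← cancel_epi φ, comp_π, comp_zero]
  exact (Submodule.Quotient.mk_eq_zero _).1 (congrArg (fun ψ => Hom.f ψ i y) h)

/-- A degreewise bijective homomorphism, inverted. -/
def invOfBijective {M N : RaynaudModule p k} (φ : M ⟶ N)
    (hφ : ∀ i, Function.Bijective (φ.f i)) : N ⟶ M :=
  have key : ∀ i (x : N.X i), φ.f i ((LinearEquiv.ofBijective (φ.f i) (hφ i)).symm x) = x :=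
    fun i => (LinearEquiv.ofBijective (φ.f i) (hφ i)).apply_symm_apply
  ⟨fun i => ((LinearEquiv.ofBijective (φ.f i) (hφ i)).symm : N.X i →ₗ[WittVector p k] M.X i),
    fun i x => (hφ i).1 (by
      simp only [LinearEquiv.coe_coe]; rw [φ.comm_F, key, key]),
    fun i x => (hφ i).1 (by
      simp only [LinearEquiv.coe_coe]; rw [φ.comm_V, key, key]),
    fun i j h x => (hφ j).1 (by
      simp only [LinearEquiv.coe_coe]; rw [φ.comm_d, key, key])⟩

theorem isIso_of_bijective {M N : RaynaudModule p k} (φ : M ⟶ N)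
    (hφ : ∀ i, Function.Bijective (φ.f i)) : IsIso φ :=
  ⟨invOfBijective φ hφ, by
    ext i x
    exact (LinearEquiv.ofBijective (φ.f i) (hφ i)).symm_apply_apply x, by
    ext i x
    exact (LinearEquiv.ofBijective (φ.f i) (hφ i)).apply_symm_apply x⟩

/-- Graded modules over the Raynaud ring form an abelian category. -/
instance : Abelian (RaynaudModule p k) where
  normalMonoOfMono {M N} φ _ := by
    let l : M ⟶ (kerStable (rangeStable φ).π).sub :=
      (kerStable (rangeStable φ).π).lift φ fun i x =>
        congrArg (fun ψ => Hom.f ψ i x) (comp_π φ)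
    have : IsIso l := isIso_of_bijective l fun i => by
      refine ⟨fun x y h => injective_of_mono φ i (congrArg Subtype.val h), ?_⟩
      rintro ⟨y, hy⟩
      obtain ⟨x, rfl⟩ := (Submodule.Quotient.mk_eq_zero _).1 hy
      exact ⟨x, rfl⟩
    exact ⟨{ Z := (rangeStable φ).quot
             g := (rangeStable φ).π
             w := comp_π φ
             isLimit := IsLimit.ofIsoLimit (kerIsLimit (rangeStable φ).π)
               (Fork.ext (asIso l).symm (by
                 rw [Iso.symm_hom, asIso_inv, IsIso.inv_comp_eq]
                 ext i x; rfl)) }⟩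
  normalEpiOfEpi {M N} φ _ := by
    let l : (rangeStable (kerStable φ).ι).quot ⟶ N :=
      (rangeStable (kerStable φ).ι).desc φ (by
        rintro i _ ⟨x, rfl⟩
        exact x.2)
    have : IsIso l := isIso_of_bijective l fun i => by
      constructor
      · rw [injective_iff_map_eq_zero]
        intro x hx
        obtain ⟨x, rfl⟩ :=
          (LinearMap.range (Hom.f (kerStable φ).ι i)).mkQ_surjective x
        exact (Submodule.Quotient.mk_eq_zero _).2 ⟨⟨x, hx⟩, rfl⟩
      · intro y
        obtain ⟨x, rfl⟩ := surjective_of_epi φ i y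
        exact ⟨(LinearMap.range (Hom.f (kerStable φ).ι i)).mkQ x, rfl⟩
    exact ⟨{ W := (kerStable φ).sub
             g := (kerStable φ).ι
             w := ι_comp φ
             isColimit := IsColimit.ofIsoColimit (cokerIsColimit (kerStable φ).ι)
               (Cofork.ext (asIso l) (by ext i x; rfl)) }⟩

/-! ## Coherent modules and complexes -/

/-- The degree shift `M{n}`, with `M{n}ⁱ = Mⁿ⁺ⁱ` and `d` multiplied by `(-1)ⁿ`. -/
def shift (M : RaynaudModule p k) (n : ℤ) : RaynaudModule p k where
  X i := M.X (n + i)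
  F i := M.F (n + i)
  V i := M.V (n + i)
  d i j h := (n.negOnePow : ℤ) • M.d (n + i) (n + j) (by rw [← h, add_assoc])
  F_V i := M.F_V (n + i)
  V_F i := M.V_F (n + i)
  F_smul i := M.F_smul (n + i)
  smul_V i := M.smul_V (n + i)
  d_d i j l h h' x := by simp [M.d_d]
  F_d_V i j h x := by simp [M.F_d_V]
  d_smul i j h a x := by
    simp only [AddMonoidHom.smul_apply, M.d_smul]
    exact smul_comm _ _ _

/-- Elementary modules of type I: concentrated in degree `0`, finitely generated over `W(k)`, and
with `V` topologically nilpotent (for the `p`-adic topology). -/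
def IsTypeI (M : RaynaudModule p k) : Prop :=
  (∀ i, i ≠ 0 → Subsingleton (M.X i)) ∧ Module.Finite (WittVector p k) (M.X 0) ∧
    ∀ n : ℕ, ∃ m : ℕ, ∀ x : M.X 0, ∃ y : M.X 0, (M.V 0)^[m] x = (p : WittVector p k) ^ n • y

/-- Elementary modules of type II: those isomorphic, for some `l ∈ ℤ`, to
`U_l : ∏_{n ≥ 0} k Vⁿ → ∏_{n ≥ l} k dVⁿ` in degrees `0` and `1`.
Under `e₀` the sequence `a` stands for `∑_{n ≥ 0} a(n) Vⁿ`, and under `e₁` the sequence `b` stands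
for `∑_{n ≥ 0} b(n) dV^{l + n}`; here `V a = σ⁻¹(a) V`, `F a = σ(a) F`, `F dVⁿ⁺¹ = dVⁿ` for `n ≥ l`
and `F dVˡ = 0`. -/
def IsTypeII (M : RaynaudModule p k) : Prop :=
  ∃ (l : ℤ) (e₀ : M.X 0 ≃+ (ℕ → k)) (e₁ : M.X 1 ≃+ (ℕ → k)),
    (∀ i, i ≠ 0 → i ≠ 1 → Subsingleton (M.X i)) ∧
    (∀ (c : WittVector p k) x n, e₀ (c • x) n = WittVector.constantCoeff c * e₀ x n) ∧
    (∀ (c : WittVector p k) x n, e₁ (c • x) n = WittVector.constantCoeff c * e₁ x n) ∧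
    (∀ x, M.F 0 x = 0) ∧
    (∀ x, e₀ (M.V 0 x) 0 = 0) ∧
    (∀ x n, e₀ (M.V 0 x) (n + 1) ^ p = e₀ x n) ∧
    (∀ x n, e₁ (M.F 1 x) n = e₁ x (n + 1) ^ p) ∧
    (∀ x, M.V 1 x = 0) ∧
    (∀ x (n : ℕ), e₁ (M.d 0 1 (zero_add 1) x) n =
      if 0 ≤ l + n then e₀ x (l + n).toNat else 0)

/-- Coherent graded modules: those with a finite filtration whose quotients are degree shifts of
elementary modules. -/
inductive IsCoherent : RaynaudModule p k → Prop
  | zero (M : RaynaudModule p k) (h : ∀ i, Subsingleton (M.X i)) : IsCoherent M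
  | extension (A M N : RaynaudModule p k) (n : ℤ) (f : A ⟶ M) (g : M ⟶ N.shift n)
      (hA : IsCoherent A) (hN : N.IsTypeI ∨ N.IsTypeII)
      (injective : ∀ i, Function.Injective (f.f i))
      (exact : ∀ i, Function.Exact (f.f i) (g.f i))
      (surjective : ∀ i, Function.Surjective (g.f i)) : IsCoherent M

theorem mul_p_tmul (M : RaynaudModule p k) (i : ℤ) (c : K(p, k)) (x : M.X i) :
    ((p : K(p, k))⁻¹ * c) ⊗ₜ[WittVector p k] ((p : WittVector p k) • x) = c ⊗ₜ x := by
  rw [← TensorProduct.smul_tmul, Algebra.smul_def, map_natCast,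
    mul_inv_cancel_left₀ (WittVector.FractionRing.p_nonzero p k)]

/-! ## Submodules attached to a graded module -/

section Perfect

variable [PerfectRing k p]

theorem V_smul (M : RaynaudModule p k) (i : ℤ) (a : WittVector p k) (x : M.X i) :
    M.V i (a • x) = (WittVector.frobeniusEquiv p k).symm a • M.V i x := by
  rw [M.smul_V]
  congr 2
  exact ((WittVector.frobeniusEquiv p k).apply_symm_apply a).symm

/-- The submodule `V Mⁱ` of `Mⁱ`. -/
def rangeV (M : RaynaudModule p k) (i : ℤ) : Submodule (WittVector p k) (M.X i) :=
  { (M.V i).range with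
    smul_mem' := by
      rintro a _ ⟨x, rfl⟩
      exact ⟨_, (M.smul_V i a x).symm⟩ }

/-- The submodule `F Mⁱ` of `Mⁱ`. -/
def rangeF (M : RaynaudModule p k) (i : ℤ) : Submodule (WittVector p k) (M.X i) :=
  { (M.F i).range with
    smul_mem' := by
      rintro a _ ⟨x, rfl⟩
      refine ⟨(WittVector.frobeniusEquiv p k).symm a • x, ?_⟩
      rw [M.F_smul]
      congr 1
      exact (WittVector.frobeniusEquiv p k).apply_symm_apply a }

theorem V_iterate_smul (M : RaynaudModule p k) (i : ℤ) (n : ℕ) (a : WittVector p k) :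
    ∃ b : WittVector p k, ∀ x : M.X i, (M.V i)^[n] (a • x) = b • (M.V i)^[n] x := by
  induction n with
  | zero => exact ⟨a, fun _ => rfl⟩
  | succ n ih =>
    obtain ⟨b, hb⟩ := ih
    exact ⟨_, fun x => by
      rw [Function.iterate_succ_apply', Function.iterate_succ_apply', hb, V_smul]⟩

/-- `V^{-∞} Zⁱ`, the submodule of all `x ∈ Mⁱ` such that `d Vⁿ x = 0` for all `n`. -/
def vInftyZ (M : RaynaudModule p k) (i : ℤ) : Submodule (WittVector p k) (M.X i) where
  carrier := {x | ∀ n : ℕ, M.d i (i + 1) rfl ((M.V i)^[n] x) = 0}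
  zero_mem' n := by rw [iterate_map_zero, map_zero]
  add_mem' hx hy n := by rw [iterate_map_add, map_add, hx n, hy n, add_zero]
  smul_mem' a x hx n := by
    obtain ⟨b, hb⟩ := M.V_iterate_smul i n a
    rw [hb, M.d_smul, hx n, smul_zero]

/-! ## Numerical invariants

Dimensions over `k` are taken of `W(k)`-modules on which `p = FV = VF` acts as zero. Such a module
is a vector space over `W(k) / p = k`, and its dimension is its length over `W(k)`. -/

/-- `Mⁱ / (Mⁱ_tors + V Mⁱ)`. -/
abbrev CokerV (M : RaynaudModule p k) (i : ℤ) : Type u :=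
  M.X i ⧸ (Submodule.torsion (WittVector p k) (M.X i) ⊔ M.rangeV i)

/-- `Mⁱ / (Mⁱ_tors + F Mⁱ)`. -/
abbrev CokerF (M : RaynaudModule p k) (i : ℤ) : Type u :=
  M.X i ⧸ (Submodule.torsion (WittVector p k) (M.X i) ⊔ M.rangeF i)

/-- `N⁰ / V N⁰`, where `N⁰ = Mⁱ / V^{-∞} Zⁱ` is the term of degree `0` of the domino
`Mⁱ / V^{-∞} Zⁱ → F^∞ B^{i+1}` attached to `d : Mⁱ → Mⁱ⁺¹`. -/
abbrev DominoCokerV (M : RaynaudModule p k) (i : ℤ) : Type u :=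
  M.X i ⧸ (M.vInftyZ i ⊔ M.rangeV i)

/-- `Tⁱ(M)`, the dimension of the domino attached to `d : Mⁱ → Mⁱ⁺¹`. -/
def dominoNumber (M : RaynaudModule p k) (i : ℤ) : ℕ :=
  (Module.length (WittVector p k) (M.DominoCokerV i)).toNat

/-! ## Isocrystals and slopes -/

/-- The `K`-vector space `Mⁱ_K = K ⊗ Mⁱ`, where `K` is the field of fractions of `W(k)`. -/
abbrev Rational (M : RaynaudModule p k) (i : ℤ) : Type u :=
  K(p, k) ⊗[WittVector p k] M.X i

theorem frobenius_algebraMap (a : WittVector p k) :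
    WittVector.FractionRing.frobenius p k (algebraMap _ K(p, k) a) =
      algebraMap _ K(p, k) (WittVector.frobenius a) :=
  IsFractionRing.ringEquivOfRingEquiv_algebraMap _ a

theorem frobenius_symm_algebraMap (a : WittVector p k) :
    (WittVector.FractionRing.frobenius p k).symm (algebraMap _ K(p, k) (WittVector.frobenius a)) =
      algebraMap _ K(p, k) a := by
  rw [RingEquiv.symm_apply_eq, frobenius_algebraMap]

/-- The map `σ ⊗ F` on `K ⊗ Mⁱ`. -/
def rationalF (M : RaynaudModule p k) (i : ℤ) : M.Rational i →+ M.Rational i :=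
  TensorProduct.liftAddHom
    { toFun := fun c =>
        ((TensorProduct.mk (WittVector p k) K(p, k) (M.X i)
          (WittVector.FractionRing.frobenius p k c)).toAddMonoidHom).comp (M.F i)
      map_zero' := by ext; simp
      map_add' := fun a b => by ext; simp }
    (fun a c x => by
      have h : WittVector.FractionRing.frobenius p k (a • c) =
          WittVector.frobenius a • WittVector.FractionRing.frobenius p k c := by
        rw [Algebra.smul_def, map_mul, frobenius_algebraMap, ← Algebra.smul_def]
      change WittVector.FractionRing.frobenius p k (a • c) ⊗ₜ M.F i x =
        WittVector.FractionRing.frobenius p k c ⊗ₜ M.F i (a • x)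
      rw [h, M.F_smul, TensorProduct.smul_tmul])

/-- The map `σ⁻¹ ⊗ p⁻¹ V` on `K ⊗ Mⁱ`, inverse to `σ ⊗ F`. -/
def rationalFInv (M : RaynaudModule p k) (i : ℤ) : M.Rational i →+ M.Rational i :=
  TensorProduct.liftAddHom
    { toFun := fun c =>
        ((TensorProduct.mk (WittVector p k) K(p, k) (M.X i)
          ((p : K(p, k))⁻¹ * (WittVector.FractionRing.frobenius p k).symm c)).toAddMonoidHom).comp
            (M.V i)
      map_zero' := by ext; simp
      map_add' := fun a b => by ext; simp [mul_add] }
    (fun a c x => by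
      obtain ⟨b, rfl⟩ := (WittVector.frobeniusEquiv p k).surjective a
      have h : (p : K(p, k))⁻¹ * (WittVector.FractionRing.frobenius p k).symm
          (WittVector.frobenius b • c) =
          b • ((p : K(p, k))⁻¹ * (WittVector.FractionRing.frobenius p k).symm c) := by
        rw [Algebra.smul_def, map_mul, frobenius_symm_algebraMap, Algebra.smul_def, mul_left_comm]
      change ((p : K(p, k))⁻¹ * (WittVector.FractionRing.frobenius p k).symm
          (WittVector.frobenius b • c)) ⊗ₜ M.V i x =
        ((p : K(p, k))⁻¹ * (WittVector.FractionRing.frobenius p k).symm c) ⊗ₜ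
          M.V i (WittVector.frobenius b • x)
      rw [h, ← M.smul_V, TensorProduct.smul_tmul])

theorem rationalF_tmul (M : RaynaudModule p k) (i : ℤ) (c : K(p, k)) (x : M.X i) :
    M.rationalF i (c ⊗ₜ x) = WittVector.FractionRing.frobenius p k c ⊗ₜ M.F i x := rfl

theorem rationalFInv_tmul (M : RaynaudModule p k) (i : ℤ) (c : K(p, k)) (x : M.X i) :
    M.rationalFInv i (c ⊗ₜ x) =
      ((p : K(p, k))⁻¹ * (WittVector.FractionRing.frobenius p k).symm c) ⊗ₜ M.V i x := rfl

theorem rationalF_smul (M : RaynaudModule p k) (i : ℤ) (c : K(p, k)) (y : M.Rational i) :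
    M.rationalF i (c • y) = WittVector.FractionRing.frobenius p k c • M.rationalF i y := by
  induction y using TensorProduct.induction_on with
  | zero => simp
  | tmul b x => simp only [rationalF_tmul, TensorProduct.smul_tmul', smul_eq_mul, map_mul]
  | add y z hy hz => rw [smul_add, map_add, hy, hz, map_add, smul_add]

theorem rationalFInv_rationalF (M : RaynaudModule p k) (i : ℤ) (y : M.Rational i) :
    M.rationalFInv i (M.rationalF i y) = y := by
  induction y using TensorProduct.induction_on with
  | zero => simp
  | tmul b x =>
    rw [rationalF_tmul, rationalFInv_tmul, M.V_F, RingEquiv.symm_apply_apply, mul_p_tmul]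
  | add y z hy hz => rw [map_add, map_add, hy, hz]

theorem rationalF_rationalFInv (M : RaynaudModule p k) (i : ℤ) (y : M.Rational i) :
    M.rationalF i (M.rationalFInv i y) = y := by
  induction y using TensorProduct.induction_on with
  | zero => simp
  | tmul b x =>
    rw [rationalFInv_tmul, rationalF_tmul, M.F_V, map_mul, map_inv₀, map_natCast,
      RingEquiv.apply_symm_apply, mul_p_tmul]
  | add y z hy hz => rw [map_add, map_add, hy, hz]

/-- `Mⁱ_K` with `σ ⊗ F` is an isocrystal. -/
instance (M : RaynaudModule p k) (i : ℤ) : WittVector.Isocrystal p k (M.Rational i) where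
  frob :=
    { M.rationalF i with
      map_smul' := M.rationalF_smul i
      invFun := M.rationalFInv i
      left_inv := M.rationalFInv_rationalF i
      right_inv := M.rationalF_rationalFInv i }

end Perfect

/-- The part of slope `s` of an isocrystal `E` with Frobenius `Φ`. If `s = a / b` in lowest terms
with `b > 0`, it is the `K`-subspace spanned by the finitely generated `W(k)`-submodules `L` of `E`
with `Φᵇ L = pᵃ L`. -/
def slopePart (p : ℕ) [Fact p.Prime] (k : Type u) [Field k] [CharP k p]
    [PerfectRing k p] (E : Type u) [AddCommGroup E] [WittVector.Isocrystal p k E]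
    [Module (WittVector p k) E] [IsScalarTower (WittVector p k) K(p, k) E] (s : ℚ) :
    Submodule K(p, k) E :=
  Submodule.span K(p, k) {v | ∃ L : Submodule (WittVector p k) E, L.FG ∧ v ∈ L ∧
    (WittVector.Isocrystal.frobenius p k (V := E)).toFun^[s.den] '' (L : Set E) =
      (fun x : E => (p : K(p, k)) ^ s.num • x) '' (L : Set E)}

/-- The multiplicity of `s` as a slope of the isocrystal `Mⁱ_K`. -/
def slopeMultiplicity [PerfectRing k p] (M : RaynaudModule p k) (i : ℤ) (s : ℚ) : ℕ :=
  Module.finrank K(p, k) (slopePart p k (M.Rational i) s)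

end RaynaudModule

/-! ## Coherent complexes and their invariants -/

namespace CoherentComplex

variable {p : ℕ} [Fact p.Prime] {k : Type u} [Field k] [CharP k p]
  [HasDerivedCategory.{w} (RaynaudModule p k)]

/-- The graded module `Hʲ(M)` of an object of the derived category. -/
abbrev H (M : DerivedCategory (RaynaudModule p k)) (j : ℤ) : RaynaudModule p k :=
  (DerivedCategory.homologyFunctor (RaynaudModule p k) j).obj M

/-- The objects of `D^b_c(R)`: bounded, with coherent cohomology. -/
def Dbc (p : ℕ) [Fact p.Prime] (k : Type u) [Field k] [CharP k p]
    [HasDerivedCategory.{w} (RaynaudModule p k)] :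
    ObjectProperty (DerivedCategory (RaynaudModule p k)) := fun M =>
  (∃ a b : ℤ, ∀ j, j < a ∨ b < j → IsZero (H M j)) ∧ ∀ j, (H M j).IsCoherent

/-- `T^{i,j}(M) = Tⁱ(Hʲ(M))`. -/
def T [PerfectRing k p] (M : DerivedCategory (RaynaudModule p k)) (i j : ℤ) : ℕ :=
  (H M j).dominoNumber i

/-- The slope number `m^{i,j}(M)`. -/
def slopeNumber [PerfectRing k p] (M : DerivedCategory (RaynaudModule p k)) (i j : ℤ) : ℕ :=
  (Module.length (WittVector p k) ((H M j).CokerV i)).toNat +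
    (Module.length (WittVector p k) ((H M (j + 1)).CokerF (i - 1))).toNat

/-- The Hodge-Witt number `h_W^{i,j}(M)`. -/
def hodgeWitt [PerfectRing k p] (M : DerivedCategory (RaynaudModule p k)) (i j : ℤ) : ℤ :=
  slopeNumber M i j + T M i j - 2 * T M (i - 1) (j + 1) + T M (i - 2) (j + 2)

/-- `e_r(M)`. The second sum is over all `(i, j, s)` with `s ≤ r - i`, where a slope `s` of
`Hʲ(M)ⁱ_K` is counted with its multiplicity. -/
def e [PerfectRing k p] (M : DerivedCategory (RaynaudModule p k)) (r : ℤ) : ℚ :=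
  (∑ᶠ j : ℤ, (-1 : ℚ) ^ (j - 1) * T M (r - 1) (j - r)) +
    ∑ᶠ (q : ℤ × ℤ × ℚ) (_ : q.2.2 ≤ r - q.1),
      (-1 : ℚ) ^ (q.1 + q.2.1) * ((H M q.2.1).slopeMultiplicity q.1 q.2.2 * (r - q.1 - q.2.2))

end CoherentComplex

end

/-!
Write `v^{i,j}` and `c^{i,j}` for the lengths of the cokernels of `V` and `F` on the torsion-free
quotient of `Hʲ(M)ⁱ`. Then `h_W^{i,j}` is `v^{i,j} + c^{i-1,j+1}` plus the second difference of `T`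
along the antidiagonal through `(i, j)`. The sign `(-1)^{i+j}` is constant on antidiagonals, so that
summation by parts (`finsum_mul_second_difference`) moves the shifts to the weight `max (r - i) 0`.
Its second difference is concentrated at `i = r - 1`, which gives the first sum of `e_r`; the
numbers `v^{i,j}` and `c^{i,j}` are left with the weights `max (r - i) 0` and `max (r - i - 1) 0`.
Hence it suffices to show for each `(i, j)`, with `N = r - i`, that
`max N 0 * v + max (N - 1) 0 * c` is the sum of `N - λ` over the slopes `λ ≤ N`
(`IsCoherent.finsum_slopes`). This holds since all slopes lie in `[0, 1]`, their number is `v + c`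
and their sum is `c`.

For these three facts (`exists_finset_slopes`, `IsCoherent.exists_finset_slopes`), let `L` be the
image of `Hʲ(M)ⁱ` in the isocrystal. It is a lattice that is stable under `F` and `V = p F⁻¹`, which
confines the slopes to `[0, 1]`. The number `c` is the length of `L / F L`, and `v` is the length of
`L / V L ≃ F L / p L`; so `v + c` is the length of `L / p L`, the dimension. The length of `L / g L`
is the same for all lattices that `g` maps into themselves; for a power `g = Fᴮ` it can be computed
on a lattice that is compatible with the slope decomposition and on which `g` multiplies the
summand of slope `λ` by `p ^ (λ B)`. This gives `B c = ∑ λ B`.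

The slope decomposition itself holds over any perfect field and needs no classification of
isocrystals (`iSup_slopeSubspace_eq_top_of_finrank_eq`, `iSupIndep_slopeSubspace`). A lattice that
is stable under `p ^ (-a) F ^ b` shows that all slopes are at least `a / b`. If `a / b` approximates
the supremum of these lower bounds as well as Dirichlet's theorem permits, it is a lower bound
itself, by a pigeonhole argument on chains of lattices, and `p ^ (-a) F ^ b` is not nilpotent modulo
`p` on the stable lattice, since otherwise there would be a lower bound beyond the supremum
(`exists_smallest_slope`). Fitting's lemma over the complete ring `W(k)` (`exists_fitting`) now
splits off the part of slope `a / b`, which is not zero. The parts of different slopes are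
independent because `p ^ (-a) F ^ b` is contracting on the parts of slope greater than `a / b` and
has no contracted vectors in the part of slope `a / b`.

The dimensions are finite by induction on the filtration of a coherent module. In each degree an
elementary module is finitely generated over `W(k)` or annihilated by `p`, so the torsion-free
quotient of a coherent module is finitely generated. For the dominoes the point is that an
elementary module `N` is finitely generated modulo `d N + V N`, while the image of `d` is contained
in `V^{-∞} Z` because of `V d = p d V`.

Throughout the part on lattices, semilinear automorphisms act on submodules by images, and `P` is
multiplication by `p`, viewed as such an automorphism, so that `P ^ n • L` is `p ^ n L` for all
integers `n`.
-/

noncomputable section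

/-! ### Semilinear automorphisms and their action on submodules -/

/-- The additive automorphisms of an `R`-module `E` that are semilinear with respect to some
automorphism of `R`. -/
@[ext]
structure SemilinearAut (R E : Type*) [CommRing R] [AddCommGroup E] [Module R E] where
  toEquiv : E ≃+ E
  exists_map_smul : ∃ τ : R ≃+* R, ∀ (a : R) (x : E), toEquiv (a • x) = τ a • toEquiv x

namespace SemilinearAut

variable {R E : Type*} [CommRing R] [AddCommGroup E] [Module R E]

instance : Group (SemilinearAut R E) where
  mul g h := ⟨h.1.trans g.1, by
    obtain ⟨τ, hτ⟩ := g.2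
    obtain ⟨τ', hτ'⟩ := h.2
    exact ⟨τ'.trans τ, fun a x => by simp [hτ, hτ']⟩⟩
  one := ⟨AddEquiv.refl E, RingEquiv.refl R, fun _ _ => rfl⟩
  inv g := ⟨g.1.symm, by
    obtain ⟨τ, hτ⟩ := g.2
    exact ⟨τ.symm, fun a x => g.1.injective (by simp [hτ])⟩⟩
  mul_assoc _ _ _ := rfl
  one_mul _ := rfl
  mul_one _ := rfl
  inv_mul_cancel g := by ext x; exact g.1.symm_apply_apply x

theorem mul_apply (g h : SemilinearAut R E) (x : E) : (g * h).1 x = g.1 (h.1 x) := rfl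

@[simp] theorem one_apply (x : E) : (1 : SemilinearAut R E).1 x = x := rfl

@[simp] theorem inv_apply_self (g : SemilinearAut R E) (x : E) : (g⁻¹).1 (g.1 x) = x := by
  rw [← mul_apply, inv_mul_cancel, one_apply]

@[simp] theorem apply_inv_self (g : SemilinearAut R E) (x : E) : g.1 ((g⁻¹).1 x) = x := by
  rw [← mul_apply, mul_inv_cancel, one_apply]

/-- Semilinear automorphisms act on submodules by taking images. -/
instance : MulAction (SemilinearAut R E) (Submodule R E) where
  smul g L :=
    { carrier := g.1 '' L
      zero_mem' := ⟨0, L.zero_mem, map_zero _⟩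
      add_mem' := by
        rintro _ _ ⟨x, hx, rfl⟩ ⟨y, hy, rfl⟩
        exact ⟨x + y, L.add_mem hx hy, map_add _ _ _⟩
      smul_mem' := by
        rintro a _ ⟨x, hx, rfl⟩
        obtain ⟨τ, hτ⟩ := g.2
        exact ⟨τ.symm a • x, L.smul_mem _ hx, by rw [hτ, τ.apply_symm_apply]⟩ }
  one_smul L := SetLike.coe_injective (Set.image_id _)
  mul_smul g h L := SetLike.coe_injective (Set.image_comp g.1 h.1 L)

theorem coe_smul (g : SemilinearAut R E) (L : Submodule R E) :
    ((g • L : Submodule R E) : Set E) = g.1 '' L := rfl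

theorem mem_smul {g : SemilinearAut R E} {L : Submodule R E} {x : E} :
    x ∈ g • L ↔ (g⁻¹).1 x ∈ L :=
  ⟨by rintro ⟨y, hy, rfl⟩; simpa using hy, fun h => ⟨_, h, by simp⟩⟩

theorem apply_mem_smul {g : SemilinearAut R E} {L : Submodule R E} {x : E} :
    g.1 x ∈ g • L ↔ x ∈ L := by
  rw [mem_smul, inv_apply_self]

theorem smul_le_smul_iff {g : SemilinearAut R E} {L M : Submodule R E} :
    g • L ≤ g • M ↔ L ≤ M :=
  ⟨fun h _ hx => apply_mem_smul.1 (h (apply_mem_smul.2 hx)), fun h _ hx =>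
    mem_smul.2 (h (mem_smul.1 hx))⟩

theorem smul_le_smul (g : SemilinearAut R E) {L M : Submodule R E} (h : L ≤ M) :
    g • L ≤ g • M := smul_le_smul_iff.2 h

theorem smul_le_iff {g : SemilinearAut R E} {L M : Submodule R E} :
    g • L ≤ M ↔ L ≤ g⁻¹ • M := by
  rw [← smul_le_smul_iff (g := g) (M := g⁻¹ • M), smul_inv_smul]

theorem le_smul_iff {g : SemilinearAut R E} {L M : Submodule R E} :
    L ≤ g • M ↔ g⁻¹ • L ≤ M := by
  rw [smul_le_iff, inv_inv]

/-- The automorphism of the lattice of submodules that is induced by a semilinear automorphism. -/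
def orderIso (g : SemilinearAut R E) : Submodule R E ≃o Submodule R E where
  toEquiv := MulAction.toPerm g
  map_rel_iff' := smul_le_smul_iff

theorem smul_sup (g : SemilinearAut R E) (L M : Submodule R E) :
    g • (L ⊔ M) = g • L ⊔ g • M := map_sup (orderIso g) L M

theorem smul_iSup {ι : Sort*} (g : SemilinearAut R E) (L : ι → Submodule R E) :
    g • (⨆ i, L i) = ⨆ i, g • L i := map_iSup (orderIso g) L

theorem smul_iInf {ι : Sort*} (g : SemilinearAut R E) (L : ι → Submodule R E) :
    g • (⨅ i, L i) = ⨅ i, g • L i := map_iInf (orderIso g) L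

theorem pow_smul_le {g : SemilinearAut R E} {L : Submodule R E} (h : g • L ≤ L) (n : ℕ) :
    g ^ n • L ≤ L := by
  induction n with
  | zero => simp
  | succ n ih => rw [pow_succ', mul_smul]; exact (smul_le_smul g ih).trans h

theorem pow_smul_anti {g : SemilinearAut R E} {L : Submodule R E} (h : g • L ≤ L) :
    Antitone fun n : ℕ => g ^ n • L :=
  antitone_nat_of_succ_le fun n => by
    rw [pow_succ, mul_smul]; exact smul_le_smul _ h

theorem smul_fg (g : SemilinearAut R E) {L : Submodule R E} (hL : L.FG) :
    (g • L : Submodule R E).FG := by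
  classical
  obtain ⟨s, rfl⟩ := hL
  refine ⟨s.image g.1, le_antisymm ?_ ?_⟩
  · rw [Submodule.span_le, Finset.coe_image]
    rintro _ ⟨x, hx, rfl⟩
    exact apply_mem_smul.2 (Submodule.subset_span hx)
  · rw [smul_le_iff, Submodule.span_le]
    intro x hx
    rw [SetLike.mem_coe, mem_smul, inv_inv]
    exact Submodule.subset_span (Finset.mem_image_of_mem _ hx)

end SemilinearAut

/-! ### Relative lengths -/

section RelLength

variable {R E : Type*} [CommRing R] [AddCommGroup E] [Module R E]

/-- The length of `L / (M ∩ L)`. -/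
def relLength (M L : Submodule R E) : ℕ∞ := Module.length R (L ⧸ M.comap L.subtype)

/-- The submodules of `L / M` are the submodules between `M` and `L`. -/
def submoduleQuotientIso {M L : Submodule R E} (h : M ≤ L) :
    Submodule R (L ⧸ M.comap L.subtype) ≃o Set.Icc M L where
  toFun N := ⟨(N.comap (M.comap L.subtype).mkQ).map L.subtype, by
    refine ⟨fun x hx => ⟨⟨x, h hx⟩, ?_, rfl⟩, Submodule.map_subtype_le _ _⟩
    have : (M.comap L.subtype).mkQ ⟨x, h hx⟩ = 0 := by
      rw [Submodule.mkQ_apply]; exact (Submodule.Quotient.mk_eq_zero _).2 hx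
    simp only [Submodule.comap_coe, Set.mem_preimage, this, SetLike.mem_coe, N.zero_mem]⟩
  invFun N := (N.1.comap L.subtype).map (M.comap L.subtype).mkQ
  left_inv N := by
    simp only [Submodule.comap_map_eq_of_injective L.injective_subtype]
    exact Submodule.map_comap_eq_of_surjective (Submodule.mkQ_surjective _) _
  right_inv N := by
    ext1
    have h1 : M.comap L.subtype ≤ N.1.comap L.subtype := Submodule.comap_mono N.2.1
    simp only [Submodule.comap_map_mkQ, sup_eq_right.2 h1, Submodule.map_comap_subtype]
    exact inf_eq_right.2 N.2.2
  map_rel_iff' {N N'} := by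
    change Submodule.map L.subtype _ ≤ Submodule.map L.subtype _ ↔ _
    rw [Submodule.map_le_map_iff_of_injective L.injective_subtype,
      Submodule.comap_le_comap_iff_of_surjective (Submodule.mkQ_surjective _)]

theorem coe_relLength {M L : Submodule R E} (h : M ≤ L) :
    (relLength M L : WithBot ℕ∞) = Order.krullDim (Set.Icc M L) := by
  rw [relLength, Module.coe_length, Order.krullDim_eq_of_orderIso (submoduleQuotientIso h)]

theorem relLength_add {N M L : Submodule R E} (h : N ≤ M) (h' : M ≤ L) :
    relLength N L = relLength N M + relLength M L := by
  have h1 : N.comap M.subtype ≤ (N.comap L.subtype).comap (Submodule.inclusion h') :=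
    fun _ hx => hx
  have h2 : N.comap L.subtype ≤ (M.comap L.subtype).comap LinearMap.id := fun _ hx => h hx
  refine Module.length_eq_add_of_exact (Submodule.mapQ _ _ (Submodule.inclusion h') h1)
    (Submodule.mapQ _ _ LinearMap.id h2) ?_ ?_ ?_
  · rw [injective_iff_map_eq_zero]
    intro x hx
    obtain ⟨x, rfl⟩ := Submodule.Quotient.mk_surjective _ x
    rw [Submodule.mapQ_apply, Submodule.Quotient.mk_eq_zero] at hx
    exact (Submodule.Quotient.mk_eq_zero _).2 hx
  · intro x
    obtain ⟨x, rfl⟩ := Submodule.Quotient.mk_surjective _ x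
    exact ⟨Submodule.Quotient.mk x, Submodule.mapQ_apply _ _ _ _⟩
  · intro x
    obtain ⟨x, rfl⟩ := Submodule.Quotient.mk_surjective _ x
    rw [Submodule.mapQ_apply, Submodule.Quotient.mk_eq_zero]
    constructor
    · intro hx
      exact ⟨Submodule.Quotient.mk ⟨x.1, hx⟩, Submodule.mapQ_apply _ _ _ _⟩
    · rintro ⟨y, hy⟩
      obtain ⟨y, rfl⟩ := Submodule.Quotient.mk_surjective _ y
      rw [Submodule.mapQ_apply, Submodule.Quotient.eq] at hy
      have := M.sub_mem y.2 (h (show (y : E) - x ∈ N from hy))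
      simpa using this

theorem relLength_smul (g : SemilinearAut R E) {M L : Submodule R E} (h : M ≤ L) :
    relLength (g • M) (g • L) = relLength M L := by
  rw [← WithBot.coe_inj, coe_relLength h, coe_relLength (SemilinearAut.smul_le_smul g h)]
  refine Order.krullDim_eq_of_orderIso (OrderIso.symm ?_)
  exact
    { toFun := fun N => ⟨g • N.1, SemilinearAut.smul_le_smul g N.2.1,
        SemilinearAut.smul_le_smul g N.2.2⟩
      invFun := fun N => ⟨g⁻¹ • N.1, SemilinearAut.le_smul_iff.2 (by rw [inv_inv]; exact N.2.1),
        SemilinearAut.smul_le_iff.2 (by rw [inv_inv]; exact N.2.2)⟩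
      left_inv := fun N => Subtype.ext (inv_smul_smul g N.1)
      right_inv := fun N => Subtype.ext (smul_inv_smul g N.1)
      map_rel_iff' := SemilinearAut.smul_le_smul_iff }

/-- A strictly increasing chain of submodules between `M` and `L` is no longer than the length of
`L / M`. -/
theorem le_relLength_of_strictMono {M L : Submodule R E} (n : ℕ) (f : ℕ → Submodule R E)
    (h0 : M ≤ f 0) (hn : f n ≤ L) (hf : ∀ i < n, f i < f (i + 1)) :
    (n : ℕ∞) ≤ relLength M L := by
  have hmono : ∀ j ≤ n, ∀ i ≤ j, f i ≤ f j := by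
    intro j hj
    induction j with
    | zero => intro i hi; rw [Nat.le_zero.1 hi]
    | succ j ih =>
      intro i hi
      rcases Nat.le_succ_iff.1 hi with h | rfl
      · exact (ih (by omega) i h).trans (hf j (by omega)).le
      · exact le_rfl
  let s : LTSeries (Set.Icc M L) :=
    { length := n
      toFun := fun i => ⟨f i, h0.trans (hmono i (by omega) 0 (Nat.zero_le _)),
        (hmono n le_rfl i (by omega)).trans hn⟩
      step := fun i => by
        change f i < f (i + 1)
        exact hf i i.2 }
  have h := Order.LTSeries.length_le_krullDim s
  have hML : M ≤ L := h0.trans ((hmono n le_rfl 0 (Nat.zero_le _)).trans hn)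
  rw [← coe_relLength hML] at h
  exact_mod_cast h

end RelLength

/-! ### Lattices over a complete discrete valuation ring -/

section Multiplication

variable {R E : Type*} [CommRing R] [AddCommGroup E] [Module R E] {p : ℕ} {P : SemilinearAut R E}

theorem pow_apply_of_mul (hP : ∀ x, P.1 x = (p : R) • x) (n : ℕ) (x : E) :
    (P ^ n).1 x = (p : R) ^ n • x := by
  induction n with
  | zero => simp
  | succ n ih => rw [pow_succ', SemilinearAut.mul_apply, hP, ih, pow_succ', mul_smul]

/-- Multiplication by a natural number is central. -/
theorem commute_of_mul (hP : ∀ x, P.1 x = (p : R) • x) (g : SemilinearAut R E) :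
    Commute P g := by
  ext x
  rw [SemilinearAut.mul_apply, SemilinearAut.mul_apply, hP, hP, Nat.cast_smul_eq_nsmul,
    Nat.cast_smul_eq_nsmul, map_nsmul]

theorem mem_pow_smul_of_mul (hP : ∀ x, P.1 x = (p : R) • x) {n : ℕ} {x : E}
    {L : Submodule R E} : x ∈ P ^ n • L ↔ ∃ y ∈ L, (p : R) ^ n • y = x := by
  simp only [← pow_apply_of_mul hP]
  rfl

theorem smul_le_of_mul (hP : ∀ x, P.1 x = (p : R) • x) (L : Submodule R E) : P • L ≤ L := by
  rintro _ ⟨x, hx, rfl⟩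
  rw [hP]
  exact L.smul_mem _ hx

theorem pow_smul_anti_of_mul (hP : ∀ x, P.1 x = (p : R) • x) (L : Submodule R E) {m n : ℕ}
    (h : m ≤ n) : P ^ n • L ≤ P ^ m • L :=
  SemilinearAut.pow_smul_anti (smul_le_of_mul hP L) h

theorem zpow_smul_anti_of_mul (hP : ∀ x, P.1 x = (p : R) • x) (L : Submodule R E) {m n : ℤ}
    (h : m ≤ n) : P ^ n • L ≤ P ^ m • L := by
  obtain ⟨k, rfl⟩ := Int.le.dest h
  rw [zpow_add, mul_smul, zpow_natCast]
  exact SemilinearAut.smul_le_smul _ (SemilinearAut.pow_smul_le (smul_le_of_mul hP L) k)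

theorem smul_zpow_smul_of_mul (hP : ∀ x, P.1 x = (p : R) • x) (g : SemilinearAut R E)
    (n : ℤ) (L : Submodule R E) : g • P ^ n • L = P ^ n • g • L := by
  rw [← mul_smul, ← mul_smul, ((commute_of_mul hP g).zpow_left n).eq]

theorem smul_pow_smul_of_mul (hP : ∀ x, P.1 x = (p : R) • x) (g : SemilinearAut R E)
    (n : ℕ) (L : Submodule R E) : g • P ^ n • L = P ^ n • g • L := by
  simpa using smul_zpow_smul_of_mul hP g n L

theorem smul_smul_of_mul (hP : ∀ x, P.1 x = (p : R) • x) (g : SemilinearAut R E)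
    (L : Submodule R E) : g • P • L = P • g • L := by
  simpa using smul_pow_smul_of_mul hP g 1 L

theorem pow_smul_span_range (hP : ∀ x, P.1 x = (p : R) • x) (n : ℕ) {ι : Type*} (e : ι → E) :
    P ^ n • Submodule.span R (Set.range e) =
      Submodule.span R (Set.range fun i => (p : R) ^ n • e i) := by
  apply le_antisymm
  · rw [SemilinearAut.smul_le_iff, Submodule.span_le]
    rintro _ ⟨i, rfl⟩
    rw [SetLike.mem_coe, SemilinearAut.mem_smul, inv_inv, pow_apply_of_mul hP]
    exact Submodule.subset_span ⟨i, rfl⟩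
  · rw [Submodule.span_le]
    rintro _ ⟨i, rfl⟩
    exact (mem_pow_smul_of_mul hP).2 ⟨_, Submodule.subset_span ⟨i, rfl⟩, rfl⟩

/-- A finitely generated submodule is separated in its `p`-adic topology. -/
theorem eq_zero_of_forall_mem_pow_smul [IsDomain R] [IsDiscreteValuationRing R]
    (hp : Irreducible (p : R)) (hP : ∀ x, P.1 x = (p : R) • x) {L : Submodule R E} (hL : L.FG) {x : E}
    (h : ∀ n : ℕ, x ∈ P ^ n • L) : x = 0 := by
  have : Module.Finite R L := Module.Finite.iff_fg.2 hL
  have hx : x ∈ L := by simpa using h 0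
  have hI : Ideal.span {(p : R)} ≠ ⊤ := by
    rw [Ne, Ideal.span_singleton_eq_top]
    exact hp.not_isUnit
  have key : (⟨x, hx⟩ : L) ∈ (⨅ i : ℕ, Ideal.span {(p : R)} ^ i • ⊤ : Submodule R L) := by
    rw [Submodule.mem_iInf]
    intro n
    obtain ⟨y, hy, hyx⟩ := (mem_pow_smul_of_mul hP).1 (h n)
    have : (⟨x, hx⟩ : L) = (p : R) ^ n • ⟨y, hy⟩ := Subtype.ext hyx.symm
    rw [this]
    exact Submodule.smul_mem_smul (Ideal.pow_mem_pow (Ideal.mem_span_singleton_self _) n) trivial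
  rw [Ideal.iInf_pow_smul_eq_bot_of_isLocalRing _ hI, Submodule.mem_bot] at key
  exact congrArg Subtype.val key

/-- A finitely generated submodule is complete in its `p`-adic topology. -/
theorem exists_forall_sub_mem_pow_smul [IsAdicComplete (Ideal.span {(p : R)}) R]
    (hP : ∀ x, P.1 x = (p : R) • x) {L : Submodule R E} (hL : L.FG) (y : ℕ → E)
    (hy : ∀ n : ℕ, y (n + 1) - y n ∈ P ^ n • L) : ∃ z, ∀ n : ℕ, z - y n ∈ P ^ n • L := by
  obtain ⟨m, e, rfl⟩ := Submodule.fg_iff_exists_fin_generating_family.1 hL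
  have h1 : ∀ n, ∃ a : Fin m → R, (p : R) ^ n • ∑ i, a i • e i = y (n + 1) - y n := by
    intro n
    obtain ⟨x, hx, hxy⟩ := (mem_pow_smul_of_mul hP).1 (hy n)
    obtain ⟨a, rfl⟩ := (Submodule.mem_span_range_iff_exists_fun R).1 hx
    exact ⟨a, hxy⟩
  choose a ha using h1
  have h2 : ∀ i, ∃ c : R, ∀ N, (p : R) ^ N ∣ c - ∑ n ∈ Finset.range N, (p : R) ^ n * a n i := by
    intro i
    obtain ⟨c, hc⟩ := IsPrecomplete.prec (I := Ideal.span {(p : R)}) (M := R) inferInstance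
      (f := fun N => ∑ n ∈ Finset.range N, (p : R) ^ n * a n i) (by
        intro s t hst
        rw [SModEq.comm, SModEq.sub_mem, Ideal.span_singleton_pow, smul_eq_mul, Ideal.mul_top,
          Ideal.mem_span_singleton, ← Finset.sum_Ico_eq_sub _ hst]
        exact Finset.dvd_sum fun n hn =>
          (pow_dvd_pow _ (Finset.mem_Ico.1 hn).1).mul_right _)
    refine ⟨c, fun N => ?_⟩
    have := hc N
    rwa [SModEq.comm, SModEq.sub_mem, Ideal.span_singleton_pow, smul_eq_mul, Ideal.mul_top,
      Ideal.mem_span_singleton] at this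
  choose c hc using h2
  have h3 : ∀ N, y N = y 0 + ∑ i, (∑ n ∈ Finset.range N, (p : R) ^ n * a n i) • e i := by
    intro N
    induction N with
    | zero => simp
    | succ N ih =>
      rw [← sub_add_cancel (y (N + 1)) (y N), ← ha, ih, Finset.smul_sum]
      simp only [Finset.sum_range_succ, add_smul, Finset.sum_add_distrib, mul_smul]
      abel
  refine ⟨y 0 + ∑ i, c i • e i, fun N => (mem_pow_smul_of_mul hP).2 ?_⟩
  choose b hb using fun i => hc i N
  refine ⟨∑ i, b i • e i, Submodule.sum_mem _ fun i _ =>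
    Submodule.smul_mem _ _ (Submodule.subset_span ⟨i, rfl⟩), ?_⟩
  rw [h3 N, add_sub_add_left_eq_sub, ← Finset.sum_sub_distrib, Finset.smul_sum]
  refine Finset.sum_congr rfl fun i _ => ?_
  rw [← sub_smul, hb, mul_smul]

theorem exists_pow_smul_le_of_forall (hP : ∀ x, P.1 x = (p : R) • x) {L M : Submodule R E}
    (hL : L.FG) (h : ∀ x ∈ L, ∃ n : ℕ, (P ^ n).1 x ∈ M) : ∃ n : ℕ, P ^ n • L ≤ M := by
  obtain ⟨s, rfl⟩ := hL
  choose! n hn using h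
  refine ⟨s.sup n, ?_⟩
  rw [SemilinearAut.smul_le_iff, Submodule.span_le]
  intro x hx
  have h1 : n x ≤ s.sup n := Finset.le_sup hx
  rw [SetLike.mem_coe, SemilinearAut.mem_smul, inv_inv, ← Nat.sub_add_cancel h1, pow_add,
    SemilinearAut.mul_apply, pow_apply_of_mul hP]
  exact M.smul_mem _ (hn x (Submodule.subset_span hx))

end Multiplication

section Lattice

variable {R K E : Type*} [CommRing R] [IsDomain R] [IsDiscreteValuationRing R] [Field K]
  [Algebra R K] [IsFractionRing R K] [AddCommGroup E] [Module K E] [Module R E]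
  [IsScalarTower R K E] {p : ℕ} {P : SemilinearAut R E}

theorem exists_pow_mul_eq_algebraMap (hp : Irreducible (p : R)) (c : K) :
    ∃ (n : ℕ) (r : R), algebraMap R K (p : R) ^ n * c = algebraMap R K r := by
  obtain ⟨a, b, hb, rfl⟩ := IsFractionRing.div_surjective (A := R) c
  obtain ⟨n, u, rfl⟩ := IsDiscreteValuationRing.eq_unit_mul_pow_irreducible
    (nonZeroDivisors.ne_zero hb) hp
  have h1 : algebraMap R K (p : R) ≠ 0 :=
    (map_ne_zero_iff _ (IsFractionRing.injective R K)).2 hp.ne_zero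
  have h2 : algebraMap R K (u : R) ≠ 0 := by simp
  refine ⟨n, (u⁻¹ : Rˣ) * a, ?_⟩
  have h3 : algebraMap R K (u⁻¹ : Rˣ) * algebraMap R K (u : R) = 1 := by
    rw [← map_mul, Units.inv_mul, map_one]
  rw [map_mul, map_mul, map_pow]
  field_simp
  linear_combination (-(algebraMap R K a)) * h3

theorem exists_pow_apply_mem_of_mem_span (hp : Irreducible (p : R))
    (hP : ∀ x, P.1 x = (p : R) • x) {L : Submodule R E} {x : E}
    (hx : x ∈ Submodule.span K (L : Set E)) : ∃ n : ℕ, (P ^ n).1 x ∈ L := by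
  simp only [pow_apply_of_mul hP]
  have mono : ∀ {m n : ℕ} {y : E}, m ≤ n → (p : R) ^ m • y ∈ L → (p : R) ^ n • y ∈ L := by
    intro m n y hmn hy
    rw [← Nat.sub_add_cancel hmn, pow_add, mul_smul]
    exact L.smul_mem _ hy
  induction hx using Submodule.span_induction with
  | mem x hx => exact ⟨0, by simpa using hx⟩
  | zero => exact ⟨0, by simp⟩
  | add x y _ _ hx hy =>
    obtain ⟨m, hm⟩ := hx
    obtain ⟨n, hn⟩ := hy
    refine ⟨max m n, ?_⟩
    rw [smul_add]
    exact L.add_mem (mono (le_max_left _ _) hm) (mono (le_max_right _ _) hn)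
  | smul c x _ hx =>
    obtain ⟨m, hm⟩ := hx
    obtain ⟨n, r, hr⟩ := exists_pow_mul_eq_algebraMap (K := K) hp c
    refine ⟨m + n, ?_⟩
    have : (p : R) ^ (m + n) • c • x = r • (p : R) ^ m • x := by
      rw [pow_add, mul_smul, ← algebraMap_smul K ((p : R) ^ n) (c • x), smul_smul, map_pow, hr,
        algebraMap_smul, smul_comm]
    rw [this]
    exact L.smul_mem _ hm

omit [IsDomain R] [IsDiscreteValuationRing R] in
theorem mem_span_of_pow_apply_mem (hp : Irreducible (p : R))
    (hP : ∀ x, P.1 x = (p : R) • x) {L : Submodule R E} {x : E} {n : ℕ}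
    (hn : (P ^ n).1 x ∈ L) : x ∈ Submodule.span K (L : Set E) := by
  rw [pow_apply_of_mul hP] at hn
  have h3 : algebraMap R K (p : R) ≠ 0 :=
    (map_ne_zero_iff _ (IsFractionRing.injective R K)).2 hp.ne_zero
  have h4 : x = (algebraMap R K (p : R) ^ n)⁻¹ • (p : R) ^ n • x := by
    rw [← algebraMap_smul K ((p : R) ^ n) x, map_pow, smul_smul,
      inv_mul_cancel₀ (pow_ne_zero _ h3), one_smul]
  rw [h4]
  exact Submodule.smul_mem _ _ (Submodule.subset_span hn)

/-- A finitely generated submodule is a lattice if and only if it absorbs the powers of `p`. -/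
theorem isLattice_iff (hp : Irreducible (p : R)) (hP : ∀ x, P.1 x = (p : R) • x)
    {L : Submodule R E} :
    L.IsLattice K ↔ L.FG ∧ ∀ x, ∃ n : ℕ, (P ^ n).1 x ∈ L := by
  constructor
  · intro h
    exact ⟨h.fg, fun x => exists_pow_apply_mem_of_mem_span (K := K) hp hP
      (h.span_eq_top.symm ▸ trivial)⟩
  · rintro ⟨h1, h2⟩
    refine ⟨h1, eq_top_iff.2 fun x _ => ?_⟩
    obtain ⟨n, hn⟩ := h2 x
    exact mem_span_of_pow_apply_mem hp hP hn

theorem isLattice_smul (hp : Irreducible (p : R)) (hP : ∀ x, P.1 x = (p : R) • x)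
    (g : SemilinearAut R E) {L : Submodule R E} (hL : L.IsLattice K) :
    (g • L : Submodule R E).IsLattice K := by
  rw [isLattice_iff hp hP] at hL ⊢
  refine ⟨SemilinearAut.smul_fg g hL.1, fun x => ?_⟩
  obtain ⟨n, hn⟩ := hL.2 (g⁻¹.1 x)
  refine ⟨n, ?_⟩
  rwa [SemilinearAut.mem_smul, ← SemilinearAut.mul_apply,
    ← ((commute_of_mul hP g⁻¹).pow_left n).eq]

theorem exists_pow_smul_le (hp : Irreducible (p : R)) (hP : ∀ x, P.1 x = (p : R) • x)
    {L M : Submodule R E} (hL : L.FG) (hM : M.IsLattice K) : ∃ n : ℕ, P ^ n • L ≤ M :=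
  exists_pow_smul_le_of_forall hP hL fun x _ => ((isLattice_iff hp hP).1 hM).2 x

theorem length_quotient_span_pow (hp : Irreducible (p : R)) (n : ℕ) :
    Module.length R (R ⧸ Ideal.span {(p : R) ^ n}) = n := by
  have h := IsDiscreteValuationRing.length_quotient_pow_maximalIdeal R n
  rwa [hp.maximalIdeal_eq, Ideal.span_singleton_pow] at h

/-- The relative length of the lattices with bases `p ^ a i • e i` and `e i`. -/
theorem relLength_span_basis (hp : Irreducible (p : R)) {ι : Type*} [Fintype ι]
    (e : Module.Basis ι K E) (a : ι → ℕ) :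
    relLength (Submodule.span R (Set.range fun i => (p : R) ^ a i • e i))
      (Submodule.span R (Set.range e)) = ∑ i, (a i : ℕ∞) := by
  have hli : LinearIndependent R e :=
    (LinearIndependent.iff_fractionRing (R := R) (K := K)).2 e.linearIndependent
  let b := Module.Basis.span hli
  have hb : ∀ i, (b i : E) = e i := fun i => congrArg Subtype.val (Module.Basis.span_apply hli i)
  let f : Submodule.span R (Set.range e) →ₗ[R] (i : ι) → R ⧸ Ideal.span {(p : R) ^ a i} :=
    (LinearMap.pi fun i => (Submodule.mkQ (Ideal.span {(p : R) ^ a i})).comp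
      (LinearMap.proj i)).comp b.equivFun.toLinearMap
  have hf : Function.Surjective f := by
    intro y
    choose z hz using fun i => Submodule.mkQ_surjective _ (y i)
    refine ⟨b.equivFun.symm z, ?_⟩
    funext i
    rw [← hz i]
    exact congrArg _ (congrFun (b.equivFun.apply_symm_apply z) i)
  have hker : LinearMap.ker f = (Submodule.span R (Set.range fun i => (p : R) ^ a i • e i)).comap
      (Submodule.span R (Set.range e)).subtype := by
    ext x
    have h1 : x ∈ LinearMap.ker f ↔ ∀ i, (p : R) ^ a i ∣ b.equivFun x i := by
      rw [LinearMap.mem_ker, funext_iff]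
      refine forall_congr' fun i => ?_
      rw [← Ideal.mem_span_singleton, ← Submodule.Quotient.mk_eq_zero]
      rfl
    rw [h1, Submodule.mem_comap, Submodule.mem_span_range_iff_exists_fun]
    have h2 : (x : E) = ∑ i, b.equivFun x i • e i := by
      conv_lhs => rw [← b.sum_equivFun x]
      rw [Submodule.coe_sum]
      exact Finset.sum_congr rfl fun i _ => by rw [Submodule.coe_smul, hb]
    constructor
    · intro h
      choose c hc using h
      refine ⟨c, ?_⟩
      rw [Submodule.subtype_apply, h2]
      refine Finset.sum_congr rfl fun i _ => ?_
      rw [hc, smul_smul, mul_comm]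
    · rintro ⟨c, hc⟩ i
      rw [Submodule.subtype_apply, h2] at hc
      have h3 : ∑ i, (c i * (p : R) ^ a i - b.equivFun x i) • e i = 0 := by
        simp only [sub_smul, Finset.sum_sub_distrib, mul_smul, hc, sub_self]
      have h4 := Fintype.linearIndependent_iff.1 hli _ h3 i
      exact ⟨c i, by rw [← sub_eq_zero.1 h4, mul_comm]⟩
  rw [relLength, ← hker, (f.quotKerEquivOfSurjective hf).length_eq, Module.length_pi_of_fintype]
  exact Finset.sum_congr rfl fun i _ => length_quotient_span_pow hp _

theorem relLength_pow_smul [FiniteDimensional K E] (hp : Irreducible (p : R))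
    (hP : ∀ x, P.1 x = (p : R) • x) {L : Submodule R E} (hL : L.IsLattice K) (n : ℕ) :
    relLength (P ^ n • L) L = (Module.finrank K E * n : ℕ) := by
  have : Module.Finite R L := Module.Finite.iff_fg.2 hL.fg
  have : Module.Free R L := Submodule.IsLattice.free K L
  let b := Module.Free.chooseBasis R L
  let e := b.extendOfIsLattice K
  have h1 : L = Submodule.span R (Set.range e) := by
    have h := congrArg (Submodule.map L.subtype) b.span_eq
    rw [Submodule.map_span, Submodule.map_top, Submodule.range_subtype, ← Set.range_comp] at h
    refine h.symm.trans ?_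
    congr 2
    funext i
    exact (Module.Basis.extendOfIsLattice_apply K b i).symm
  have h2 : P ^ n • L = Submodule.span R (Set.range fun i => (p : R) ^ n • e i) := by
    conv_lhs => rw [h1]
    exact pow_smul_span_range hP n e
  have h3 := relLength_span_basis hp e fun _ => n
  rw [← h2, ← h1] at h3
  rw [h3]
  simp [Module.finrank_eq_card_basis e]

/-- If `g` maps two lattices into themselves, the relative lengths of their images are equal. -/
theorem relLength_smul_self_eq [FiniteDimensional K E] (hp : Irreducible (p : R))
    (hP : ∀ x, P.1 x = (p : R) • x) (g : SemilinearAut R E) {L M : Submodule R E}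
    (hL : L.IsLattice K) (hM : M.IsLattice K) (hgL : g • L ≤ L) (hgM : g • M ≤ M) :
    relLength (g • L) L = relLength (g • M) M := by
  obtain ⟨n, hn⟩ := exists_pow_smul_le hp hP hM.fg hL
  have h1 : relLength (g • M) M = relLength (g • P ^ n • M) (P ^ n • M) := by
    rw [smul_pow_smul_of_mul hP, relLength_smul _ hgM]
  have hgM' : g • P ^ n • M ≤ P ^ n • M := by
    rw [smul_pow_smul_of_mul hP]; exact SemilinearAut.smul_le_smul _ hgM
  rw [h1]
  have h2 := relLength_add hgM' hn
  rw [relLength_add (SemilinearAut.smul_le_smul g hn) hgL, relLength_smul g hn, add_comm] at h2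
  obtain ⟨m, hm⟩ := exists_pow_smul_le hp hP hL.fg (isLattice_smul hp hP (P ^ n) hM)
  have h3 : relLength (P ^ n • M) L ≠ ⊤ := by
    have h4 := relLength_add hm hn
    rw [relLength_pow_smul hp hP hL] at h4
    intro h5
    rw [h5, add_top] at h4
    exact ENat.natCast_ne_top _ h4
  exact ENat.add_left_injective_of_ne_top h3 h2

end Lattice

/-! ### Stable lattices -/

section Chains

variable {R E : Type*} [CommRing R] [AddCommGroup E] [Module R E]

/-- A decreasing chain of submodules between `M` and `L` that becomes constant at the first
repetition is constant from the length of `L / M` on. -/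
theorem eq_of_antitone_of_relLength {M L : Submodule R E} {X : ℕ → Submodule R E}
    (hX : Antitone X) (hM : ∀ i, M ≤ X i) (hL : X 0 ≤ L)
    (hstep : ∀ i, X (i + 1) = X i → X (i + 2) = X (i + 1)) {n : ℕ} (hn : relLength M L = n)
    {m : ℕ} (hm : n ≤ m) : X m = X n := by
  have key : ∃ i ≤ n, X (i + 1) = X i := by
    by_contra! h
    have h1 := le_relLength_of_strictMono (M := M) (L := L) (n + 1) (fun t => X (n + 1 - t))
      (hM _) ((hX (Nat.zero_le _)).trans hL) fun t ht => by
        have h2 : n + 1 - t = n + 1 - (t + 1) + 1 := by omega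
        have h3 := h (n + 1 - (t + 1)) (by omega)
        change X (n + 1 - t) < X (n + 1 - (t + 1))
        rw [h2]
        exact lt_of_le_of_ne (hX (by omega)) h3
    rw [hn] at h1
    have : n + 1 ≤ n := by exact_mod_cast h1
    omega
  obtain ⟨i, hi, h⟩ := key
  have h1 : ∀ t, X (i + t + 1) = X (i + t) := by
    intro t
    induction t with
    | zero => exact h
    | succ t ih => exact hstep _ ih
  have h2 : ∀ t, X (i + t) = X i := by
    intro t
    induction t with
    | zero => rfl
    | succ t ih => rw [← ih, ← h1 t]; rfl
  obtain ⟨s, rfl⟩ := Nat.exists_eq_add_of_le hi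
  obtain ⟨t, rfl⟩ := Nat.exists_eq_add_of_le hm
  rw [h2, add_assoc, h2]

end Chains

section StableLattice

variable {R K E : Type*} [CommRing R] [IsDomain R] [IsDiscreteValuationRing R] [Field K]
  [Algebra R K] [IsFractionRing R K] [AddCommGroup E] [Module K E] [Module R E]
  [IsScalarTower R K E] {p : ℕ} {P : SemilinearAut R E}

omit [IsDomain R] [IsDiscreteValuationRing R] [IsFractionRing R K] in
theorem exists_isLattice [FiniteDimensional K E] : ∃ L : Submodule R E, L.IsLattice K := by
  let e := Module.finBasis K E
  refine ⟨Submodule.span R (Set.range e), Submodule.fg_span (Set.finite_range e), ?_⟩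
  rw [Submodule.span_span_of_tower, e.span_eq]

/-- If the iterates of `g` enlarge a lattice sublinearly, with rate below `1 / dim E`, then `g` has
a stable lattice: the lengths of `L + g L + ⋯ + gⁱ L` over `L` cannot increase at each step. -/
theorem exists_smul_le_of_pow_smul_le [FiniteDimensional K E] (hp : Irreducible (p : R))
    (hP : ∀ x, P.1 x = (p : R) • x) (g : SemilinearAut R E) {L : Submodule R E}
    (hL : L.IsLattice K) {e j : ℕ} (h : ∀ i ≤ j, P ^ e • g ^ i • L ≤ L)
    (hj : Module.finrank K E * e < j) : ∃ M : Submodule R E, M.IsLattice K ∧ g • M ≤ M := by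
  let X : ℕ → Submodule R E := fun i => partialSups (fun m => g ^ m • L) i
  have hXs : ∀ i, X (i + 1) = X i ⊔ g ^ (i + 1) • L := fun i => partialSups_succ _ i
  have hX0 : X 0 = L := by
    simp only [X, partialSups_zero, pow_zero, one_smul]
  have hmono : Monotone X := (partialSups _).monotone
  have hg : ∀ i, g • X i ≤ X (i + 1) := by
    intro i
    induction i with
    | zero => rw [hXs, hX0, zero_add, pow_one]; exact le_sup_right
    | succ i ih =>
      rw [hXs i, SemilinearAut.smul_sup, ← mul_smul, ← pow_succ']
      exact sup_le (ih.trans (hmono (Nat.le_succ _))) ((hXs (i + 1)).ge.trans' le_sup_right)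
  have hlat : ∀ i, (X i).IsLattice K := by
    intro i
    induction i with
    | zero => rw [hX0]; exact hL
    | succ i ih =>
      have := isLattice_smul hp hP (g ^ (i + 1)) hL
      rw [hXs]
      exact Submodule.IsLattice.sup K _ _
  by_cases hex : ∃ i < j, X (i + 1) = X i
  · obtain ⟨i, -, hi⟩ := hex
    exact ⟨X i, hlat i, (hg i).trans hi.le⟩
  · exfalso
    push Not at hex
    have hXj : P ^ e • X j ≤ L := by
      rw [SemilinearAut.smul_le_iff]
      exact partialSups_le _ _ _ fun i hi => SemilinearAut.smul_le_iff.1 (h i hi)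
    have h1 := le_relLength_of_strictMono (M := P ^ e • L) (L := L) j (fun i => P ^ e • X i)
      (by rw [hX0]) hXj fun i hi => by
        refine lt_of_le_of_ne (SemilinearAut.smul_le_smul _ (hmono (Nat.le_succ _))) fun h => ?_
        exact hex i hi (smul_left_cancel _ h).symm
    rw [relLength_pow_smul hp hP hL] at h1
    have : j ≤ Module.finrank K E * e := by exact_mod_cast h1
    omega

/-- If `g` is nilpotent modulo `p` on a lattice, then its nilpotency index there is at most the
dimension. -/
theorem pow_finrank_smul_le [FiniteDimensional K E] (hp : Irreducible (p : R))
    (hP : ∀ x, P.1 x = (p : R) • x) (g : SemilinearAut R E) {L : Submodule R E}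
    (hL : L.IsLattice K) (hgL : g • L ≤ L) {m : ℕ} (h : g ^ m • L ≤ P • L) :
    g ^ Module.finrank K E • L ≤ P • L := by
  let X : ℕ → Submodule R E := fun i => g ^ i • L ⊔ P • L
  have hgP : g • P • L ≤ P • L := by
    rw [smul_smul_of_mul hP]; exact SemilinearAut.smul_le_smul _ hgL
  have hstep : ∀ i, X (i + 1) = g • X i ⊔ P • L := by
    intro i
    simp only [X]
    rw [SemilinearAut.smul_sup, sup_assoc, sup_eq_right.2 hgP, ← mul_smul, pow_succ']
  have hn : relLength (P • L) L = Module.finrank K E := by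
    simpa using relLength_pow_smul hp hP hL 1
  have h1 := eq_of_antitone_of_relLength (X := X)
    (fun i j hij => sup_le_sup_right (SemilinearAut.pow_smul_anti hgL hij) _)
    (fun _ => le_sup_right) (sup_le (by simp) (smul_le_of_mul hP L))
    (fun i hi => by rw [hstep (i + 1), hi, ← hstep, hi]) hn (le_max_right m (Module.finrank K E))
  refine le_sup_left.trans (h1.ge.trans ?_)
  exact sup_le ((SemilinearAut.pow_smul_anti hgL (le_max_left _ _)).trans h) le_rfl

theorem exists_forall_lt_pow_smul_le (hp : Irreducible (p : R))
    (hP : ∀ x, P.1 x = (p : R) • x) (g : SemilinearAut R E) {M L : Submodule R E}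
    (hM : M.FG) (hL : L.IsLattice K) (b : ℕ) : ∃ C : ℕ, ∀ r < b, P ^ C • g ^ r • M ≤ L := by
  choose C hC using fun r : ℕ => exists_pow_smul_le hp hP (SemilinearAut.smul_fg (g ^ r) hM) hL
  refine ⟨(Finset.range b).sup C, fun r hr => ?_⟩
  exact (pow_smul_anti_of_mul hP _ (Finset.le_sup (Finset.mem_range.2 hr))).trans (hC r)

/-- There is a lattice that `p ^ (-a) Φ ^ b` maps into itself. For `0 < b` this says that all
slopes of `Φ` are at least `a / b`. -/
def SlopesGE (K : Type*) [Field K] [Algebra R K] [Module K E] [IsScalarTower R K E]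
    (P Φ : SemilinearAut R E) (a : ℤ) (b : ℕ) : Prop :=
  ∃ M : Submodule R E, M.IsLattice K ∧ (Φ ^ b * P ^ (-a)) • M ≤ M

omit [IsDomain R] [IsDiscreteValuationRing R] in
/-- The `d`-th power of `p ^ (-a) Φ ^ b` and the `b`-th power of `p ^ (-c) Φ ^ d` differ by a power
of `p`. -/
theorem pow_mul_zpow_neg_pow (hP : ∀ x, P.1 x = (p : R) • x) (Φ : SemilinearAut R E) (a c : ℤ)
    (b d : ℕ) :
    (Φ ^ b * P ^ (-a)) ^ d = P ^ (b * c - a * d) * (Φ ^ d * P ^ (-c)) ^ b := by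
  have h : ∀ (m : ℕ) (n : ℤ), Commute (Φ ^ m) (P ^ n) := fun m n =>
    ((commute_of_mul hP (Φ ^ m)).zpow_left n).symm
  rw [(h b (-a)).mul_pow, (h d (-c)).mul_pow, ← pow_mul, ← pow_mul, ← (h _ _).left_comm,
    ← zpow_natCast (P ^ (-a)), ← zpow_natCast (P ^ (-c)), ← zpow_mul, ← zpow_mul, ← zpow_add,
    mul_comm b d]
  congr 2
  ring

/-- A lower bound for the slopes may be increased to any `a / b` that exceeds it by less than
`1 / (dim E * b)`: on a lattice for the given bound, the iterates of `p ^ (-a) Φ ^ b` grow at a rate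
below `1 / dim E`. -/
theorem SlopesGE.of_lt [FiniteDimensional K E] (hp : Irreducible (p : R))
    (hP : ∀ x, P.1 x = (p : R) • x) {Φ : SemilinearAut R E} {a c : ℤ} {b d : ℕ}
    (hd : 0 < d) (h : SlopesGE K P Φ c d)
    (hlt : Module.finrank K E * (a * d - b * c) < d) : SlopesGE K P Φ a b := by
  obtain ⟨M, hM, hle⟩ := h
  set g := Φ ^ b * P ^ (-a) with hg
  set n := Module.finrank K E with hn
  obtain ⟨C, hC⟩ := exists_forall_lt_pow_smul_le hp hP g hM.fg hM d
  set δ := (a * d - b * c).toNat with hδ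
  have hnδ : n * δ < d := by
    rcases le_total 0 (a * d - b * c) with h0 | h0
    · zify
      rw [hδ, Int.toNat_of_nonneg h0]
      exact hlt
    · rw [hδ, Int.toNat_of_nonpos h0, mul_zero]
      exact hd
  have h1 : ∀ i, P ^ (δ * i) • g ^ (d * i) • M ≤ M := by
    intro i
    have h2 : P ^ δ • g ^ d • M ≤ M := by
      rw [hg, pow_mul_zpow_neg_pow hP Φ a c b d, mul_smul, ← zpow_natCast, ← mul_smul,
        ← zpow_add]
      refine (zpow_smul_anti_of_mul hP _ (m := 0) ?_).trans ?_
      · have := Int.self_le_toNat (a * d - b * c)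
        rw [← hδ] at this
        linarith
      · rw [zpow_zero, one_smul]
        exact SemilinearAut.pow_smul_le hle b
    have h3 := SemilinearAut.pow_smul_le (g := P ^ δ * g ^ d) (L := M)
      (by rw [mul_smul]; exact h2) i
    rwa [((commute_of_mul hP (g ^ d)).pow_left δ).mul_pow, ← pow_mul, ← pow_mul, mul_smul] at h3
  have h4 : ∀ I i, i ≤ d * I → P ^ (C + δ * I) • g ^ i • M ≤ M := by
    intro I i hi
    obtain ⟨r, q, hr, rfl⟩ : ∃ r q, r < d ∧ i = r + d * q :=
      ⟨i % d, i / d, Nat.mod_lt _ hd, (Nat.mod_add_div i d).symm⟩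
    have h5 : q ≤ I := Nat.le_of_mul_le_mul_left ((Nat.le_add_left _ _).trans hi) hd
    have h6 : P ^ (C + δ * q) • g ^ (r + d * q) • M ≤ M := by
      rw [pow_add, pow_add, mul_smul, mul_smul (g ^ r), ← smul_pow_smul_of_mul hP (g ^ r)]
      exact (SemilinearAut.smul_le_smul _ (SemilinearAut.smul_le_smul _ (h1 q))).trans (hC r hr)
    exact (pow_smul_anti_of_mul hP _
      (Nat.add_le_add_left (Nat.mul_le_mul_left δ h5) C)).trans h6
  refine exists_smul_le_of_pow_smul_le hp hP g hM (e := C + δ * (n * C + 1))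
    (j := d * (n * C + 1)) (h4 _) ?_
  have h7 : (n * δ + 1) * (n * C + 1) ≤ d * (n * C + 1) := Nat.mul_le_mul_right _ hnδ
  rw [← hn]
  nlinarith

theorem exists_slopesGE [FiniteDimensional K E] (hp : Irreducible (p : R))
    (hP : ∀ x, P.1 x = (p : R) • x) (Φ : SemilinearAut R E) : ∃ a : ℤ, SlopesGE K P Φ a 1 := by
  obtain ⟨L, hL⟩ := exists_isLattice (R := R) (K := K) (E := E)
  obtain ⟨n, hn⟩ := exists_pow_smul_le hp hP (SemilinearAut.smul_fg Φ hL.fg) hL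
  refine ⟨-n, L, hL, ?_⟩
  rw [neg_neg, pow_one, zpow_natCast, mul_smul, smul_pow_smul_of_mul hP]
  exact hn

/-- The lower bounds for the slopes are bounded above: some `p ^ (-C) Φ` expands a lattice. -/
theorem exists_forall_slopesGE_le [FiniteDimensional K E] [Nontrivial E]
    (hp : Irreducible (p : R)) (hP : ∀ x, P.1 x = (p : R) • x) (Φ : SemilinearAut R E) :
    ∃ C : ℕ, ∀ (a : ℤ) (b : ℕ), SlopesGE K P Φ a b → a ≤ C * b := by
  obtain ⟨L, hL⟩ := exists_isLattice (R := R) (K := K) (E := E)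
  obtain ⟨C, hC⟩ := exists_pow_smul_le hp hP (SemilinearAut.smul_fg Φ⁻¹ hL.fg) hL
  refine ⟨C, fun a b ⟨M, hM, hle⟩ => ?_⟩
  by_contra! hlt
  -- `h` expands `L`, while a power of `h` maps `M` into `p M`
  set h := Φ * P ^ (-C : ℤ) with hh
  have hcomm : ∀ n : ℤ, Commute Φ (P ^ n) := fun n => ((commute_of_mul hP Φ).zpow_left n).symm
  have h1 : h⁻¹ • L ≤ L := by
    rw [hh, mul_inv_rev, zpow_neg, inv_inv, zpow_natCast, mul_smul]
    exact hC
  have h2 : h ^ b • M ≤ P • M := by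
    have h3 : h ^ b = P ^ (a - C * b) * (Φ ^ b * P ^ (-a)) := by
      rw [hh, (hcomm _).mul_pow, ← zpow_natCast (P ^ (-C : ℤ)), ← zpow_mul,
        ← (((commute_of_mul hP (Φ ^ b)).zpow_left (a - C * b)).symm).left_comm, ← zpow_add]
      congr 2
      ring
    rw [h3, mul_smul]
    refine (zpow_smul_anti_of_mul hP _ (m := 1) (by omega)).trans ?_
    rw [zpow_one]
    exact SemilinearAut.smul_le_smul _ hle
  have h4 : ∀ m : ℕ, (h ^ b) ^ m • M ≤ P ^ m • M := by
    intro m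
    induction m with
    | zero => simp
    | succ m ih =>
      rw [pow_succ', pow_succ, mul_smul, mul_smul]
      refine (SemilinearAut.smul_le_smul _ ih).trans ?_
      rw [smul_pow_smul_of_mul hP]
      exact SemilinearAut.smul_le_smul _ h2
  obtain ⟨e, he⟩ := exists_pow_smul_le hp hP hL.fg hM
  have h5 : P ^ e • L = ⊥ := by
    rw [eq_bot_iff]
    intro x hx
    refine eq_zero_of_forall_mem_pow_smul hp hP hM.fg fun m => h4 m ?_
    have h6 : (h ^ b)⁻¹ ^ m • P ^ e • L ≤ P ^ e • L := by
      refine SemilinearAut.pow_smul_le ?_ m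
      rw [smul_pow_smul_of_mul hP, ← inv_pow]
      exact SemilinearAut.smul_le_smul _ (SemilinearAut.pow_smul_le h1 b)
    rw [SemilinearAut.smul_le_iff, ← inv_pow, inv_inv] at h6
    exact SemilinearAut.smul_le_smul _ he (h6 hx)
  obtain ⟨x, hx⟩ := exists_ne (0 : E)
  obtain ⟨m, hm⟩ := ((isLattice_iff hp hP).1 (isLattice_smul hp hP (P ^ e) hL)).2 x
  rw [h5, Submodule.mem_bot, map_eq_zero_iff _ (P ^ m).1.injective] at hm
  exact hx hm

/-- There is a smallest slope `q`: the automorphism `p ^ (-a) Φ ^ b`, where `q = a / b`, has a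
stable lattice and is not nilpotent modulo `p` on it. The number `q` is the supremum of the lower
bounds for the slopes: a rational number with denominator at most `dim E` that approximates the
supremum as well as in Dirichlet's theorem is a lower bound, and so would be a larger number if the
automorphism were nilpotent modulo `p`. -/
theorem exists_smallest_slope [FiniteDimensional K E] [Nontrivial E] (hp : Irreducible (p : R))
    (hP : ∀ x, P.1 x = (p : R) • x) (Φ : SemilinearAut R E) :
    ∃ (q : ℚ) (L : Submodule R E), L.IsLattice K ∧ (Φ ^ q.den * P ^ (-q.num)) • L ≤ L ∧
      ∀ m, ¬ (Φ ^ q.den * P ^ (-q.num)) ^ m • L ≤ P • L := by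
  set n := Module.finrank K E with hn
  have hn0 : 0 < n := Module.finrank_pos
  have hn0' : (0 : ℝ) < n := by exact_mod_cast hn0
  let S : Set ℝ := {x | ∃ q : ℚ, (q : ℝ) = x ∧ SlopesGE K P Φ q.num q.den}
  have hne : S.Nonempty := by
    obtain ⟨a, ha⟩ := exists_slopesGE (K := K) hp hP Φ
    exact ⟨_, (a : ℚ), rfl, by simpa using ha⟩
  have hbdd : BddAbove S := by
    obtain ⟨C, hC⟩ := exists_forall_slopesGE_le (K := K) hp hP Φ
    refine ⟨C, ?_⟩
    rintro _ ⟨q, rfl, hq⟩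
    have h1 : (q.num : ℚ) ≤ C * q.den := by exact_mod_cast hC _ _ hq
    have h2 : q ≤ C := by
      rw [← Rat.num_div_den q]
      exact (div_le_iff₀ (by exact_mod_cast q.pos)).2 h1
    exact_mod_cast h2
  set lam := sSup S with hlam
  -- Dirichlet: `|lam - q| ≤ 1 / ((n + 1) * b)` with `b ≤ n`
  obtain ⟨q, hq, hqn⟩ := Real.exists_rat_abs_sub_le_and_den_le lam hn0
  set b := q.den with hb
  have hb0 : 0 < b := q.pos
  have hb0' : (0 : ℝ) < b := by exact_mod_cast hb0
  -- there is a lower bound `s` with `q - s < 1 / (n * b)`, the tolerance of `SlopesGE.of_lt`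
  have hqS : SlopesGE K P Φ q.num b := by
    obtain ⟨_, ⟨s, rfl, hs⟩, hlt⟩ := exists_lt_of_lt_csSup hne
      (show lam - (1 / (n * b) - 1 / ((n + 1) * b)) < lam by
        have : (1 : ℝ) / ((n + 1) * b) < 1 / (n * b) := by
          apply one_div_lt_one_div_of_lt
          · positivity
          · nlinarith
        linarith)
    refine hs.of_lt hp hP s.pos ?_
    have h1 : (q : ℝ) - s < 1 / (n * b) := by
      have := (abs_le.1 hq).1
      linarith
    have hd0 : (0 : ℝ) < s.den := by exact_mod_cast s.pos
    have hqq : (q : ℝ) = q.num / b := by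
      have := Rat.num_div_den q
      exact_mod_cast this.symm
    have hss : (s : ℝ) = s.num / s.den := by
      have := Rat.num_div_den s
      exact_mod_cast this.symm
    rw [hqq, hss, div_sub_div _ _ hb0'.ne' hd0.ne', div_lt_div_iff₀ (by positivity)
      (by positivity)] at h1
    have h2 : (n : ℝ) * (q.num * s.den - b * s.num) < s.den := by
      have h3 : ((n : ℝ) * (q.num * s.den - b * s.num)) * b < s.den * b := by linarith
      exact lt_of_mul_lt_mul_right h3 hb0'.le
    exact_mod_cast h2
  obtain ⟨L, hL, hle⟩ := hqS
  refine ⟨q, L, hL, hle, fun m hm => ?_⟩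
  -- otherwise `q + 1 / (n * b)` is a lower bound for the slopes as well
  have h1 := pow_finrank_smul_le hp hP _ hL hle hm
  rw [← hn] at h1
  set q' : ℚ := (n * q.num + 1 : ℤ) / (n * b : ℕ) with hq'
  have hnb : (0 : ℚ) < (n * b : ℕ) := by exact_mod_cast Nat.mul_pos hn0 hb0
  have h2 : SlopesGE K P Φ (n * q.num + 1) (n * b) := by
    refine ⟨L, hL, ?_⟩
    have h3 : Φ ^ (n * b) * P ^ (-(n * q.num + 1 : ℤ)) = P⁻¹ * (Φ ^ b * P ^ (-q.num)) ^ n := by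
      have hc := ((commute_of_mul hP (Φ ^ b)).zpow_left (-q.num)).symm
      rw [hc.mul_pow, ← pow_mul, mul_comm n b, ← zpow_natCast (P ^ (-q.num)), ← zpow_mul,
        ← ((commute_of_mul hP (Φ ^ (b * n))).inv_left.symm).left_comm, ← zpow_neg_one P, ← zpow_add]
      congr 2
      ring
    rw [h3, mul_smul, SemilinearAut.smul_le_iff, inv_inv]
    exact h1
  have h3 : SlopesGE K P Φ q'.num q'.den := by
    refine h2.of_lt hp hP (Nat.mul_pos hn0 hb0) ?_
    have h4 : (q'.num : ℚ) * (n * b : ℕ) = q'.den * (n * q.num + 1 : ℤ) := by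
      have h5 : q' * (n * b : ℕ) = (n * q.num + 1 : ℤ) := div_mul_cancel₀ _ hnb.ne'
      have h6 : q' * q'.den = q'.num := Rat.mul_den_eq_num q'
      rw [← h5, ← h6]
      ring
    have h5 : q'.num * (n * b : ℕ) = q'.den * (n * q.num + 1 : ℤ) := by exact_mod_cast h4
    rw [h5, sub_self, mul_zero]
    exact_mod_cast Nat.mul_pos hn0 hb0
  have h4 : (q' : ℝ) ≤ lam := le_csSup hbdd ⟨q', rfl, h3⟩
  have h5 : (q' : ℝ) = q + 1 / (n * b) := by
    have h6 : q' = q + 1 / (n * b) := by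
      have h7 : q * b = q.num := Rat.mul_den_eq_num q
      have hb1 : (b : ℚ) ≠ 0 := by exact_mod_cast hb0.ne'
      have hn1 : (n : ℚ) ≠ 0 := by exact_mod_cast hn0.ne'
      rw [hq']
      push_cast
      rw [← h7]
      field_simp
    rw [h6]
    push_cast
    rfl
  have h6 : (1 : ℝ) / ((n + 1) * b) < 1 / (n * b) := by
    apply one_div_lt_one_div_of_lt
    · positivity
    · nlinarith
  have h7 := (abs_le.1 hq).2
  linarith

end StableLattice

/-! ### The slope decomposition -/

section Fitting

variable {R K E : Type*} [CommRing R] [IsDomain R] [IsDiscreteValuationRing R] [Field K]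
  [Algebra R K] [IsFractionRing R K] [AddCommGroup E] [Module K E] [Module R E]
  [IsScalarTower R K E] {p : ℕ} {P : SemilinearAut R E}

/-- A Fitting decomposition: if `g` maps a lattice `L` into itself, every element of `L` is the sum
of an element of `⋂ gᵐ L` and an element on which the powers of `g` tend to zero. Modulo `pᴺ` this
is Fitting's lemma for modules of finite length, and the components modulo the various `pᴺ` form
Cauchy sequences since the kernels of the powers of `g` modulo `pᴺ` become stationary. -/
theorem exists_fitting [FiniteDimensional K E] [IsAdicComplete (Ideal.span {(p : R)}) R]
    (hp : Irreducible (p : R))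
    (hP : ∀ x, P.1 x = (p : R) • x) (g : SemilinearAut R E) {L : Submodule R E}
    (hL : L.IsLattice K) (hgL : g • L ≤ L) {x : E} (hx : x ∈ L) :
    ∃ z, (∀ m : ℕ, z ∈ g ^ m • L) ∧ ∀ N : ℕ, ∃ m, ∀ k ≥ m, (g ^ k).1 (x - z) ∈ P ^ N • L := by
  have hPL : ∀ N : ℕ, P ^ N • L ≤ L := fun N =>
    SemilinearAut.pow_smul_le (smul_le_of_mul hP L) N
  have hgP : ∀ k N : ℕ, g ^ k • P ^ N • L ≤ P ^ N • L := fun k N => by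
    rw [smul_pow_smul_of_mul hP]
    exact SemilinearAut.smul_le_smul _ (SemilinearAut.pow_smul_le hgL k)
  have hgpow : ∀ (k : ℕ) {y : E}, y ∈ L → (g ^ k).1 y ∈ L := fun k y hy =>
    SemilinearAut.pow_smul_le hgL k (SemilinearAut.apply_mem_smul.2 hy)
  have hgpowP : ∀ (k N : ℕ) {y : E}, y ∈ P ^ N • L → (g ^ k).1 y ∈ P ^ N • L := fun k N y hy =>
    hgP k N (SemilinearAut.apply_mem_smul.2 hy)
  have hadd : ∀ (k l : ℕ) (y : E), (g ^ (k + l)).1 y = (g ^ k).1 ((g ^ l).1 y) := fun k l y => by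
    rw [pow_add, SemilinearAut.mul_apply]
  have : Module.Finite R L := Module.Finite.iff_fg.2 hL.fg
  -- the images and the kernels of the powers of `g` modulo `p ^ N` are stationary from `t N` on
  have hker : ∀ N : ℕ, ∃ t, ∀ k ≥ t, ∀ y ∈ L, (g ^ k).1 y ∈ P ^ N • L →
      (g ^ t).1 y ∈ P ^ N • L := by
    intro N
    let X : ℕ →o Submodule R L :=
      { toFun := fun m => ((g ^ m)⁻¹ • P ^ N • L).comap L.subtype
        monotone' := by
          refine monotone_nat_of_le_succ fun m => Submodule.comap_mono ?_
          rw [pow_succ', mul_inv_rev, mul_smul]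
          refine SemilinearAut.smul_le_smul _ ?_
          rw [SemilinearAut.le_smul_iff, inv_inv]
          simpa using hgP 1 N }
    obtain ⟨t, ht⟩ := monotone_stabilizes_iff_noetherian.2 (inferInstance : IsNoetherian R L) X
    have hmem : ∀ m (y : L), y ∈ X m ↔ (g ^ m).1 y ∈ P ^ N • L := by
      intro m y
      change (y : E) ∈ (g ^ m)⁻¹ • P ^ N • L ↔ _
      rw [SemilinearAut.mem_smul, inv_inv]
    refine ⟨t, fun k hk y hy h => ?_⟩
    rw [← hmem t ⟨y, hy⟩, ht k hk, hmem]
    exact h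
  have him : ∀ N : ℕ, ∀ k ≥ Module.finrank K E * N, g ^ (Module.finrank K E * N) • L ≤
      g ^ k • L ⊔ P ^ N • L := by
    intro N k hk
    let X : ℕ → Submodule R E := fun i => g ^ i • L ⊔ P ^ N • L
    have hstep : ∀ i, X (i + 1) = g • X i ⊔ P ^ N • L := by
      intro i
      have h1 : g • P ^ N • L ≤ P ^ N • L := by simpa using hgP 1 N
      simp only [X]
      rw [SemilinearAut.smul_sup, sup_assoc, sup_eq_right.2 h1, ← mul_smul, pow_succ']
    have h1 := eq_of_antitone_of_relLength (X := X)
      (fun i j hij => sup_le_sup_right (SemilinearAut.pow_smul_anti hgL hij) _)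
      (fun _ => le_sup_right) (sup_le (by simp) (hPL N))
      (fun i hi => by rw [hstep (i + 1), hi, ← hstep, hi]) (relLength_pow_smul hp hP hL N) hk
    exact le_sup_left.trans h1.ge
  choose t ht using hker
  let m : ℕ → ℕ := fun N =>
    ∑ i ∈ Finset.range (N + 1), (t i + Module.finrank K E * i) + N
  have hm_mono : ∀ N, m N ≤ m (N + 1) := by
    intro N
    simp only [m, Finset.sum_range_succ _ (N + 1)]
    omega
  have hm_ge : ∀ N, t N + Module.finrank K E * N ≤ m N := by
    intro N
    simp only [m, Finset.sum_range_succ]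
    omega
  have hmN : ∀ N, N ≤ m N := fun N => Nat.le_add_left _ _
  have hker' : ∀ N, ∀ k ≥ m N, ∀ y ∈ L, (g ^ k).1 y ∈ P ^ N • L →
      (g ^ m N).1 y ∈ P ^ N • L := by
    intro N k hk y hy h
    have h1 : t N ≤ m N := (Nat.le_add_right _ _).trans (hm_ge N)
    have h2 := hgpowP (m N - t N) N (ht N k (h1.trans hk) y hy h)
    rwa [← hadd, Nat.sub_add_cancel h1] at h2
  have happrox : ∀ N, ∃ y ∈ g ^ m N • L, (g ^ m N).1 (x - y) ∈ P ^ N • L := by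
    intro N
    have h1 : Module.finrank K E * N ≤ m N := (Nat.le_add_left _ _).trans (hm_ge N)
    have h2 : (g ^ m N).1 x ∈ g ^ (m N + m N) • L ⊔ P ^ N • L :=
      him N _ (h1.trans (Nat.le_add_left _ _))
        (SemilinearAut.pow_smul_anti hgL h1 (SemilinearAut.apply_mem_smul.2 hx))
    obtain ⟨_, ⟨z, hz, rfl⟩, w, hw, hzw⟩ := Submodule.mem_sup.1 h2
    refine ⟨(g ^ m N).1 z, SemilinearAut.apply_mem_smul.2 hz, ?_⟩
    have hzw' : (g ^ m N).1 ((g ^ m N).1 z) + w = (g ^ m N).1 x := by rw [← hadd]; exact hzw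
    rw [map_sub, ← hzw', add_sub_cancel_left]
    exact hw
  choose y hy hxy using happrox
  have hyL : ∀ N, y N ∈ L := fun N => SemilinearAut.pow_smul_le hgL _ (hy N)
  have hcauchy : ∀ N, y (N + 1) - y N ∈ P ^ N • L := by
    intro N
    have h1 : (g ^ m N).1 (x - y (N + 1)) ∈ P ^ N • L :=
      hker' N _ (hm_mono N) _ (L.sub_mem hx (hyL _))
        (pow_smul_anti_of_mul hP L (Nat.le_succ N) (hxy (N + 1)))
    have h2 : (g ^ m N).1 (y (N + 1) - y N) ∈ P ^ N • L := by
      have h3 := Submodule.sub_mem _ (hxy N) h1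
      rwa [← map_sub, sub_sub_sub_cancel_left] at h3
    obtain ⟨v, hv, hvy⟩ : y (N + 1) - y N ∈ g ^ m N • L :=
      Submodule.sub_mem _ (SemilinearAut.pow_smul_anti hgL (hm_mono N) (hy (N + 1))) (hy N)
    rw [← hvy]
    refine hker' N (m N + m N) (Nat.le_add_left _ _) v hv ?_
    rw [hadd]
    exact hvy.symm ▸ h2
  obtain ⟨z, hz⟩ := exists_forall_sub_mem_pow_smul hP hL.fg y hcauchy
  refine ⟨z, fun k => ?_, fun N => ⟨m N, fun k hk => ?_⟩⟩
  · obtain ⟨c, hc⟩ := exists_pow_smul_le hp hP hL.fg (isLattice_smul hp hP (g ^ k) hL)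
    rw [← sub_add_cancel z (y (max c k))]
    exact Submodule.add_mem _ (hc (pow_smul_anti_of_mul hP L (le_max_left c k) (hz _)))
      (SemilinearAut.pow_smul_anti hgL ((le_max_right c k).trans (hmN _)) (hy _))
  · have h1 : (g ^ m N).1 (x - z) ∈ P ^ N • L := by
      rw [← sub_sub_sub_cancel_right x z (y N), map_sub]
      exact Submodule.sub_mem _ (hxy N) (hgpowP _ _ (hz N))
    have h2 := hgpowP (k - m N) N h1
    rwa [← hadd, Nat.sub_add_cancel hk] at h2

/-- The subspace of all elements on which the powers of `g` tend to zero for the `p`-adic topology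
that is given by the submodule `L`. -/
def contractedPart (K : Type*) [Field K] [Algebra R K] [IsFractionRing R K] [Module K E]
    [IsScalarTower R K E] (hp : Irreducible (p : R)) (hP : ∀ x, P.1 x = (p : R) • x)
    (g : SemilinearAut R E) (L : Submodule R E) : Submodule K E where
  carrier := {x | ∀ N : ℕ, ∃ m, ∀ k ≥ m, (g ^ k).1 x ∈ P ^ N • L}
  zero_mem' N := ⟨0, fun k _ => by rw [map_zero]; exact Submodule.zero_mem _⟩
  add_mem' {x y} hx hy N := by
    obtain ⟨m, hm⟩ := hx N
    obtain ⟨n, hn⟩ := hy N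
    refine ⟨max m n, fun k hk => ?_⟩
    rw [map_add]
    exact Submodule.add_mem _ (hm k (le_of_max_le_left hk)) (hn k (le_of_max_le_right hk))
  smul_mem' c x hx N := by
    obtain ⟨n, r, hr⟩ := exists_pow_mul_eq_algebraMap (K := K) hp c
    obtain ⟨m, hm⟩ := hx (n + N)
    refine ⟨m, fun k hk => ?_⟩
    have h1 : (P ^ n).1 ((g ^ k).1 (c • x)) = (g ^ k).1 (r • x) := by
      rw [← SemilinearAut.mul_apply, ((commute_of_mul hP (g ^ k)).pow_left n).eq,
        SemilinearAut.mul_apply, pow_apply_of_mul hP, ← algebraMap_smul K ((p : R) ^ n) (c • x),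
        smul_smul, map_pow, hr, algebraMap_smul]
    obtain ⟨τ, hτ⟩ := (g ^ k).2
    rw [hτ] at h1
    have h2 := Submodule.smul_mem _ (τ r) (hm k hk)
    rwa [← h1, pow_add, mul_smul, SemilinearAut.apply_mem_smul] at h2

theorem contractedPart_stable (hp : Irreducible (p : R)) (hP : ∀ x, P.1 x = (p : R) • x)
    {g Φ : SemilinearAut R E} (hc : Commute Φ g) {L : Submodule R E} (hL : L.IsLattice K)
    {x : E} (hx : x ∈ contractedPart K hp hP g L) : Φ.1 x ∈ contractedPart K hp hP g L := by
  intro N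
  obtain ⟨c, hc'⟩ := exists_pow_smul_le hp hP (SemilinearAut.smul_fg Φ hL.fg) hL
  obtain ⟨m, hm⟩ := hx (N + c)
  refine ⟨m, fun k hk => ?_⟩
  have h1 : (g ^ k).1 (Φ.1 x) ∈ Φ • P ^ (N + c) • L := by
    rw [← SemilinearAut.mul_apply, ← (hc.pow_right k).eq]
    exact SemilinearAut.apply_mem_smul.2 (hm k hk)
  rw [smul_pow_smul_of_mul hP, pow_add, mul_smul] at h1
  exact SemilinearAut.smul_le_smul _ hc' h1

end Fitting

section Intertwining

variable {R E E' : Type*} [CommRing R] [AddCommGroup E] [Module R E] [AddCommGroup E']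
  [Module R E']

/-- The linear map `f` commutes with the semilinear automorphisms `g'` and `g`. -/
def Intertwines (f : E' →ₗ[R] E) (g' : SemilinearAut R E') (g : SemilinearAut R E) : Prop :=
  ∀ x, f (g'.1 x) = g.1 (f x)

namespace Intertwines

variable {f : E' →ₗ[R] E} {g' h' : SemilinearAut R E'} {g h : SemilinearAut R E}

theorem mul (hg : Intertwines f g' g) (hh : Intertwines f h' h) :
    Intertwines f (g' * h') (g * h) := fun x => by
  rw [SemilinearAut.mul_apply, SemilinearAut.mul_apply, hg, hh]

theorem inv (hg : Intertwines f g' g) : Intertwines f g'⁻¹ g⁻¹ := fun x => by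
  apply g.1.injective
  rw [← hg, SemilinearAut.apply_inv_self, SemilinearAut.apply_inv_self]

theorem pow (hg : Intertwines f g' g) (n : ℕ) : Intertwines f (g' ^ n) (g ^ n) := by
  induction n with
  | zero => intro x; simp
  | succ n ih => rw [pow_succ, pow_succ]; exact ih.mul hg

theorem zpow (hg : Intertwines f g' g) (n : ℤ) : Intertwines f (g' ^ n) (g ^ n) := by
  obtain ⟨m, rfl | rfl⟩ := n.eq_nat_or_neg
  · simpa using hg.pow m
  · simpa using (hg.pow m).inv

theorem map_smul (hg : Intertwines f g' g) (M : Submodule R E') :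
    (g' • M).map f = g • M.map f := by
  ext x
  constructor
  · rintro ⟨_, ⟨y, hy, rfl⟩, rfl⟩
    rw [hg]
    exact SemilinearAut.apply_mem_smul.2 ⟨y, hy, rfl⟩
  · rintro ⟨_, ⟨y, hy, rfl⟩, rfl⟩
    rw [← hg]
    exact ⟨_, SemilinearAut.apply_mem_smul.2 hy, rfl⟩

end Intertwines

/-- The restriction of a semilinear automorphism to a stable subspace. -/
def SemilinearAut.restrict {K : Type*} [Field K] [Algebra R K] [Module K E] [IsScalarTower R K E]
    (g : SemilinearAut R E) (U : Submodule K E) (h : ∀ x ∈ U, g.1 x ∈ U)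
    (h' : ∀ x ∈ U, (g⁻¹).1 x ∈ U) : SemilinearAut R U where
  toEquiv :=
    { toFun := fun x => ⟨g.1 x, h x x.2⟩
      invFun := fun x => ⟨(g⁻¹).1 x, h' x x.2⟩
      left_inv := fun x => Subtype.ext (g.inv_apply_self x)
      right_inv := fun x => Subtype.ext (g.apply_inv_self x)
      map_add' := fun x y => Subtype.ext (map_add g.1 (x : E) y) }
  exists_map_smul := by
    obtain ⟨τ, hτ⟩ := g.2
    exact ⟨τ, fun a x => Subtype.ext (hτ a x)⟩

end Intertwining

section Slopes

variable {R K E : Type*} [CommRing R] [Field K]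
  [Algebra R K] [AddCommGroup E] [Module K E] [Module R E]
  [IsScalarTower R K E] {p : ℕ} {P : SemilinearAut R E}

/-- The part of slope `q = a / b` of `E` with the semilinear automorphism `Φ`: the subspace that
is spanned by the finitely generated submodules `M` with `Φ ^ b M = p ^ a M`. -/
def slopeSubspace (K : Type*) [Field K] [Algebra R K] [Module K E] [IsScalarTower R K E]
    (P Φ : SemilinearAut R E) (q : ℚ) : Submodule K E :=
  Submodule.span K {v | ∃ M : Submodule R E, M.FG ∧ v ∈ M ∧ Φ ^ q.den • M = P ^ q.num • M}

theorem map_slopeSubspace_le {E' : Type*} [AddCommGroup E'] [Module K E'] [Module R E']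
    [IsScalarTower R K E'] (f : E' →ₗ[K] E) {P Φ : SemilinearAut R E} {P' Φ' : SemilinearAut R E'}
    (hP : Intertwines (f.restrictScalars R) P' P) (hΦ : Intertwines (f.restrictScalars R) Φ' Φ)
    (q : ℚ) : (slopeSubspace K P' Φ' q).map f ≤ slopeSubspace K P Φ q := by
  rw [slopeSubspace, Submodule.map_span_le]
  rintro v ⟨M, hM, hv, h⟩
  refine Submodule.subset_span ⟨M.map (f.restrictScalars R), hM.map _, ⟨v, hv, rfl⟩, ?_⟩
  rw [← (hΦ.pow _).map_smul, h, (hP.zpow _).map_smul]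

theorem slopeSubspace_eq_iff (hP : ∀ x, P.1 x = (p : R) • x) {Φ : SemilinearAut R E} {q : ℚ}
    {M : Submodule R E} :
    Φ ^ q.den • M = P ^ q.num • M ↔ (Φ ^ q.den * P ^ (-q.num)) • M = M := by
  rw [mul_smul, smul_zpow_smul_of_mul hP, zpow_neg, inv_smul_eq_iff]

variable [IsDomain R] [IsDiscreteValuationRing R] [IsFractionRing R K]

/-- The submodules that span the part of slope `q` already exhaust it. -/
theorem mem_slopeSubspace (hp : Irreducible (p : R)) (hP : ∀ x, P.1 x = (p : R) • x)
    {Φ : SemilinearAut R E} {q : ℚ} {v : E} :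
    v ∈ slopeSubspace K P Φ q ↔
      ∃ M : Submodule R E, M.FG ∧ v ∈ M ∧ Φ ^ q.den • M = P ^ q.num • M := by
  refine ⟨fun h => ?_, fun h => Submodule.subset_span h⟩
  induction h using Submodule.span_induction with
  | mem v h => exact h
  | zero =>
    refine ⟨⊥, Submodule.fg_bot, Submodule.zero_mem _, ?_⟩
    exact (map_bot (SemilinearAut.orderIso (Φ ^ q.den))).trans
      (map_bot (SemilinearAut.orderIso (P ^ q.num))).symm
  | add x y _ _ hx hy =>
    obtain ⟨M, hM, hxM, h⟩ := hx
    obtain ⟨M', hM', hxM', h'⟩ := hy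
    refine ⟨M ⊔ M', hM.sup hM', Submodule.add_mem_sup hxM hxM', ?_⟩
    rw [SemilinearAut.smul_sup, SemilinearAut.smul_sup, h, h']
  | smul c x _ hx =>
    obtain ⟨M, hM, hxM, h⟩ := hx
    obtain ⟨n, r, hr⟩ := exists_pow_mul_eq_algebraMap (K := K) hp c
    refine ⟨(P ^ n)⁻¹ • M, SemilinearAut.smul_fg _ hM, ?_, ?_⟩
    · rw [SemilinearAut.mem_smul, inv_inv, pow_apply_of_mul hP,
        ← algebraMap_smul K ((p : R) ^ n) (c • x), smul_smul, map_pow, hr, algebraMap_smul]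
      exact M.smul_mem _ hxM
    · rw [← zpow_natCast P, ← zpow_neg, smul_zpow_smul_of_mul hP, h, ← mul_smul, ← mul_smul,
        ← zpow_add, ← zpow_add, add_comm]

end Slopes

/-- The slope decomposition over a complete discrete valuation ring, by induction on the
dimension: split off the part of smallest slope. -/
theorem iSup_slopeSubspace_eq_top_of_finrank_eq {R K : Type*} [CommRing R] [IsDomain R]
    [IsDiscreteValuationRing R] [Field K] [Algebra R K] [IsFractionRing R K] {p : ℕ}
    [IsAdicComplete (Ideal.span {(p : R)}) R] (hp : Irreducible (p : R)) (n : ℕ) :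
    ∀ (E : Type u) [AddCommGroup E] [Module K E] [Module R E] [IsScalarTower R K E]
      [FiniteDimensional K E] (P Φ : SemilinearAut R E) (_ : ∀ x, P.1 x = (p : R) • x),
      Module.finrank K E = n → ⨆ q, slopeSubspace K P Φ q = ⊤ := by
  induction n using Nat.strong_induction_on with
  | _ n ih =>
  intro E _ _ _ _ _ P Φ hP hn
  rcases subsingleton_or_nontrivial E with hE | hE
  · exact Subsingleton.elim _ _
  obtain ⟨q, L, hL, hgL, hnil⟩ := exists_smallest_slope (K := K) hp hP Φ
  set g := Φ ^ q.den * P ^ (-q.num) with hg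
  have hcP : ∀ h : SemilinearAut R E, Commute P h := commute_of_mul hP
  have hcΦ : Commute Φ g :=
    ((Commute.refl Φ).pow_right _).mul_right ((hcP Φ).zpow_left _).symm
  set U := contractedPart K hp hP g L with hU
  have hstab : ∀ {h : SemilinearAut R E}, Commute h g → ∀ x ∈ U, h.1 x ∈ U :=
    fun hc x hx => contractedPart_stable hp hP hc hL hx
  have hUtop : U ≠ ⊤ := by
    intro h
    have h1 : ∀ x ∈ L, ∃ m : ℕ, ∀ k ≥ m, (g ^ k).1 x ∈ P • L := fun x _ => by
      have h2 : x ∈ U := by rw [h]; trivial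
      simpa using h2 1
    obtain ⟨s, hs⟩ := hL.fg
    choose! m hm using h1
    refine hnil (s.sup m) ?_
    conv_lhs => rw [← hs]
    rw [SemilinearAut.smul_le_iff, Submodule.span_le]
    intro x hx
    rw [SetLike.mem_coe, SemilinearAut.mem_smul, inv_inv]
    exact hm x (hs ▸ Submodule.subset_span hx) _ (Finset.le_sup hx)
  let PU := P.restrict U (hstab (hcP g)) (hstab (hcP g).inv_left)
  let ΦU := Φ.restrict U (hstab hcΦ) (hstab hcΦ.inv_left)
  have hIH : ⨆ q, slopeSubspace K PU ΦU q = ⊤ :=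
    ih (Module.finrank K U) (hn ▸ Submodule.finrank_lt hUtop) U PU ΦU
      (fun x => Subtype.ext (hP x)) rfl
  have hU_le : U ≤ ⨆ q, slopeSubspace K P Φ q := by
    have h1 := congrArg (Submodule.map U.subtype) hIH
    rw [Submodule.map_iSup, Submodule.map_top, Submodule.range_subtype] at h1
    rw [← h1]
    exact iSup_mono fun q => map_slopeSubspace_le U.subtype (fun _ => rfl) (fun _ => rfl) q
  -- the complement of `U` is spanned by the intersection of the images of `L`
  let L₁ : Submodule R E := ⨅ m : ℕ, g ^ m • L
  have hL₁ : L₁ ≤ L := (iInf_le _ 0).trans (by simp)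
  have hL₁fg : L₁.FG := by
    have : Module.Finite R L := Module.Finite.iff_fg.2 hL.fg
    have : IsNoetherian R L₁ := isNoetherian_of_le hL₁
    exact Module.Finite.iff_fg.1 inferInstance
  have hgL₁ : g • L₁ = L₁ := by
    apply le_antisymm
    · refine le_iInf fun m => ?_
      refine (SemilinearAut.smul_le_smul g (iInf_le _ m)).trans ?_
      rw [← mul_smul, ← pow_succ']
      exact SemilinearAut.pow_smul_anti hgL (Nat.le_succ m)
    · rw [SemilinearAut.smul_iInf]
      refine le_iInf fun m => (iInf_le _ (m + 1)).trans ?_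
      rw [pow_succ', mul_smul]
  rw [eq_top_iff, ← hL.span_eq_top, Submodule.span_le]
  intro x hx
  obtain ⟨z, hz, hxz⟩ := exists_fitting hp hP g hL hgL hx
  rw [← add_sub_cancel z x]
  refine Submodule.add_mem _ (Submodule.mem_iSup_of_mem q ?_) (hU_le hxz)
  exact Submodule.subset_span ⟨L₁, hL₁fg, (Submodule.mem_iInf _).2 hz,
    (slopeSubspace_eq_iff hP).2 hgL₁⟩

section Independence

variable {R K E : Type*} [CommRing R] [IsDomain R] [IsDiscreteValuationRing R] [Field K]
  [Algebra R K] [IsFractionRing R K] [AddCommGroup E] [Module K E] [Module R E]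
  [IsScalarTower R K E] {p : ℕ} {P Φ : SemilinearAut R E}

/-- If `t` is greater than `s = c / d`, then the powers of `p ^ (-c) Φ ^ d` tend to zero on the part
of slope `t`. -/
theorem slopeSubspace_le_contractedPart (hp : Irreducible (p : R))
    (hP : ∀ x, P.1 x = (p : R) • x) {L : Submodule R E} (hL : L.IsLattice K) {s t : ℚ}
    (hst : s < t) : slopeSubspace K P Φ t ≤
      contractedPart K hp hP (Φ ^ s.den * P ^ (-s.num)) L := by
  rw [slopeSubspace, Submodule.span_le]
  rintro v ⟨M, hM, hv, hΦM⟩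
  set g := Φ ^ s.den * P ^ (-s.num) with hg
  have h1 : g ^ t.den • M ≤ P • M := by
    have h2 : (Φ ^ t.den * P ^ (-t.num)) ^ s.den • M = M := by
      have h3 := (slopeSubspace_eq_iff hP).1 hΦM
      induction s.den with
      | zero => simp
      | succ n ih => rw [pow_succ, mul_smul, h3, ih]
    rw [hg, pow_mul_zpow_neg_pow hP Φ s.num t.num s.den t.den, mul_smul, h2]
    have h4 : s.num * t.den < t.num * s.den := Rat.lt_iff _ _ |>.1 hst
    refine (zpow_smul_anti_of_mul hP M (m := 1) (by linarith)).trans ?_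
    rw [zpow_one]
  have h2 : ∀ i : ℕ, (g ^ t.den) ^ i • M ≤ P ^ i • M := by
    intro i
    induction i with
    | zero => simp
    | succ i ih =>
      rw [pow_succ', pow_succ, mul_smul, mul_smul]
      refine (SemilinearAut.smul_le_smul _ ih).trans ?_
      rw [smul_pow_smul_of_mul hP]
      exact SemilinearAut.smul_le_smul _ h1
  obtain ⟨C, hC⟩ := exists_forall_lt_pow_smul_le hp hP g hM hL t.den
  intro N
  refine ⟨t.den * (N + C), fun k hk => ?_⟩
  obtain ⟨r, i, hr, rfl⟩ : ∃ r i, r < t.den ∧ k = r + t.den * i :=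
    ⟨k % t.den, k / t.den, Nat.mod_lt _ t.pos, (Nat.mod_add_div k _).symm⟩
  have hi : N + C ≤ i := by
    by_contra! hlt
    have h3 : t.den * (i + 1) ≤ t.den * (N + C) := Nat.mul_le_mul_left _ hlt
    rw [Nat.mul_succ] at h3
    omega
  have h3 : P ^ C • g ^ (r + t.den * i) • M ≤ P ^ i • L := by
    rw [pow_add, pow_mul, mul_smul]
    refine (SemilinearAut.smul_le_smul _ (SemilinearAut.smul_le_smul _ (h2 i))).trans ?_
    rw [smul_pow_smul_of_mul hP (g ^ r), smul_pow_smul_of_mul hP (P ^ C)]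
    exact SemilinearAut.smul_le_smul _ (hC r hr)
  have h4 := h3.trans (pow_smul_anti_of_mul hP L hi)
  rw [add_comm N C, pow_add P, mul_smul (P ^ C), SemilinearAut.smul_le_smul_iff] at h4
  exact h4 (SemilinearAut.apply_mem_smul.2 hv)

/-- Every vector of slope `s = c / d` lies in a finitely generated submodule that `p ^ (-c) Φ ^ d`
maps onto itself, so that the powers of this automorphism tend to zero on no vector but `0`. -/
theorem slopeSubspace_inf_contractedPart (hp : Irreducible (p : R))
    (hP : ∀ x, P.1 x = (p : R) • x) {L : Submodule R E} (hL : L.IsLattice K) {s : ℚ} {v : E}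
    (hv : v ∈ slopeSubspace K P Φ s)
    (hv' : v ∈ contractedPart K hp hP (Φ ^ s.den * P ^ (-s.num)) L) : v = 0 := by
  obtain ⟨M, hM, hvM, hΦM⟩ := (mem_slopeSubspace hp hP).1 hv
  set g := Φ ^ s.den * P ^ (-s.num) with hg
  have hgM : ∀ k : ℕ, g ^ k • M = M := by
    intro k
    induction k with
    | zero => simp
    | succ k ih => rw [pow_succ, mul_smul, (slopeSubspace_eq_iff hP).1 hΦM, ih]
  -- the powers of `p` bring the saturation of `M` in `L` into `M`
  let T : Submodule R E := L ⊓ (Submodule.span K (M : Set E)).restrictScalars R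
  have hT : T.FG := by
    have : Module.Finite R L := Module.Finite.iff_fg.2 hL.fg
    have : IsNoetherian R T := isNoetherian_of_le (inf_le_left : T ≤ L)
    exact Module.Finite.iff_fg.1 inferInstance
  obtain ⟨c, hc⟩ := exists_pow_smul_le_of_forall (M := M) hP hT fun x hx =>
    exists_pow_apply_mem_of_mem_span (K := K) hp hP hx.2
  refine eq_zero_of_forall_mem_pow_smul hp hP hM fun N => ?_
  obtain ⟨k, hk⟩ := hv' (N + c)
  obtain ⟨y, hy, hyv⟩ := hk k le_rfl
  have h1 : (g ^ k).1 v ∈ M := by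
    rw [← hgM k]
    exact SemilinearAut.apply_mem_smul.2 hvM
  have h2 : y ∈ T := ⟨hy, mem_span_of_pow_apply_mem hp hP (n := N + c) (hyv.symm ▸ h1)⟩
  have h3 : (g ^ k).1 v ∈ P ^ N • M := by
    rw [← hyv, pow_add, SemilinearAut.mul_apply, SemilinearAut.apply_mem_smul]
    exact hc (SemilinearAut.apply_mem_smul.2 h2)
  rw [← hgM k, ← smul_pow_smul_of_mul hP, SemilinearAut.apply_mem_smul] at h3
  exact h3

/-- Subspaces indexed by a linear order are independent if, for each `s`, those with larger index lie
in a subspace `U s` that meets the one with index `s` trivially. -/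
theorem iSupIndep_of_linearOrder {ι : Type*} [LinearOrder ι] {f U : ι → Submodule K E}
    (h1 : ∀ s t, s < t → f t ≤ U s) (h2 : ∀ s, ∀ v ∈ f s, v ∈ U s → v = 0) : iSupIndep f := by
  rw [iSupIndep_iff_finsetSum_eq_zero_imp_eq_zero]
  intro T
  induction T using Finset.induction_on_min with
  | empty => intro v _ _ i hi; simp at hi
  | insert a T ha ih =>
    intro v hv hsum
    have haT : a ∉ T := fun h => lt_irrefl _ (ha a h)
    rw [Finset.sum_insert haT] at hsum
    have h3 : v a = 0 := by
      refine h2 a _ (hv a (Finset.mem_insert_self _ _)) ?_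
      rw [eq_neg_of_add_eq_zero_left hsum]
      exact Submodule.neg_mem _ (Submodule.sum_mem _ fun i hi =>
        h1 a i (ha i hi) (hv i (Finset.mem_insert_of_mem hi)))
    rw [h3, zero_add] at hsum
    intro i hi
    rcases Finset.mem_insert.1 hi with rfl | hi
    · exact h3
    · exact ih v (fun j hj => hv j (Finset.mem_insert_of_mem hj)) hsum i hi

theorem iSupIndep_slopeSubspace [FiniteDimensional K E] (hp : Irreducible (p : R))
    (hP : ∀ x, P.1 x = (p : R) • x) : iSupIndep (slopeSubspace K P Φ) := by
  obtain ⟨L, hL⟩ := exists_isLattice (R := R) (K := K) (E := E)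
  exact iSupIndep_of_linearOrder
    (U := fun s => contractedPart K hp hP (Φ ^ s.den * P ^ (-s.num)) L)
    (fun s t h => slopeSubspace_le_contractedPart hp hP hL h)
    (fun s v hv hv' => slopeSubspace_inf_contractedPart hp hP hL hv hv')

end Independence

/-! ### The degree formula -/

section Degree

variable {R K E : Type*} [CommRing R] [IsDomain R] [IsDiscreteValuationRing R] [Field K]
  [Algebra R K] [IsFractionRing R K] [AddCommGroup E] [Module K E] [Module R E]
  [IsScalarTower R K E] {p : ℕ} {P Φ : SemilinearAut R E}

omit [IsDomain R] [IsDiscreteValuationRing R] in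
theorem pow_smul_eq_zpow_smul (hP : ∀ x, P.1 x = (p : R) • x) {g : SemilinearAut R E}
    {M : Submodule R E} {c : ℤ} (h : g • M = P ^ c • M) (m : ℕ) :
    g ^ m • M = P ^ (c * m) • M := by
  induction m with
  | zero => simp
  | succ m ih =>
    rw [pow_succ', mul_smul, ih, smul_zpow_smul_of_mul hP, h, ← mul_smul, ← zpow_add]
    congr 2
    push_cast
    ring

/-- If `Φ` has a stable lattice, its slopes are nonnegative. -/
theorem nonneg_of_pow_smul_eq (hp : Irreducible (p : R)) (hP : ∀ x, P.1 x = (p : R) • x)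
    {L : Submodule R E} (hL : L.IsLattice K) (hΦ : Φ • L ≤ L) {M : Submodule R E} (hM : M.FG)
    (hM0 : M ≠ ⊥) {d : ℕ} {c : ℤ} (h : Φ ^ d • M = P ^ c • M) : 0 ≤ c := by
  by_contra! hc
  obtain ⟨e, he⟩ := exists_pow_smul_le hp hP hM hL
  have h1 : P ^ e • M = ⊥ := by
    rw [eq_bot_iff]
    intro x hx
    refine eq_zero_of_forall_mem_pow_smul hp hP hL.fg fun m => ?_
    have h2 : P ^ (c * m) • P ^ e • M ≤ L := by
      rw [smul_pow_smul_of_mul hP (P ^ (c * m)),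
        ← pow_smul_eq_zpow_smul hP h m, ← smul_pow_smul_of_mul hP ((Φ ^ d) ^ m)]
      exact (SemilinearAut.smul_le_smul _ he).trans
        (SemilinearAut.pow_smul_le (SemilinearAut.pow_smul_le hΦ d) m)
    rw [SemilinearAut.smul_le_iff, ← zpow_neg] at h2
    rw [← zpow_natCast]
    exact zpow_smul_anti_of_mul hP L (by nlinarith) (h2 hx)
  apply hM0
  rw [eq_bot_iff]
  intro x hx
  have h2 := SemilinearAut.apply_mem_smul (g := P ^ e).2 hx
  rw [h1, Submodule.mem_bot, map_eq_zero_iff _ (P ^ e).1.injective] at h2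
  exact h2

/-- The upper bound is the lower bound for `p Φ⁻¹`, whose slopes are the `1 - q`. -/
theorem slope_mem_Icc (hp : Irreducible (p : R)) (hP : ∀ x, P.1 x = (p : R) • x)
    {L : Submodule R E} (hL : L.IsLattice K) (hΦ : Φ • L ≤ L) (hV : P • Φ⁻¹ • L ≤ L) {q : ℚ}
    (hq : slopeSubspace K P Φ q ≠ ⊥) : 0 ≤ q ∧ q ≤ 1 := by
  obtain ⟨v, hv, hv0⟩ := (Submodule.ne_bot_iff _).1 hq
  obtain ⟨M, hM, hvM, h⟩ := (mem_slopeSubspace hp hP).1 hv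
  have hM0 : M ≠ ⊥ := fun h0 => hv0 (by rw [h0] at hvM; exact hvM)
  constructor
  · exact Rat.num_nonneg.1 (nonneg_of_pow_smul_eq hp hP hL hΦ hM hM0 h)
  · have h1 : (P * Φ⁻¹) ^ q.den • M = P ^ ((q.den : ℤ) - q.num) • M := by
      rw [(commute_of_mul hP Φ⁻¹).mul_pow, mul_smul, sub_eq_add_neg, zpow_add, mul_smul,
        zpow_natCast]
      congr 1
      rw [inv_pow, inv_smul_eq_iff, smul_zpow_smul_of_mul hP, h, ← mul_smul, ← zpow_add,
        neg_add_cancel, zpow_zero, one_smul]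
    have h2 := nonneg_of_pow_smul_eq hp hP hL (Φ := P * Φ⁻¹) (by rw [mul_smul]; exact hV) hM hM0 h1
    have h3 : (q.num : ℚ) ≤ q.den := by exact_mod_cast sub_nonneg.1 h2
    rw [← Rat.num_div_den q]
    exact (div_le_one (by exact_mod_cast q.pos)).2 h3

/-- The part of slope `q = a / b` has a lattice `M` with `Φ ^ b M = p ^ a M`. -/
theorem exists_fg_span_eq_slopeSubspace [FiniteDimensional K E] (q : ℚ)
    (hp : Irreducible (p : R)) (hP : ∀ x, P.1 x = (p : R) • x) :
    ∃ M : Submodule R E, M.FG ∧ Submodule.span K (M : Set E) = slopeSubspace K P Φ q ∧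
      Φ ^ q.den • M = P ^ q.num • M := by
  let b := Module.finBasis K (slopeSubspace K P Φ q)
  choose M hM hbM h using fun i => (mem_slopeSubspace hp hP).1 (b i).2
  refine ⟨⨆ i, M i, Submodule.fg_iSup _ hM, ?_, ?_⟩
  · apply le_antisymm
    · rw [Submodule.span_le]
      have h1 : ⨆ i, M i ≤ (slopeSubspace K P Φ q).restrictScalars R :=
        iSup_le fun i x hx => Submodule.subset_span ⟨M i, hM i, hx, h i⟩
      exact h1
    · have h1 := congrArg (Submodule.map (slopeSubspace K P Φ q).subtype) b.span_eq
      rw [Submodule.map_span, Submodule.map_top, Submodule.range_subtype, ← Set.range_comp] at h1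
      refine h1.ge.trans (Submodule.span_le.2 ?_)
      rintro _ ⟨i, rfl⟩
      exact Submodule.subset_span (Submodule.mem_iSup_of_mem i (hbM i))
  · rw [SemilinearAut.smul_iSup, SemilinearAut.smul_iSup]
    exact iSup_congr h

/-- A finitely generated submodule that spans a subspace `U` is generated by a basis of `U`. -/
theorem exists_basis_span_eq (U : Submodule K E) {M : Submodule R E} (hM : M.FG)
    (hU : Submodule.span K (M : Set E) = U) :
    ∃ (n : ℕ) (e : Module.Basis (Fin n) K U),
      Submodule.span R (Set.range fun i => (e i : E)) = M := by
  have hMU : M ≤ U.restrictScalars R := fun x hx => hU ▸ Submodule.subset_span hx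
  let f : U →ₗ[R] E := U.subtype.restrictScalars R
  have hf : Function.Injective f := U.injective_subtype
  let N : Submodule R U := M.comap f
  have hN : N.map f = M := by
    rw [Submodule.map_comap_eq, inf_eq_right]
    rintro x hx
    exact ⟨⟨x, hMU hx⟩, rfl⟩
  have hNlat : N.IsLattice K := by
    refine ⟨Submodule.fg_of_fg_map_injective f hf (hN.symm ▸ hM), ?_⟩
    apply Submodule.map_injective_of_injective U.injective_subtype
    rw [Submodule.map_span, Submodule.map_top, Submodule.range_subtype]
    rw [← hN] at hU
    exact hU
  have : Module.Finite R N := Module.Finite.iff_fg.2 hNlat.fg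
  have : Module.Free R N := Submodule.IsLattice.free K N
  let b := Module.finBasis R N
  refine ⟨_, b.extendOfIsLattice K, ?_⟩
  have h := congrArg (Submodule.map (f.comp N.subtype)) b.span_eq
  rw [Submodule.map_span, Submodule.map_top, LinearMap.range_comp, Submodule.range_subtype, hN,
    ← Set.range_comp] at h
  refine Eq.trans ?_ h
  congr 2
  funext i
  exact congrArg f (Module.Basis.extendOfIsLattice_apply K b i)

omit [IsDomain R] [IsDiscreteValuationRing R] in
theorem relLength_pow {g : SemilinearAut R E} {L : Submodule R E} (h : g • L ≤ L) (n : ℕ) :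
    relLength (g ^ n • L) L = n * relLength (g • L) L := by
  induction n with
  | zero =>
    rw [pow_zero, one_smul, Nat.cast_zero, zero_mul, relLength, Module.length_eq_zero_iff,
      Submodule.comap_subtype_self, Submodule.Quotient.subsingleton_iff]
  | succ n ih =>
    have h1 : g ^ (n + 1) • L ≤ g ^ n • L := SemilinearAut.pow_smul_anti h (Nat.le_succ n)
    rw [relLength_add h1 (SemilinearAut.pow_smul_le h n), ih, pow_succ, mul_smul,
      relLength_smul _ h]
    push_cast
    ring

/-- For an automorphism `Φ` with a lattice `L` that is stable under `Φ` and `p Φ⁻¹`, there are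
finitely many slopes, all in `[0, 1]`; the sum of the multiplicities is the dimension and the sum
of the slopes is the length of `L / Φ L`. -/
theorem exists_finset_slopes {R K : Type*} [CommRing R] [IsDomain R]
    [IsDiscreteValuationRing R] [Field K] [Algebra R K] [IsFractionRing R K]
    {E : Type u} [AddCommGroup E] [Module K E] [Module R E] [IsScalarTower R K E]
    [FiniteDimensional K E] {p : ℕ} [IsAdicComplete (Ideal.span {(p : R)}) R]
    (hp : Irreducible (p : R)) {P Φ : SemilinearAut R E} (hP : ∀ x, P.1 x = (p : R) • x)
    {L : Submodule R E} (hL : L.IsLattice K) (hΦ : Φ • L ≤ L) (hV : P • Φ⁻¹ • L ≤ L) :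
    ∃ (T : Finset ℚ) (c : ℕ), (∀ q, q ∈ T ↔ slopeSubspace K P Φ q ≠ ⊥) ∧
      (∀ q ∈ T, 0 ≤ q ∧ q ≤ 1) ∧
      ∑ q ∈ T, Module.finrank K (slopeSubspace K P Φ q) = Module.finrank K E ∧
      relLength (Φ • L) L = c ∧
      ∑ q ∈ T, q * Module.finrank K (slopeSubspace K P Φ q) = c := by
  classical
  set S := slopeSubspace K P Φ with hS
  have hind : iSupIndep S := iSupIndep_slopeSubspace hp hP
  have hfin : {q | S q ≠ ⊥}.Finite := WellFoundedGT.finite_ne_bot_of_iSupIndep hind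
  let T := hfin.toFinset
  have hT : ∀ q, q ∈ T ↔ S q ≠ ⊥ := fun q => by simp [T]
  have h01 : ∀ q ∈ T, 0 ≤ q ∧ q ≤ 1 := fun q hq => slope_mem_Icc hp hP hL hΦ hV ((hT q).1 hq)
  have hint : DirectSum.IsInternal fun q : T => S q := by
    refine DirectSum.isInternal_submodule_of_iSupIndep_of_iSup_eq_top
      (hind.comp Subtype.val_injective) ?_
    rw [eq_top_iff, ← iSup_slopeSubspace_eq_top_of_finrank_eq hp _ E P Φ hP rfl]
    refine iSup_le fun q => ?_
    by_cases hq : q ∈ T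
    · exact le_iSup (fun q : T => S q) ⟨q, hq⟩
    · rw [hT, not_not] at hq
      change S q ≤ _
      rw [hq]
      exact bot_le
  choose M hM hMS hΦM using fun q => exists_fg_span_eq_slopeSubspace (K := K) (Φ := Φ) q hp hP
  choose n β hβ using fun q => exists_basis_span_eq (S q) (hM q) (hMS q)
  have hn : ∀ q, Module.finrank K (S q) = n q := fun q => by
    rw [Module.finrank_eq_card_basis (β q), Fintype.card_fin]
  let e := hint.collectedBasis fun q : T => β q
  have he : ∀ a, e a = β a.1 a.2 := fun a => congrFun (hint.collectedBasis_coe _) a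
  -- a power of `Φ` multiplies each part of the lattice spanned by `e` by a power of `p`
  let B := ∏ q ∈ T, q.den
  have hB : 0 < B := Finset.prod_pos fun q _ => q.pos
  have hBq : ∀ q ∈ T, ∃ a : ℕ, (a : ℚ) = q * B ∧ Φ ^ B • M q = P ^ a • M q := by
    intro q hq
    obtain ⟨k, hk⟩ := Finset.dvd_prod_of_mem (fun q : ℚ => q.den) hq
    have h0 : 0 ≤ q.num := Rat.num_nonneg.2 (h01 q hq).1
    refine ⟨q.num.toNat * k, ?_, ?_⟩
    · have h1 : ((q.num.toNat : ℤ) : ℚ) = q.num := by rw [Int.toNat_of_nonneg h0]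
      have h2 : (B : ℚ) = q.den * k := by exact_mod_cast hk
      rw [h2, ← mul_assoc, Rat.mul_den_eq_num]
      push_cast at h1 ⊢
      rw [h1]
    · change Φ ^ (∏ q ∈ T, q.den) • M q = _
      rw [hk, pow_mul, pow_smul_eq_zpow_smul hP (hΦM q), ← zpow_natCast]
      congr 2
      push_cast
      rw [Int.toNat_of_nonneg h0]
  choose! a ha hΦa using hBq
  let L' := Submodule.span R (Set.range e)
  have hL'sup : ∀ b : ℚ → ℕ, Submodule.span R (Set.range fun i => (p : R) ^ b i.1 • e i) =
      ⨆ q : T, P ^ b q • M q := by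
    intro b
    rw [Set.range_sigma_eq_iUnion_range, Submodule.span_iUnion]
    refine iSup_congr fun q => ?_
    rw [← hβ q, pow_smul_span_range hP]
    simp only [he]
  have hL'eq : L' = ⨆ q : T, M q := by
    have := hL'sup fun _ => 0
    simpa using this
  have hΦL' : Φ ^ B • L' = Submodule.span R (Set.range fun i => (p : R) ^ a i.1 • e i) := by
    rw [hL'sup a, hL'eq, SemilinearAut.smul_iSup]
    exact iSup_congr fun q => hΦa q q.2
  have hL'lat : L'.IsLattice K := by
    refine ⟨Submodule.fg_span (Set.finite_range e), ?_⟩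
    rw [Submodule.span_span_of_tower, e.span_eq]
  have hΦL'le : Φ ^ B • L' ≤ L' := by
    rw [hΦL', Submodule.span_le]
    rintro _ ⟨i, rfl⟩
    exact Submodule.smul_mem _ _ (Submodule.subset_span ⟨i, rfl⟩)
  have hlen : relLength (Φ ^ B • L) L = ∑ i : (q : T) × Fin (n q), (a i.1 : ℕ∞) := by
    rw [relLength_smul_self_eq hp hP (Φ ^ B) hL hL'lat (SemilinearAut.pow_smul_le hΦ B) hΦL'le,
      hΦL', relLength_span_basis hp e fun i => a i.1]
  have hsum : ∑ i : (q : T) × Fin (n q), a i.1 = ∑ q ∈ T, n q * a q := by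
    rw [Fintype.sum_sigma, ← Finset.sum_coe_sort T]
    refine Finset.sum_congr rfl fun q _ => ?_
    simp
  have hfinite : relLength (Φ • L) L ≠ ⊤ := by
    intro h
    rw [relLength_pow hΦ, h, ENat.mul_top (by exact_mod_cast hB.ne')] at hlen
    have : ((∑ i : (q : T) × Fin (n q), a i.1 : ℕ) : ℕ∞) = ⊤ := by
      rw [hlen]; push_cast; rfl
    exact ENat.natCast_ne_top _ this
  obtain ⟨c, hc⟩ := ENat.ne_top_iff_exists.1 hfinite
  refine ⟨T, c, hT, h01, ?_, hc.symm, ?_⟩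
  · rw [Module.finrank_eq_card_basis e, Fintype.card_sigma, ← Finset.sum_coe_sort T]
    exact Finset.sum_congr rfl fun q _ => by rw [hn, Fintype.card_fin]
  · rw [relLength_pow hΦ, ← hc] at hlen
    have h1 : B * c = ∑ q ∈ T, n q * a q := by
      rw [← hsum]; exact_mod_cast hlen
    have h2 : (B : ℚ) * c = ∑ q ∈ T, n q * (q * B) := by
      rw [← Finset.sum_congr rfl fun q hq => by rw [← ha q hq]]
      exact_mod_cast h1
    have hB' : (B : ℚ) ≠ 0 := by exact_mod_cast hB.ne'
    apply mul_left_cancel₀ hB'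
    rw [h2, Finset.mul_sum]
    exact Finset.sum_congr rfl fun q _ => by rw [hn]; ring

end Degree

/-! ### Finiteness properties of coherent modules -/

section FiniteLength

variable {R Q : Type*} [CommRing R] [IsDomain R] [IsDiscreteValuationRing R] [AddCommGroup Q]
  [Module R Q]

theorem isFiniteLength_of_finite_of_smul_eq_zero {p : ℕ} (hp : Irreducible (p : R))
    [Module.Finite R Q] (h : ∀ x : Q, (p : R) • x = 0) : IsFiniteLength R Q := by
  obtain ⟨n, s, hs⟩ := Module.Finite.exists_fin (R := R) (M := Q)
  let f : Fin n → (R ⧸ Ideal.span {(p : R) ^ 1}) →ₗ[R] Q := fun i =>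
    Submodule.liftQ _ (LinearMap.toSpanSingleton R Q (s i)) (by
      rw [pow_one, Ideal.span, Submodule.span_le, Set.singleton_subset_iff]
      exact h (s i))
  let φ : (Fin n → R ⧸ Ideal.span {(p : R) ^ 1}) →ₗ[R] Q := LinearMap.lsum R _ ℕ f
  have hφ : Function.Surjective φ := by
    rw [← LinearMap.range_eq_top, eq_top_iff, ← hs, Submodule.span_le]
    rintro _ ⟨i, rfl⟩
    refine ⟨Pi.single i (Submodule.Quotient.mk 1), ?_⟩
    simp only [φ, f, LinearMap.lsum_piSingle]
    rw [Submodule.liftQ_apply, LinearMap.toSpanSingleton_apply, one_smul]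
  rw [← Module.length_ne_top_iff]
  refine ne_top_of_le_ne_top ?_ (Module.length_le_of_surjective φ hφ)
  rw [Module.length_pi_of_fintype]
  simp only [length_quotient_span_pow hp, Finset.sum_const, Finset.card_univ, Fintype.card_fin]
  exact_mod_cast ENat.natCast_ne_top (n * 1)

/-- The torsion-free quotient of `M` is finitely generated if the one of a submodule is and the
quotient module is either finitely generated or annihilated by a nonzero scalar. -/
theorem finite_quotient_torsion_of_exact {A M N : Type*} [AddCommGroup A] [Module R A]
    [AddCommGroup M] [Module R M] [AddCommGroup N] [Module R N] (f : A →ₗ[R] M) (g : M →ₗ[R] N)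
    (hfg : Function.Exact f g) (hg : Function.Surjective g)
    (hA : Module.Finite R (A ⧸ Submodule.torsion R A))
    (hN : Module.Finite R N ∨ ∃ c : R, c ≠ 0 ∧ ∀ x : N, c • x = 0) :
    Module.Finite R (M ⧸ Submodule.torsion R M) := by
  have htor : Submodule.torsion R A ≤ (Submodule.torsion R M).comap f := by
    intro x hx
    obtain ⟨a, ha⟩ := (Submodule.mem_torsion_iff x).1 hx
    exact (Submodule.mem_torsion_iff _).2 ⟨a, by
      rw [Submonoid.smul_def] at ha ⊢; rw [← map_smul, ha, map_zero]⟩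
  let f' := Submodule.mapQ _ _ f htor
  have hrange : ∀ a, Submodule.Quotient.mk (f a) ∈ LinearMap.range f' := fun a =>
    ⟨Submodule.Quotient.mk a, Submodule.mapQ_apply _ _ _ _⟩
  have hfr : (LinearMap.range f').FG := by
    rw [LinearMap.range_eq_map]
    exact (Module.finite_def.1 hA).map f'
  rcases hN with hN | ⟨c, hc, hN⟩
  · have hq : LinearMap.ker g ≤ LinearMap.ker
        ((LinearMap.range f').mkQ ∘ₗ (Submodule.torsion R M).mkQ) := by
      intro x hx
      obtain ⟨a, rfl⟩ := (hfg x).1 hx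
      rw [LinearMap.mem_ker, LinearMap.comp_apply, Submodule.mkQ_apply, Submodule.mkQ_apply]
      exact (Submodule.Quotient.mk_eq_zero _).2 (hrange a)
    have : Module.Finite R (M ⧸ LinearMap.ker g) :=
      Module.Finite.equiv (g.quotKerEquivOfSurjective hg).symm
    have : Module.Finite R ((M ⧸ Submodule.torsion R M) ⧸ LinearMap.range f') := by
      refine Module.Finite.of_surjective (Submodule.liftQ _ _ hq) ?_
      rw [← LinearMap.range_eq_top, Submodule.range_liftQ, LinearMap.range_eq_top]
      exact (Submodule.mkQ_surjective _).comp (Submodule.mkQ_surjective _)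
    have : Module.Finite R (LinearMap.range f') := Module.Finite.iff_fg.2 hfr
    exact Module.Finite.of_submodule_quotient (LinearMap.range f')
  · have : Module.Finite R (LinearMap.range f') := Module.Finite.iff_fg.2 hfr
    have hmem : ∀ x : M ⧸ Submodule.torsion R M, c • x ∈ LinearMap.range f' := by
      intro x
      obtain ⟨x, rfl⟩ := Submodule.Quotient.mk_surjective _ x
      obtain ⟨a, ha⟩ := (hfg (c • x)).1 (by rw [map_smul, hN])
      rw [← Submodule.Quotient.mk_smul, ← ha]
      exact hrange a
    let m : (M ⧸ Submodule.torsion R M) →ₗ[R] LinearMap.range f' :=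
      (LinearMap.lsmul R _ c).codRestrict _ hmem
    refine Module.Finite.of_injective m ?_
    intro x y hxy
    have h1 : c • x = c • y := congrArg Subtype.val hxy
    exact smul_right_injective _ hc h1

end FiniteLength

namespace RaynaudModule

variable {p : ℕ} [Fact p.Prime] {k : Type u} [Field k] [CharP k p]

omit [CharP k p] in
theorem exists_constantCoeff_eq (c : k) :
    ∃ a : WittVector p k, WittVector.constantCoeff a = c :=
  ⟨WittVector.teichmuller p c, WittVector.teichmuller_coeff_zero p c⟩

theorem finite_or_smul_eq_zero_of_elementary {N : RaynaudModule p k}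
    (hN : N.IsTypeI ∨ N.IsTypeII) (j : ℤ) :
    Module.Finite (WittVector p k) (N.X j) ∨ ∀ x : N.X j, (p : WittVector p k) • x = 0 := by
  rcases hN with ⟨h1, h2, -⟩ | ⟨l, e₀, e₁, h0, h1, h2, -⟩
  · left
    by_cases hj : j = 0
    · subst hj; exact h2
    · have := h1 j hj
      infer_instance
  · have hp : WittVector.constantCoeff (p : WittVector p k) = 0 := by
      rw [map_natCast, CharP.cast_eq_zero]
    by_cases hj : j = 0
    · subst hj
      right
      intro x
      apply e₀.injective
      funext n
      rw [h1, hp, zero_mul, map_zero, Pi.zero_apply]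
    · by_cases hj' : j = 1
      · subst hj'
        right
        intro x
        apply e₁.injective
        funext n
        rw [h2, hp, zero_mul, map_zero, Pi.zero_apply]
      · have := h0 j hj hj'
        left
        infer_instance

/-- In each degree, `N` is generated by a finitely generated `W(k)`-submodule and the images of
`d` and `V`. -/
def FiniteModDV (N : RaynaudModule p k) : Prop :=
  ∀ i j (h : i + 1 = j), ∃ S : Submodule (WittVector p k) (N.X j), S.FG ∧
    ∀ x : N.X j, ∃ y ∈ S, ∃ z w, x = y + N.d i j h z + N.V j w

theorem finiteModDV_of_elementary {N : RaynaudModule p k} (hN : N.IsTypeI ∨ N.IsTypeII) :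
    N.FiniteModDV := by
  have htriv : ∀ i j (h : i + 1 = j), Module.Finite (WittVector p k) (N.X j) →
      ∃ S : Submodule (WittVector p k) (N.X j), S.FG ∧
        ∀ x : N.X j, ∃ y ∈ S, ∃ z w, x = y + N.d i j h z + N.V j w := fun i j h hf =>
    ⟨⊤, Module.finite_def.1 hf, fun x => ⟨x, trivial, 0, 0, by simp⟩⟩
  intro i j h
  rcases hN with ⟨h1, h2, -⟩ | ⟨l, e₀, e₁, h0, h1, h2, -, hV0, hV, -, -, hd⟩
  · apply htriv
    by_cases hj : j = 0
    · subst hj; exact h2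
    · have := h1 j hj
      infer_instance
  · by_cases hj : j = 0
    · subst hj
      -- `N⁰ / V N⁰` is generated by `V⁰`
      refine ⟨Submodule.span _ {e₀.symm (Pi.single 0 1)}, Submodule.fg_span_singleton _,
        fun x => ?_⟩
      obtain ⟨a, ha⟩ := exists_constantCoeff_eq (p := p) (e₀ x 0)
      refine ⟨a • e₀.symm (Pi.single 0 1), Submodule.smul_mem _ _
        (Submodule.mem_span_singleton_self _), 0,
        e₀.symm fun n => e₀ x (n + 1) ^ p, ?_⟩
      apply e₀.injective
      funext n
      rw [map_zero, add_zero, map_add, Pi.add_apply, h1, ha, AddEquiv.apply_symm_apply]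
      rcases n with _ | n
      · rw [hV0, Pi.single_eq_same, mul_one, add_zero]
      · rw [Pi.single_eq_of_ne (Nat.succ_ne_zero n), mul_zero, zero_add]
        apply frobenius_inj k p
        rw [frobenius_def, frobenius_def, hV, AddEquiv.apply_symm_apply]
    · by_cases hj' : j = 1
      · obtain rfl : i = 0 := by omega
        subst hj'
        -- `N¹ / d N⁰` is generated by the `d Vⁿ` with `l ≤ n < 0`
        refine ⟨Submodule.span _ (Set.range fun t : Fin (-l).toNat => e₁.symm (Pi.single t 1)),
          Submodule.fg_span (Set.finite_range _), fun x => ?_⟩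
        choose a ha using fun n => exists_constantCoeff_eq (p := p) (e₁ x n)
        refine ⟨∑ t : Fin (-l).toNat, a t • e₁.symm (Pi.single t 1), Submodule.sum_mem _ fun t _ =>
          Submodule.smul_mem _ _ (Submodule.subset_span ⟨t, rfl⟩),
          e₀.symm fun t => if 0 ≤ (t : ℤ) - l then e₁ x ((t : ℤ) - l).toNat else 0, 0, ?_⟩
        apply e₁.injective
        funext n
        rw [map_zero, add_zero, map_add, Pi.add_apply, hd, AddEquiv.apply_symm_apply, map_sum,
          Finset.sum_apply]
        simp only [h2, ha, AddEquiv.apply_symm_apply]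
        by_cases hn : 0 ≤ l + n
        · have hln : (l + (n : ℤ) - l).toNat = n := by omega
          rw [if_pos hn, Int.toNat_of_nonneg hn, if_pos (by omega), hln, Finset.sum_eq_zero,
            zero_add]
          intro t _
          rw [Pi.single_eq_of_ne (by have := t.2; omega), mul_zero]
        · rw [if_neg hn, add_zero, Finset.sum_eq_single ⟨n, by omega⟩]
          · rw [Pi.single_eq_same, mul_one]
          · intro t _ ht
            rw [Pi.single_eq_of_ne (fun h => ht (Fin.ext h.symm)), mul_zero]
          · exact fun h => (h (Finset.mem_univ _)).elim
      · have := h0 j hj hj'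
        exact htriv _ _ _ inferInstance

theorem FiniteModDV.shift {N : RaynaudModule p k} (hN : N.FiniteModDV) (n : ℤ) :
    (N.shift n).FiniteModDV := by
  intro i j h
  obtain ⟨S, hS, hS'⟩ := hN (n + i) (n + j) (by rw [← h, add_assoc])
  refine ⟨S, hS, fun x => ?_⟩
  obtain ⟨y, hy, z, w, hx⟩ := hS' x
  refine ⟨y, hy, (n.negOnePow : ℤ) • z, w, ?_⟩
  have h1 : (N.shift n).d i j h ((n.negOnePow : ℤ) • z) =
      N.d (n + i) (n + j) (by rw [← h, add_assoc]) z := by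
    change (n.negOnePow : ℤ) • N.d (n + i) (n + j) _ ((n.negOnePow : ℤ) • z) = _
    rw [map_zsmul, smul_smul, ← Units.val_mul, Int.units_mul_self, Units.val_one, one_smul]
  rw [h1]
  exact hx

/-- `V d = p d V`. -/
theorem V_d (M : RaynaudModule p k) (i j : ℤ) (h : i + 1 = j) (x : M.X i) :
    M.V j (M.d i j h x) = (p : WittVector p k) • M.d i j h (M.V i x) := by
  rw [← M.F_d_V, M.V_F]

variable [PerfectRing k p]

/-- The image of `d` is contained in `V^{-∞} Z`, because `Vⁿ d` takes values in the image of `d`. -/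
theorem d_mem_vInftyZ (M : RaynaudModule p k) (i j : ℤ) (h : i + 1 = j) (x : M.X i) :
    M.d i j h x ∈ M.vInftyZ j := by
  have key : ∀ n : ℕ, ∃ y : M.X i, (M.V j)^[n] (M.d i j h x) = M.d i j h y := by
    intro n
    induction n with
    | zero => exact ⟨x, rfl⟩
    | succ n ih =>
      obtain ⟨y, hy⟩ := ih
      refine ⟨(p : WittVector p k) • M.V i y, ?_⟩
      rw [Function.iterate_succ_apply', hy, V_d, M.d_smul]
  intro n
  obtain ⟨y, hy⟩ := key n
  rw [hy, M.d_d]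

theorem map_mem_vInftyZ {A M : RaynaudModule p k} (f : A ⟶ M) {i : ℤ} {x : A.X i}
    (hx : x ∈ A.vInftyZ i) : f.f i x ∈ M.vInftyZ i := by
  intro n
  have h1 : ∀ n : ℕ, (M.V i)^[n] (f.f i x) = f.f i ((A.V i)^[n] x) := by
    intro n
    induction n with
    | zero => rfl
    | succ n ih => rw [Function.iterate_succ_apply', Function.iterate_succ_apply', ih, f.comm_V]
  rw [h1, ← f.comm_d, hx n, map_zero]

omit [PerfectRing k p] in
theorem smul_mem_rangeV (M : RaynaudModule p k) (i : ℤ) (x : M.X i) :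
    (p : WittVector p k) • x ∈ M.rangeV i := ⟨M.F i x, M.V_F i x⟩

theorem smul_mem_rangeF (M : RaynaudModule p k) (i : ℤ) (x : M.X i) :
    (p : WittVector p k) • x ∈ M.rangeF i := ⟨M.V i x, M.F_V i x⟩

/-- The image of `A` in `M / (V^{-∞} Z + V M)` has finite length. The quotient by it is a quotient of
`N / (d N + V N)`, since the image of `d` is contained in `V^{-∞} Z`. -/
theorem isFiniteLength_dominoCokerV_of_exact {A M N : RaynaudModule p k} (f : A ⟶ M) (g : M ⟶ N)
    (i : ℤ) (hfg : Function.Exact (f.f i) (g.f i)) (hg : ∀ i, Function.Surjective (g.f i))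
    (hN : N.FiniteModDV) (hA : IsFiniteLength (WittVector p k) (A.DominoCokerV i)) :
    IsFiniteLength (WittVector p k) (M.DominoCokerV i) := by
  set S := M.vInftyZ i ⊔ M.rangeV i with hS
  have hAS : A.vInftyZ i ⊔ A.rangeV i ≤ S.comap (f.f i) := by
    refine sup_le (fun x hx => le_sup_left (a := M.vInftyZ i) (map_mem_vInftyZ f hx)) ?_
    rintro _ ⟨x, rfl⟩
    exact le_sup_right (a := M.vInftyZ i) ⟨f.f i x, (f.comm_V i x).symm⟩
  let α : A.DominoCokerV i →ₗ[WittVector p k] (M.X i ⧸ S) := Submodule.mapQ _ _ (f.f i) hAS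
  -- the cokernel of `α` is finitely generated and annihilated by `p`
  have hfin : Module.Finite (WittVector p k) ((M.X i ⧸ S) ⧸ LinearMap.range α) := by
    obtain ⟨_, ⟨s, rfl⟩, hT⟩ := hN (i - 1) i (sub_add_cancel i 1)
    choose lift hlift using hg i
    let q : M.X i →ₗ[WittVector p k] (M.X i ⧸ S) ⧸ LinearMap.range α :=
      (LinearMap.range α).mkQ ∘ₗ S.mkQ
    have hq : Function.Surjective q :=
      (Submodule.mkQ_surjective _).comp (Submodule.mkQ_surjective _)
    have hqS : ∀ x ∈ S, q x = 0 := fun x hx => by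
      have : S.mkQ x = 0 := by rw [Submodule.mkQ_apply]; exact (Submodule.Quotient.mk_eq_zero _).2 hx
      rw [LinearMap.comp_apply, this, map_zero]
    have hqf : ∀ a, q (f.f i a) = 0 := fun a => by
      rw [LinearMap.comp_apply, Submodule.mkQ_apply, Submodule.mkQ_apply]
      exact (Submodule.Quotient.mk_eq_zero _).2
        ⟨Submodule.Quotient.mk a, Submodule.mapQ_apply _ _ _ _⟩
    refine Module.finite_def.2 ?_
    have htop : (⊤ : Submodule (WittVector p k) _) =
        (Submodule.span (WittVector p k) (lift '' (s : Set (N.X i)))).map q := by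
      symm
      rw [eq_top_iff]
      intro x _
      obtain ⟨x, rfl⟩ := hq x
      obtain ⟨y, hy, z, w, hx⟩ := hT (g.f i x)
      have hy' : y ∈ (Submodule.span (WittVector p k) (lift '' (s : Set (N.X i)))).map (g.f i) := by
        rw [Submodule.map_span, Set.image_image]
        simpa only [hlift, Set.image_id'] using hy
      obtain ⟨y', hy', rfl⟩ := hy'
      obtain ⟨z', rfl⟩ := hg _ z
      obtain ⟨w', rfl⟩ := hg _ w
      have h1 : g.f i (x - (y' + M.d (i - 1) i (sub_add_cancel i 1) z' + M.V i w')) = 0 := by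
        rw [map_sub, map_add, map_add, g.comm_d, g.comm_V, hx, sub_self]
      obtain ⟨a, ha⟩ := (hfg _).1 h1
      refine ⟨y', hy', ?_⟩
      rw [eq_comm, ← sub_eq_zero, ← map_sub]
      have h2 : x - y' = f.f i a + (M.d (i - 1) i (sub_add_cancel i 1) z' + M.V i w') := by
        rw [ha]; abel
      rw [h2, map_add, hqf, zero_add]
      exact hqS _ (Submodule.add_mem_sup (d_mem_vInftyZ M _ _ _ _) ⟨w', rfl⟩)
    rw [htop]
    exact (Submodule.fg_span (s.finite_toSet.image _)).map _
  have hcoker : IsFiniteLength (WittVector p k) ((M.X i ⧸ S) ⧸ LinearMap.range α) := by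
    refine isFiniteLength_of_finite_of_smul_eq_zero (WittVector.irreducible p) fun x => ?_
    obtain ⟨x, rfl⟩ := Submodule.Quotient.mk_surjective _ x
    obtain ⟨x, rfl⟩ := Submodule.Quotient.mk_surjective _ x
    rw [← Submodule.Quotient.mk_smul, ← Submodule.Quotient.mk_smul,
      (Submodule.Quotient.mk_eq_zero S).2 (le_sup_right (a := M.vInftyZ i) (M.smul_mem_rangeV i x)),
      Submodule.Quotient.mk_zero]
  rw [isFiniteLength_iff_isNoetherian_isArtinian] at hA hcoker ⊢
  obtain ⟨_, _⟩ := hA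
  obtain ⟨_, _⟩ := hcoker
  have hex : LinearMap.range α = LinearMap.ker (LinearMap.range α).mkQ :=
    (Submodule.ker_mkQ _).symm
  exact ⟨isNoetherian_of_range_eq_ker _ _ hex, isArtinian_of_range_eq_ker _ _ hex⟩

theorem IsCoherent.isFiniteLength_dominoCokerV {M : RaynaudModule p k} (hM : M.IsCoherent)
    (i : ℤ) : IsFiniteLength (WittVector p k) (M.DominoCokerV i) := by
  induction hM with
  | zero M h =>
    have := h i
    exact .of_subsingleton
  | extension A M N n f g hA hN _ hfg hg ih =>
    exact isFiniteLength_dominoCokerV_of_exact f g i (hfg i) hg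
      ((finiteModDV_of_elementary hN).shift n) ih

theorem IsCoherent.finite_quotient_torsion {M : RaynaudModule p k} (hM : M.IsCoherent)
    (i : ℤ) : Module.Finite (WittVector p k)
      (M.X i ⧸ Submodule.torsion (WittVector p k) (M.X i)) := by
  induction hM with
  | zero M h =>
    have := h i
    infer_instance
  | extension A M N n f g hA hN _ hfg hg ih =>
    refine finite_quotient_torsion_of_exact (f.f i) (g.f i) (hfg i) (hg i) ih ?_
    rcases finite_or_smul_eq_zero_of_elementary hN (n + i) with h | h
    · exact Or.inl h
    · exact Or.inr ⟨p, (WittVector.irreducible p).ne_zero, h⟩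

omit [PerfectRing k p] in
theorem IsCoherent.finite_nontrivial {M : RaynaudModule p k} (hM : M.IsCoherent) :
    {i | ¬ Subsingleton (M.X i)}.Finite := by
  induction hM with
  | zero M h => simp [h]
  | extension A M N n f g hA hN hf hfg hg ih =>
    refine (ih.union (Set.toFinite {-n, 1 - n})).subset fun i hi => ?_
    by_contra hcon
    simp only [Set.mem_union, Set.mem_ofPred_eq, not_or, not_not, Set.mem_insert_iff,
      Set.mem_singleton_iff] at hcon
    obtain ⟨hAi, h1, h2⟩ := hcon
    have hNi : Subsingleton (N.X (n + i)) := by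
      rcases hN with ⟨h, -⟩ | ⟨_, _, _, h, -⟩
      · exact h _ (by omega)
      · exact h _ (by omega) (by omega)
    refine hi ⟨fun x y => ?_⟩
    have hzero : ∀ x : M.X i, x = 0 := fun x => by
      obtain ⟨a, rfl⟩ := (hfg i x).1 (hNi.elim _ _)
      rw [hAi.elim a 0, map_zero]
    rw [hzero x, hzero y]

theorem IsCoherent.isFiniteLength_cokerV {M : RaynaudModule p k} (hM : M.IsCoherent)
    (i : ℤ) : IsFiniteLength (WittVector p k) (M.CokerV i) := by
  have := hM.finite_quotient_torsion i
  have : Module.Finite (WittVector p k) (M.CokerV i) :=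
    Module.Finite.of_surjective (Submodule.factor le_sup_left) (Submodule.factor_surjective _)
  refine isFiniteLength_of_finite_of_smul_eq_zero (WittVector.irreducible p) fun x => ?_
  obtain ⟨x, rfl⟩ := Submodule.Quotient.mk_surjective _ x
  rw [← Submodule.Quotient.mk_smul]
  exact (Submodule.Quotient.mk_eq_zero _).2 (Submodule.mem_sup_right (M.smul_mem_rangeV i x))

theorem IsCoherent.isFiniteLength_cokerF {M : RaynaudModule p k} (hM : M.IsCoherent)
    (i : ℤ) : IsFiniteLength (WittVector p k) (M.CokerF i) := by
  have := hM.finite_quotient_torsion i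
  have : Module.Finite (WittVector p k) (M.CokerF i) :=
    Module.Finite.of_surjective (Submodule.factor le_sup_left) (Submodule.factor_surjective _)
  refine isFiniteLength_of_finite_of_smul_eq_zero (WittVector.irreducible p) fun x => ?_
  obtain ⟨x, rfl⟩ := Submodule.Quotient.mk_surjective _ x
  rw [← Submodule.Quotient.mk_smul]
  exact (Submodule.Quotient.mk_eq_zero _).2 (Submodule.mem_sup_right (M.smul_mem_rangeF i x))

end RaynaudModule

/-! ### The isocrystal of a coherent module -/

theorem length_quotient_ker_sup {R X E : Type*} [CommRing R] [AddCommGroup X] [Module R X]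
    [AddCommGroup E] [Module R E] (f : X →ₗ[R] E) (S : Submodule R X) :
    Module.length R (X ⧸ (LinearMap.ker f ⊔ S)) = relLength (S.map f) (LinearMap.range f) := by
  let q := ((S.map f).comap (LinearMap.range f).subtype).mkQ ∘ₗ f.rangeRestrict
  have hq : Function.Surjective q :=
    (Submodule.mkQ_surjective _).comp f.surjective_rangeRestrict
  have hker : LinearMap.ker q = LinearMap.ker f ⊔ S := by
    rw [LinearMap.ker_comp, Submodule.ker_mkQ, ← Submodule.comap_comp,
      LinearMap.subtype_comp_codRestrict, Submodule.comap_map_eq, sup_comm]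
  rw [← hker]
  exact (q.quotKerEquivOfSurjective hq).length_eq

section TensorLattice

variable {R K X : Type*} [CommRing R] [Field K] [Algebra R K] [IsFractionRing R K]
  [AddCommGroup X] [Module R X]

/-- The kernel of `x ↦ 1 ⊗ x` is the torsion submodule, `K ⊗ X` being a localization of `X`. -/
theorem ker_mk_one_eq_torsion :
    LinearMap.ker (TensorProduct.mk R K X 1) = Submodule.torsion R X := by
  have := (isLocalizedModule_iff_isBaseChange (nonZeroDivisors R) K
    (TensorProduct.mk R K X 1)).2 (TensorProduct.isBaseChange R X K)
  ext x
  rw [LinearMap.mem_ker, IsLocalizedModule.eq_zero_iff (nonZeroDivisors R),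
    Submodule.mem_torsion_iff]

variable (R K X) in
theorem isLattice_range_mk_one [Module.Finite R (X ⧸ Submodule.torsion R X)] :
    (LinearMap.range (TensorProduct.mk R K X 1)).IsLattice K where
  fg := by
    have h := Submodule.range_liftQ (Submodule.torsion R X) (TensorProduct.mk R K X 1)
      ker_mk_one_eq_torsion.ge
    rw [← h]
    exact Submodule.fg_range _
  span_eq_top := by
    rw [eq_top_iff]
    intro y _
    induction y using TensorProduct.induction_on with
    | zero => exact Submodule.zero_mem _
    | tmul c x =>
      rw [← mul_one c, ← smul_eq_mul, ← TensorProduct.smul_tmul']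
      exact Submodule.smul_mem _ _ (Submodule.subset_span ⟨x, rfl⟩)
    | add y z hy hz => exact Submodule.add_mem _ (hy trivial) (hz trivial)

theorem length_quotient_torsion_sup (S : Submodule R X) :
    Module.length R (X ⧸ (Submodule.torsion R X ⊔ S)) =
      relLength (S.map (TensorProduct.mk R K X 1)) (LinearMap.range (TensorProduct.mk R K X 1)) := by
  rw [← ker_mk_one_eq_torsion (K := K)]
  exact length_quotient_ker_sup _ _

end TensorLattice

namespace RaynaudModule

variable {p : ℕ} [Fact p.Prime] {k : Type u} [Field k] [CharP k p] [PerfectRing k p]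

/-- The map `σ ⊗ F` on `K ⊗ Mⁱ`, as a semilinear automorphism over `W(k)`. -/
def frobAut (M : RaynaudModule p k) (i : ℤ) : SemilinearAut (WittVector p k) (M.Rational i) where
  toEquiv :=
    { M.rationalF i with
      invFun := M.rationalFInv i
      left_inv := M.rationalFInv_rationalF i
      right_inv := M.rationalF_rationalFInv i }
  exists_map_smul := ⟨WittVector.frobeniusEquiv p k, fun a x => by
    change M.rationalF i (a • x) = WittVector.frobenius a • M.rationalF i x
    rw [← algebraMap_smul K(p, k) a x, M.rationalF_smul, frobenius_algebraMap, algebraMap_smul]⟩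

/-- Multiplication by `p` on `K ⊗ Mⁱ`, as a semilinear automorphism over `W(k)`. -/
def mulAut (M : RaynaudModule p k) (i : ℤ) : SemilinearAut (WittVector p k) (M.Rational i) where
  toEquiv :=
    { toFun := fun x => (p : K(p, k)) • x
      invFun := fun x => (p : K(p, k))⁻¹ • x
      left_inv := inv_smul_smul₀ (WittVector.FractionRing.p_nonzero p k)
      right_inv := smul_inv_smul₀ (WittVector.FractionRing.p_nonzero p k)
      map_add' := smul_add _ }
  exists_map_smul := ⟨RingEquiv.refl _, fun a x => smul_comm (p : K(p, k)) a x⟩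

theorem mulAut_apply (M : RaynaudModule p k) (i : ℤ) (x : M.Rational i) :
    (M.mulAut i).1 x = (p : WittVector p k) • x := by
  rw [← algebraMap_smul K(p, k) (p : WittVector p k) x, map_natCast]
  rfl

omit [PerfectRing k p] in
theorem mulAut_zpow_apply (M : RaynaudModule p k) (i n : ℤ) (x : M.Rational i) :
    (M.mulAut i ^ n).1 x = (p : K(p, k)) ^ n • x := by
  have hp := WittVector.FractionRing.p_nonzero p k
  induction n generalizing x with
  | zero => simp
  | succ n ih =>
    rw [zpow_add_one, SemilinearAut.mul_apply, ih, zpow_add_one₀ hp, mul_smul]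
    rfl
  | pred n ih =>
    rw [zpow_sub_one, SemilinearAut.mul_apply, ih, zpow_sub_one₀ hp, mul_smul]
    rfl

theorem frobAut_pow_apply (M : RaynaudModule p k) (i : ℤ) (n : ℕ) (x : M.Rational i) :
    (M.frobAut i ^ n).1 x =
      (WittVector.Isocrystal.frobenius p k (V := M.Rational i)).toFun^[n] x := by
  induction n generalizing x with
  | zero => rfl
  | succ n ih =>
    rw [pow_succ, SemilinearAut.mul_apply, ih, Function.iterate_succ_apply]
    rfl

theorem slopePart_eq_slopeSubspace (M : RaynaudModule p k) (i : ℤ) (s : ℚ) :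
    slopePart p k (M.Rational i) s = slopeSubspace K(p, k) (M.mulAut i) (M.frobAut i) s := by
  have key : ∀ L : Submodule (WittVector p k) (M.Rational i),
      M.frobAut i ^ s.den • L = M.mulAut i ^ s.num • L ↔
        (WittVector.Isocrystal.frobenius p k (V := M.Rational i)).toFun^[s.den] ''
          (L : Set (M.Rational i)) = (fun x => (p : K(p, k)) ^ s.num • x) '' L := fun L => by
    rw [← SetLike.coe_set_eq, SemilinearAut.coe_smul, SemilinearAut.coe_smul,
      ← funext (M.frobAut_pow_apply i s.den), ← funext (M.mulAut_zpow_apply i s.num)]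
  rw [slopePart, slopeSubspace]
  simp only [key]

/-- The slopes of the isocrystal of a coherent module and their multiplicities, compared with the
lengths of `Mⁱ / (Mⁱ_tors + V Mⁱ)` and `Mⁱ / (Mⁱ_tors + F Mⁱ)`: with the lattice `L` that is the
image of `Mⁱ`, the latter is the length of `L / F L`, the degree of the isocrystal, and both
lengths add up to the length of `L / p L`, the rank. -/
theorem IsCoherent.exists_finset_slopes {M : RaynaudModule p k} (hM : M.IsCoherent) (i : ℤ) :
    Module.Finite K(p, k) (M.Rational i) ∧
    ∃ (T : Finset ℚ) (c v : ℕ),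
      (∀ q, q ∈ T ↔ M.slopeMultiplicity i q ≠ 0) ∧ (∀ q ∈ T, 0 ≤ q ∧ q ≤ 1) ∧
      Module.length (WittVector p k) (M.CokerV i) = v ∧
      Module.length (WittVector p k) (M.CokerF i) = c ∧
      ∑ q ∈ T, M.slopeMultiplicity i q = v + c ∧ ∑ q ∈ T, q * M.slopeMultiplicity i q = c := by
  have hp := WittVector.irreducible p (k := k)
  have := hM.finite_quotient_torsion i
  set f := TensorProduct.mk (WittVector p k) K(p, k) (M.X i) 1 with hf
  set L := LinearMap.range f with hL
  have hlat : L.IsLattice K(p, k) := isLattice_range_mk_one _ _ _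
  have hfin : Module.Finite K(p, k) (M.Rational i) := by
    obtain ⟨s, hs⟩ := hlat.fg
    refine ⟨s, ?_⟩
    rw [eq_top_iff, ← hlat.span_eq_top, ← hs, Submodule.span_span_of_tower]
  refine ⟨hfin, ?_⟩
  have hP := M.mulAut_apply i
  have hfF : ∀ x, (M.frobAut i).1 (f x) = f (M.F i x) := fun x => by
    change M.rationalF i (1 ⊗ₜ x) = 1 ⊗ₜ M.F i x
    rw [rationalF_tmul, map_one]
  have hfV : ∀ x, (M.mulAut i * (M.frobAut i)⁻¹).1 (f x) = f (M.V i x) := fun x => by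
    rw [SemilinearAut.mul_apply, hP]
    change (p : WittVector p k) • M.rationalFInv i (1 ⊗ₜ x) = 1 ⊗ₜ M.V i x
    rw [rationalFInv_tmul, map_one, ← TensorProduct.tmul_smul, mul_p_tmul]
  have himage : ∀ (g : SemilinearAut (WittVector p k) (M.Rational i)) (S : Submodule _ (M.X i))
      (t : M.X i →+ M.X i), (∀ x, g.1 (f x) = f (t x)) → (S : Set (M.X i)) = Set.range t →
      g • L = S.map f := fun g S t hg hS => by
    apply SetLike.coe_injective
    rw [SemilinearAut.coe_smul, Submodule.map_coe, hS, hL, LinearMap.coe_range, ← Set.range_comp,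
      ← Set.range_comp]
    exact congrArg Set.range (funext hg)
  have hFL : M.frobAut i • L = (M.rangeF i).map f := himage _ _ (M.F i) hfF rfl
  have hVL : (M.mulAut i * (M.frobAut i)⁻¹) • L = (M.rangeV i).map f :=
    himage _ _ (M.V i) hfV rfl
  have hF : M.frobAut i • L ≤ L := hFL.trans_le (LinearMap.map_le_range)
  have hV : M.mulAut i • (M.frobAut i)⁻¹ • L ≤ L := by
    rw [← mul_smul]
    exact hVL.trans_le (LinearMap.map_le_range)
  obtain ⟨T, c, hT, h01, hsum, hc, hdeg⟩ := _root_.exists_finset_slopes hp hP hlat hF hV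
  have hcF : Module.length (WittVector p k) (M.CokerF i) = c := by
    rw [length_quotient_torsion_sup (K := K(p, k)), ← hf, ← hFL, hc]
  have hcV : Module.length (WittVector p k) (M.CokerV i) + c =
      (Module.finrank K(p, k) (M.Rational i) : ℕ) := by
    have h1 := relLength_pow_smul hp hP hlat 1
    rw [pow_one, mul_one] at h1
    -- `L / V L` is isomorphic to `F L / p L`
    have h2 := relLength_smul (M.frobAut i) hV
    rw [smul_smul_of_mul hP, smul_inv_smul] at h2
    rw [length_quotient_torsion_sup (K := K(p, k)), ← hf, ← hVL, mul_smul, ← h2, ← hc, ← h1]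
    refine (relLength_add ?_ hF).symm
    rw [← smul_inv_smul (M.frobAut i) (M.mulAut i • L), smul_smul_of_mul hP]
    exact SemilinearAut.smul_le_smul _ hV
  obtain ⟨v, hv⟩ := ENat.ne_top_iff_exists.1
    (Module.length_ne_top_iff.2 (hM.isFiniteLength_cokerV i))
  rw [← hv] at hcV
  have hcV : v + c = Module.finrank K(p, k) (M.Rational i) := by exact_mod_cast hcV
  have hmult : ∀ q, M.slopeMultiplicity i q =
      Module.finrank K(p, k) (slopeSubspace K(p, k) (M.mulAut i) (M.frobAut i) q) := fun q => by
    rw [slopeMultiplicity, slopePart_eq_slopeSubspace]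
  refine ⟨T, c, v, fun q => ?_, h01, hv.symm, hcF, ?_, ?_⟩
  · rw [hT, hmult, Ne, Ne, Submodule.finrank_eq_zero]
  · rw [hcV, ← hsum]
    exact Finset.sum_congr rfl fun q _ => hmult q
  · rw [← hdeg]
    exact Finset.sum_congr rfl fun q _ => by rw [hmult]

end RaynaudModule

/-! ### Summation -/

/-- Summation by parts for finitely supported families, with respect to a permutation `S` of the
index set. -/
theorem finsum_mul_second_difference {α : Type*} (S : Equiv.Perm α) (W : α → ℚ) {A B C : α → ℚ}
    (hA : A.support.Finite) (hB : B.support.Finite) (hC : C.support.Finite) :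
    ∑ᶠ q, W q * (A q + B (S q) + C q - 2 * C (S q) + C (S (S q))) =
      ∑ᶠ q, (W q - 2 * W (S.symm q) + W (S.symm (S.symm q))) * C q +
        ∑ᶠ q, (W q * A q + W (S.symm q) * B q) := by
  have fin : ∀ {D : α → ℚ} (U : α → ℚ), D.support.Finite →
      (fun q => U q * D q).HasFiniteSupport := fun U hD =>
    hD.subset fun q hq => right_ne_zero_of_mul hq
  have fS : ∀ {D : α → ℚ}, D.support.Finite → (fun q => D (S q)).support.Finite := fun hD =>
    hD.preimage S.injective.injOn
  have hS : ∀ U D : α → ℚ, ∑ᶠ q, U q * D (S q) = ∑ᶠ q, U (S.symm q) * D q := fun U D => by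
    rw [← finsum_comp_equiv S (f := fun q => U (S.symm q) * D q)]
    simp only [Equiv.symm_apply_apply]
  have h1 : ∀ q, W q * (A q + B (S q) + C q - 2 * C (S q) + C (S (S q))) =
      W q * A q + W q * B (S q) + W q * C q + (-2 * W q) * C (S q) + W q * C (S (S q)) :=
    fun q => by ring
  have h2 : ∀ q, (W q - 2 * W (S.symm q) + W (S.symm (S.symm q))) * C q =
      W q * C q + (-2 * W (S.symm q)) * C q + W (S.symm (S.symm q)) * C q := fun q => by ring
  have a1 := fin W hA
  have a2 := fin W (fS hB)
  have a3 := fin W hC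
  have a4 := fin (fun q => -2 * W q) (fS hC)
  simp only [h1, h2]
  rw [finsum_add_distrib (((a1.fun_add a2).fun_add a3).fun_add a4) (fin W (fS (fS hC))),
    finsum_add_distrib ((a1.fun_add a2).fun_add a3) a4, finsum_add_distrib (a1.fun_add a2) a3,
    finsum_add_distrib a1 a2, finsum_add_distrib (a3.fun_add (fin (fun q => -2 * W (S.symm q)) hC))
      (fin _ hC), finsum_add_distrib a3 (fin (fun q => -2 * W (S.symm q)) hC),
    finsum_add_distrib a1 (fin _ hB), hS W B, hS (fun q => -2 * W q) C,
    hS W fun q => C (S q), hS (fun q => W (S.symm q)) C]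
  ring

namespace RaynaudModule

variable {p : ℕ} [Fact p.Prime] {k : Type u} [Field k] [CharP k p] [PerfectRing k p]

section Subsingleton

variable (M : RaynaudModule p k) (i : ℤ) [Subsingleton (M.X i)]

omit [PerfectRing k p] in
theorem length_cokerV_of_subsingleton : Module.length (WittVector p k) (M.CokerV i) = 0 :=
  Module.length_eq_zero

theorem length_cokerF_of_subsingleton : Module.length (WittVector p k) (M.CokerF i) = 0 :=
  Module.length_eq_zero

theorem dominoNumber_of_subsingleton : M.dominoNumber i = 0 := by
  rw [dominoNumber, Module.length_eq_zero]
  rfl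

theorem slopeMultiplicity_of_subsingleton (s : ℚ) : M.slopeMultiplicity i s = 0 := by
  have : Subsingleton (M.Rational i) := inferInstance
  exact Module.finrank_zero_of_subsingleton

end Subsingleton

theorem IsCoherent.finite_slopes {M : RaynaudModule p k} (hM : M.IsCoherent) (i : ℤ) :
    {s | M.slopeMultiplicity i s ≠ 0}.Finite := by
  obtain ⟨-, T, -, -, hT, -⟩ := hM.exists_finset_slopes i
  exact T.finite_toSet.subset fun q hq => (hT q).2 hq

/-- The slopes of the isocrystal lie between `0` and `1`, so that the sum over the slopes that are
at most `N` is empty (or contributes zero) for `N ≤ 0` and runs over all slopes for `N ≥ 1`. -/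
theorem IsCoherent.finsum_slopes {M : RaynaudModule p k} (hM : M.IsCoherent) (i N : ℤ) :
    ∑ᶠ (s : ℚ) (_ : s ≤ N), (M.slopeMultiplicity i s : ℚ) * (N - s) =
      (max N 0 : ℤ) * ((Module.length (WittVector p k) (M.CokerV i)).toNat : ℚ) +
        (max (N - 1) 0 : ℤ) * ((Module.length (WittVector p k) (M.CokerF i)).toNat : ℚ) := by
  obtain ⟨-, T, c, v, hT, h01, hv, hc, hsum, hdeg⟩ := hM.exists_finset_slopes i
  rw [hv, hc, ENat.toNat_natCast, ENat.toNat_natCast]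
  rcases le_or_gt N 0 with hN | hN
  · have h0 : ∀ s : ℚ, s ≤ N → (M.slopeMultiplicity i s : ℚ) * (N - s) = 0 := fun s hs => by
      by_cases hm : M.slopeMultiplicity i s = 0
      · rw [hm, Nat.cast_zero, zero_mul]
      · have h1 := (h01 s ((hT s).2 hm)).1
        have h2 : (N : ℚ) ≤ 0 := by exact_mod_cast hN
        rw [show (N : ℚ) - s = 0 by linarith, mul_zero]
    rw [max_eq_right hN, max_eq_right (by omega)]
    simp +contextual [h0]
  · have hN1 : (1 : ℚ) ≤ N := by exact_mod_cast hN
    have h1 : ∀ s : ℚ, (∑ᶠ (_ : s ≤ N), (M.slopeMultiplicity i s : ℚ) * (N - s)) =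
        (M.slopeMultiplicity i s : ℚ) * (N - s) := fun s => by
      by_cases hm : M.slopeMultiplicity i s = 0
      · simp [hm]
      · exact finsum_eq_if.trans (if_pos ((h01 s ((hT s).2 hm)).2.trans hN1))
    have hsum' : ∑ q ∈ T, (M.slopeMultiplicity i q : ℚ) = v + c := by exact_mod_cast hsum
    rw [max_eq_left hN.le, max_eq_left (by omega), finsum_congr h1,
      finsum_eq_sum_of_support_subset (s := T) _ fun s hs => (hT s).2 fun h => hs (by simp [h])]
    have h2 : ∀ s, (M.slopeMultiplicity i s : ℚ) * (N - s) =
        N * M.slopeMultiplicity i s - s * M.slopeMultiplicity i s := fun s => by ring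
    simp only [h2]
    rw [Finset.sum_sub_distrib, ← Finset.mul_sum, hsum', hdeg]
    push_cast
    ring

end RaynaudModule

namespace CoherentComplex

open RaynaudModule

variable {p : ℕ} [Fact p.Prime] {k : Type u} [Field k] [CharP k p]
  [HasDerivedCategory.{w} (RaynaudModule p k)]

theorem Dbc.finite_nontrivial {M : DerivedCategory (RaynaudModule p k)} (hM : Dbc p k M) :
    {q : ℤ × ℤ | ¬ Subsingleton ((H M q.2).X q.1)}.Finite := by
  obtain ⟨⟨a, b, h⟩, hc⟩ := hM
  refine ((Set.finite_Icc a b).biUnion fun j _ =>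
    (hc j).finite_nontrivial.image fun i => (i, j)).subset ?_
  rintro ⟨i, j⟩ hij
  refine Set.mem_biUnion (x := j) ?_ ⟨i, hij, rfl⟩
  by_contra hj
  have hz := h j (by rw [Set.mem_Icc] at hj; omega)
  refine hij (subsingleton_of_forall_eq 0 fun x => ?_)
  exact congrArg (fun φ => Hom.f φ i x) (hz.eq_of_src (𝟙 _) 0)

theorem Dbc.finite_support {M : DerivedCategory (RaynaudModule p k)} (hM : Dbc p k M)
    {f : ℤ × ℤ → ℚ} (hf : ∀ q, Subsingleton ((H M q.2).X q.1) → f q = 0) :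
    f.support.Finite :=
  hM.finite_nontrivial.subset fun q hq h => hq (hf q h)

variable [PerfectRing k p]

theorem Dbc.finite_slopes {M : DerivedCategory (RaynaudModule p k)} (hM : Dbc p k M) :
    {q : ℤ × ℤ × ℚ | (H M q.2.1).slopeMultiplicity q.1 q.2.2 ≠ 0}.Finite := by
  refine (hM.finite_nontrivial.biUnion fun q _ =>
    ((hM.2 q.2).finite_slopes q.1).image fun s => (q.1, q.2, s)).subset ?_
  rintro ⟨i, j, s⟩ hs
  refine Set.mem_biUnion (x := (i, j)) (fun h => hs ?_) ⟨s, hs, rfl⟩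
  have : Subsingleton ((H M j).X i) := h
  exact slopeMultiplicity_of_subsingleton _ _ _

/-- The shift `(i, j) ↦ (i - 1, j + 1)` along an antidiagonal. -/
def antidiagonalShift : Equiv.Perm (ℤ × ℤ) :=
  (Equiv.subRight 1).prodCongr (Equiv.addRight 1)

variable (M : DerivedCategory (RaynaudModule p k))

/-- The contribution of `V` to the slope number `m^{i,j}`. -/
def lengthCokerV (q : ℤ × ℤ) : ℚ :=
  (Module.length (WittVector p k) ((H M q.2).CokerV q.1)).toNat

/-- The contribution of `F` to the slope number `m^{i+1,j-1}`. -/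
def lengthCokerF (q : ℤ × ℤ) : ℚ :=
  (Module.length (WittVector p k) ((H M q.2).CokerF q.1)).toNat

/-- The family of the `T^{i,j}`, as rational numbers. -/
def domino (q : ℤ × ℤ) : ℚ := T M q.1 q.2

theorem hodgeWitt_eq (q : ℤ × ℤ) : (hodgeWitt M q.1 q.2 : ℚ) =
    lengthCokerV M q + lengthCokerF M (antidiagonalShift q) + domino M q -
      2 * domino M (antidiagonalShift q) + domino M (antidiagonalShift (antidiagonalShift q)) := by
  have h : antidiagonalShift (antidiagonalShift q) = (q.1 - 2, q.2 + 2) :=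
    Prod.ext (by change q.1 - 1 - 1 = q.1 - 2; ring) (by change q.2 + 1 + 1 = q.2 + 2; ring)
  rw [h, hodgeWitt, slopeNumber]
  push_cast
  rfl

variable {M}

omit [PerfectRing k p] in
theorem Dbc.finite_support_lengthCokerV (hM : Dbc p k M) :
    (lengthCokerV M).support.Finite :=
  hM.finite_support fun q _ => by
    rw [lengthCokerV, length_cokerV_of_subsingleton]; rfl

theorem Dbc.finite_support_lengthCokerF (hM : Dbc p k M) :
    (lengthCokerF M).support.Finite :=
  hM.finite_support fun q _ => by
    rw [lengthCokerF, length_cokerF_of_subsingleton]; rfl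

theorem Dbc.finite_support_domino (hM : Dbc p k M) : (domino M).support.Finite :=
  hM.finite_support fun q _ => by
    rw [domino, T, dominoNumber_of_subsingleton, Nat.cast_zero]

theorem Dbc.finite_hodgeWitt (hM : Dbc p k M) :
    {q : ℤ × ℤ | hodgeWitt M q.1 q.2 ≠ 0}.Finite := by
  have hC := hM.finite_support_domino
  refine ((((hM.finite_support_lengthCokerV.union
    (hM.finite_support_lengthCokerF.preimage antidiagonalShift.injective.injOn)).union hC).union
    (hC.preimage antidiagonalShift.injective.injOn)).union
    (hC.preimage (antidiagonalShift.trans antidiagonalShift).injective.injOn)).subset fun q hq => ?_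
  by_contra h
  simp only [Set.mem_union, Set.mem_preimage, Function.mem_support, not_or, not_not,
    Equiv.trans_apply] at h
  obtain ⟨⟨⟨⟨h1, h2⟩, h3⟩, h4⟩, h5⟩ := h
  apply hq
  rw [← Int.cast_eq_zero (α := ℚ), hodgeWitt_eq, h1, h2, h3, h4, h5]
  norm_num

/-- The sum over the slopes in `e_r`, in terms of the lengths of the cokernels of `V` and `F`. -/
theorem Dbc.finsum_slopes (hM : Dbc p k M) (r : ℤ) :
    ∑ᶠ (q : ℤ × ℤ × ℚ) (_ : q.2.2 ≤ r - q.1),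
      (-1 : ℚ) ^ (q.1 + q.2.1) * ((H M q.2.1).slopeMultiplicity q.1 q.2.2 * (r - q.1 - q.2.2)) =
    ∑ᶠ q : ℤ × ℤ, (-1 : ℚ) ^ (q.1 + q.2) * ((max (r - q.1) 0 : ℤ) * lengthCokerV M q +
      (max (r - q.1 - 1) 0 : ℤ) * lengthCokerF M q) := by
  rw [← finsum_comp_equiv (Equiv.prodAssoc ℤ ℤ ℚ), finsum_curry]
  · refine finsum_congr fun q => ?_
    have h := (hM.2 q.2).finsum_slopes q.1 (r - q.1)
    push_cast at h
    rw [lengthCokerV, lengthCokerF]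
    push_cast
    rw [← h, mul_finsum']
    · refine finsum_congr fun s => ?_
      simp only [Equiv.prodAssoc_apply, finsum_eq_if, mul_ite, mul_zero]
    · refine ((hM.2 q.2).finite_slopes q.1).subset fun s hs hm => hs ?_
      simp [hm]
  · refine (hM.finite_slopes.preimage (Equiv.prodAssoc ℤ ℤ ℚ).injective.injOn).subset
      fun q hq hm => hq ?_
    simp only [Equiv.prodAssoc_apply] at hm ⊢
    simp [hm]

/-- The second difference of `max (r - i) 0` in `i` is concentrated at `i = r - 1`; it is the
coefficient that `T^{i,j}` gets in the sum of the Hodge-Witt numbers. -/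
theorem finsum_second_difference_mul_domino (M : DerivedCategory (RaynaudModule p k)) (r : ℤ) :
    ∑ᶠ q : ℤ × ℤ, ((-1 : ℚ) ^ (q.1 + q.2) * ((max (r - q.1) 0 : ℤ) -
      2 * (max (r - (q.1 + 1)) 0 : ℤ) + (max (r - (q.1 + 1 + 1)) 0 : ℤ))) * domino M q =
    ∑ᶠ j : ℤ, (-1 : ℚ) ^ (j - 1) * T M (r - 1) (j - r) := by
  let f : ℤ × ℤ → ℚ := fun q => (-1) ^ (q.1 + q.2) * domino M q
  have hinj : Function.Injective fun j : ℤ => (r - 1, j - r) := fun j j' h => by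
    simpa using congrArg Prod.snd h
  have h1 : ∀ j : ℤ, (-1 : ℚ) ^ (j - 1) * T M (r - 1) (j - r) =
      f (r - 1, j - r) := fun j => by
    simp only [f, domino]
    congr 2
    ring
  refine Eq.trans ?_ ((finsum_mem_range (f := f) hinj).trans (finsum_congr h1).symm)
  refine finsum_congr fun q => ?_
  classical
  simp only [f]
  rw [finsum_eq_if]
  by_cases hq : q.1 = r - 1
  · rw [if_pos ⟨q.2 + r, Prod.ext hq.symm (by simp)⟩, hq]
    simp
  · rw [if_neg (by rintro ⟨j, rfl⟩; exact hq rfl)]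
    have h2 : max (r - q.1) 0 - 2 * max (r - (q.1 + 1)) 0 + max (r - (q.1 + 1 + 1)) 0 = 0 := by
      omega
    have h3 := congrArg (Int.cast : ℤ → ℚ) h2
    rw [Int.cast_add, Int.cast_sub, Int.cast_mul, Int.cast_ofNat, Int.cast_zero] at h3
    rw [h3, mul_zero, zero_mul]

theorem Dbc.finsum_hodgeWitt (hM : Dbc p k M) (r : ℤ) :
    ∑ᶠ (q : ℤ × ℤ) (_ : q.1 ≤ r),
      (-1 : ℚ) ^ (q.1 + q.2) * ((r - q.1) * hodgeWitt M q.1 q.2) = e M r := by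
  rw [e, hM.finsum_slopes, ← finsum_second_difference_mul_domino]
  have h1 : ∀ q : ℤ × ℤ, (∑ᶠ (_ : q.1 ≤ r),
      (-1 : ℚ) ^ (q.1 + q.2) * ((r - q.1) * hodgeWitt M q.1 q.2)) =
      ((-1 : ℚ) ^ (q.1 + q.2) * (max (r - q.1) 0 : ℤ)) * hodgeWitt M q.1 q.2 := fun q => by
    rw [finsum_eq_if]
    split_ifs with h
    · rw [max_eq_left (by omega), Int.cast_sub, mul_assoc]
    · rw [max_eq_right (by omega), Int.cast_zero, mul_zero, zero_mul]
  rw [finsum_congr h1]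
  simp only [hodgeWitt_eq]
  rw [finsum_mul_second_difference antidiagonalShift
    (fun q => (-1 : ℚ) ^ (q.1 + q.2) * (max (r - q.1) 0 : ℤ)) hM.finite_support_lengthCokerV
    hM.finite_support_lengthCokerF hM.finite_support_domino]
  -- the sign is constant along antidiagonals
  have hsgn : ∀ q : ℤ × ℤ, q.1 + 1 + (q.2 - 1) = q.1 + q.2 := fun q => by ring
  have hS : ∀ q : ℤ × ℤ, antidiagonalShift.symm q = (q.1 + 1, q.2 - 1) := fun q => rfl
  congr 1
  · refine finsum_congr fun q => ?_
    rw [hS, hS, hsgn, hsgn, hsgn]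
    ring
  · refine finsum_congr fun q => ?_
    rw [hS, hsgn, ← sub_sub]
    ring

end CoherentComplex

end

open CoherentComplex in
theorem theorem2 (p : ℕ) [Fact p.Prime] (k : Type u) [Field k] [CharP k p] [PerfectRing k p]
    [HasDerivedCategory.{w} (RaynaudModule p k)]
    (M : DerivedCategory (RaynaudModule p k)) (hM : Dbc p k M) :
    -- all dimensions that occur are finite
    (∀ i j : ℤ,
      IsFiniteLength (WittVector p k) ((H M j).CokerV i) ∧
      IsFiniteLength (WittVector p k) ((H M j).CokerF i) ∧
      IsFiniteLength (WittVector p k) ((H M j).DominoCokerV i) ∧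
      Module.Finite K(p, k) ((H M j).Rational i)) ∧
    -- all sums that occur are finite
    {q : ℤ × ℤ | hodgeWitt M q.1 q.2 ≠ 0}.Finite ∧
    {q : ℤ × ℤ | T M q.1 q.2 ≠ 0}.Finite ∧
    {q : ℤ × ℤ × ℚ | (H M q.2.1).slopeMultiplicity q.1 q.2.2 ≠ 0}.Finite ∧
    ∀ r : ℤ, ∑ᶠ (q : ℤ × ℤ) (_ : q.1 ≤ r),
      (-1 : ℚ) ^ (q.1 + q.2) * ((r - q.1) * hodgeWitt M q.1 q.2) = e M r := by
  refine ⟨fun i j => ?_, hM.finite_hodgeWitt, ?_, hM.finite_slopes, hM.finsum_hodgeWitt⟩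
  · have h := hM.2 j
    exact ⟨h.isFiniteLength_cokerV i, h.isFiniteLength_cokerF i, h.isFiniteLength_dominoCokerV i,
      (h.exists_finset_slopes i).1⟩
  · exact hM.finite_support_domino.subset fun q hq => Nat.cast_ne_zero.2 hq
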